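/- Let $d\ge 1$ and let $X=(X_k)_{k\in\mathbb Z^d}$ be a real random field with finite second moments that is second-order stationary, with covariance function $r$. For $n\ge1$ and $t\in[0,1]^d$ put $A_n(t)=\mathbb Z^d\cap\prod_{i=1}^d[1,\lfloor (n-1)t_i\rfloor+1]$ and $A_n=A_n(1)=\{1,\dots,n\}^d$; for $j\in A_n$ put $A_j=\mathbb Z^d\cap\prod_i[1,j_i]$. Let $\bar X_n=n^{-d}\sum_{k\in A_n}X_k$, $S^*_{n,j}=\sum_{i\in A_j}(X_i-\bar X_n)$, $\overline S{}^*_n=n^{-d}\sum_{j\in A_n}S^*_{n,j}$, $$\hat r(j)=\frac1{n^d}\sum_{k\in A_n,\ k+j\in A_n}(X_k-\bar X_n)(X_{k+j}-\bar X_n),\qquad \hat s_n^2=\sum_{j\in\{-(q_n-1),\dots,q_n-1\}^d}\ \prod_{i=1}^d\Bigl(1-\frac{|j_i|}{q_n}\Bigr)\hat r(j),$$ $$M_n=\frac{n^{-d}}{\hat s_n^2}\cdot n^{-d}\sum_{j\in A_n}\bigl(S^*_{n,j}-\overline S{}^*_n\bigr)^2 .$$ Let $q_n$ be positive integers with $q_n\to\infty$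 and $q_n/n\to0$. Let $\mathcal D([0,1]^d)$ be the space of functions on $[0,1]^d$ that have limits along all quadrants and are continuous from above, with the Skorokhod topology (given by increasing coordinatewise time changes), and let $B$ be the Brownian sheet on $[0,1]^d$, i.e. the centered Gaussian process with $E(B(t)B(s))=\prod_i \min(t_i,s_i)$, as a random element of $\mathcal D([0,1]^d)$. (i) Suppose that $X$ has finite fourth moments and is stationary up to the fourth order (its fourth-order central product moments are also invariant under translation, as is the case when $X$ is strictly stationary), and that: (SM1) $\sum_{j}|r(j)|<\infty$ and $\sigma^2:=\sum_j r(j)>0$; (SM2) $\frac1{\sigma n^{d/2}}\sum_{k\in A_n(t)}(X_k-E X_0)\to B(t)$ in law in $\mathcal D([0,1]^d)$; (SM3) $\sup_{i\in\mathbb Z^d}\sum_{(j,k)\in\mathbb Z^{2d}}|c_4(i,j,k)|<\infty$, where, with $\tilde X=X-EX$, $c_4(i,j,k)=E[\tilde X_0\tilde X_i\tilde X_j\tilde X_k]-r(i)r(k-j)-r(j)r(k-i)-r(k)r(j-i)$. Then $M_n$ converges in law to $$\int_{[0,1]^d}\Bigl(B(t)-\bigl(\textstyle\prod_i t_i\bigr)B(1)\Bigr)^2dt-\Bigl[\int_{[0,1]^d}\Bigl(B(t)-\bigl(\textstyle\prod_i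 t_i\bigr)B(1)\Bigr)dt\Bigr]^2 .$$ (ii) Suppose instead that there are $\gamma>d/2$, a function $L$ slowly varying at infinity, and a random element $Y$ of $\mathcal D([0,1]^d)$ that is non-degenerate, in the sense that almost surely there are no constants $a,b$ with $Y(t)=a+b\prod_i t_i$ for almost every $t$, such that: (LM1) $\frac1{n^\gamma L(n)}\sum_{k\in A_n(t)}(X_k-EX_0)\to Y(t)$ in law in $\mathcal D([0,1]^d)$; (LM2) $\operatorname{Var}\bigl(\sum_{k\in A_n}X_k\bigr)=O(n^{2\gamma}L(n)^2)$. Then $M_n\to\infty$ in probability, i.e. $P(M_n\le K)\to0$ for every real $K$. -/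

import Mathlib

open MeasureTheory ProbabilityTheory Filter Topology
open scoped ENNReal unitInterval

namespace VSTest

/-! ### The Skorokhod space `D([0,1]^d)` -/

/-- The quadrant with vertex `t` selected by `ρ`: in the coordinate `i` the points `s` satisfy
`t i ≤ s i` when `ρ i = true`, and `s i < t i` when `ρ i = false`. -/
def quadrant {d : ℕ} (ρ : Fin d → Bool) (t : Fin d → I) : Set (Fin d → I) :=
  {s | ∀ i, if ρ i = true then t i ≤ s i else s i < t i}

/-- `x : [0,1]^d → ℝ` is cadlag: at every point it has a limit along each of the `2^d` quadrants
(no condition for an empty quadrant), and it is continuous from above, that is, its value is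
the limit along the quadrant where all the inequalities are `≥`. -/
structure IsCadlag {d : ℕ} (x : (Fin d → I) → ℝ) : Prop where
  exists_limit : ∀ (t : Fin d → I) (ρ : Fin d → Bool),
    ∃ l : ℝ, Tendsto x (𝓝[quadrant ρ t] t) (𝓝 l)
  continuous_from_above : ∀ t : Fin d → I,
    Tendsto x (𝓝[quadrant (fun _ => true) t] t) (𝓝 (x t))

/-- The space `D([0,1]^d)` of cadlag functions. -/
structure SkorokhodSpace (d : ℕ) where
  toFun : (Fin d → I) → ℝ
  isCadlag : IsCadlag toFun

namespace SkorokhodSpace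

instance (d : ℕ) : CoeFun (SkorokhodSpace d) (fun _ => (Fin d → I) → ℝ) := ⟨toFun⟩

/-- A time change of `[0,1]^d`: one increasing bijection of `[0,1]` for each coordinate, acting
coordinatewise. -/
abbrev TimeChange (d : ℕ) : Type := Fin d → (I ≃o I)

/-- The action of a time change on a point. -/
def TimeChange.act {d : ℕ} (l : TimeChange d) (t : Fin d → I) : Fin d → I := fun i => l i (t i)

/-- The cost of matching `x` with `y` through the time change `l`: the larger of
`sup |l t - t|` and `sup |x t - y (l t)|`. -/
noncomputable def cost {d : ℕ} (l : TimeChange d) (x y : SkorokhodSpace d) : ℝ≥0∞ :=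
  ⨆ t : Fin d → I, max (edist (l.act t) t) (edist (x t) (y (l.act t)))

theorem cost_symm_le {d : ℕ} (l : TimeChange d) (x y : SkorokhodSpace d) :
    cost (fun i => (l i).symm) y x ≤ cost l x y := by
  refine iSup_le fun t => ?_
  have h := le_iSup (fun t : Fin d → I =>
    max (edist (l.act t) t) (edist (x t) (y (l.act t))))
    (TimeChange.act (fun i => (l i).symm) t)
  have h2 : TimeChange.act l (TimeChange.act (fun i => (l i).symm) t) = t := by
    funext i; simp [TimeChange.act]
  simp only [h2] at h
  rw [edist_comm (TimeChange.act _ t) t, edist_comm (y t)]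
  exact h

theorem cost_trans_le {d : ℕ} (l m : TimeChange d) (x y z : SkorokhodSpace d) :
    cost (fun i => (l i).trans (m i)) x z ≤ cost l x y + cost m y z := by
  refine iSup_le fun t => ?_
  have h1 := le_iSup (fun t : Fin d → I =>
    max (edist (l.act t) t) (edist (x t) (y (l.act t)))) t
  have h2 := le_iSup (fun t : Fin d → I =>
    max (edist (m.act t) t) (edist (y t) (z (m.act t)))) (l.act t)
  have h3 : TimeChange.act (fun i => (l i).trans (m i)) t = m.act (l.act t) := by
    funext i; simp [TimeChange.act]
  rw [h3]
  refine max_le ?_ ?_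
  · calc edist (m.act (l.act t)) t
        ≤ edist (m.act (l.act t)) (l.act t) + edist (l.act t) t := edist_triangle _ _ _
      _ ≤ cost m y z + cost l x y :=
          add_le_add (le_trans (le_max_left _ _) h2) (le_trans (le_max_left _ _) h1)
      _ = _ := add_comm _ _
  · calc edist (x t) (z (m.act (l.act t)))
        ≤ edist (x t) (y (l.act t)) + edist (y (l.act t)) (z (m.act (l.act t))) :=
          edist_triangle _ _ _
      _ ≤ _ := add_le_add (le_trans (le_max_right _ _) h1) (le_trans (le_max_right _ _) h2)

/-- The Skorokhod (J1) distance `inf_l max (sup |l t - t|) (sup |x t - y (l t)|)`. -/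
noncomputable instance (d : ℕ) : PseudoEMetricSpace (SkorokhodSpace d) where
  edist x y := ⨅ l : TimeChange d, cost l x y
  edist_self x := by
    refine le_antisymm (iInf_le_of_le (fun _ => OrderIso.refl I) ?_) bot_le
    refine iSup_le fun t => ?_
    have h : TimeChange.act (fun _ : Fin d => OrderIso.refl I) t = t := rfl
    rw [h]; simp
  edist_comm x y := by
    refine le_antisymm ?_ ?_ <;> refine le_iInf fun l => ?_ <;>
      exact iInf_le_of_le (fun i => (l i).symm) (cost_symm_le l _ _)
  edist_triangle x y z := by
    simp only [ENNReal.iInf_add, ENNReal.add_iInf]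
    refine le_iInf fun l => le_iInf fun m => ?_
    first
      | exact iInf_le_of_le (fun i => (l i).trans (m i)) (cost_trans_le l m x y z)
      | exact iInf_le_of_le (fun i => (m i).trans (l i)) (cost_trans_le m l x y z)

/-- `D([0,1]^d)` carries its Borel σ-algebra. -/
noncomputable instance (d : ℕ) : MeasurableSpace (SkorokhodSpace d) := borel _

instance (d : ℕ) : BorelSpace (SkorokhodSpace d) := ⟨rfl⟩

end SkorokhodSpace

/-! ### The partial-sum process -/

section PartialSums

variable {d : ℕ}

/-- The discrete box `∏ [1, j_i]` of `ℤ^d`. -/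
noncomputable def box (j : Fin d → ℤ) : Finset (Fin d → ℤ) := Finset.Icc 1 j

/-- The cube `A_n = {1, …, n}^d`. -/
noncomputable def cube (d n : ℕ) : Finset (Fin d → ℤ) := box (fun _ => (n : ℤ))

/-- The corner of `A_n(t) = ℤ^d ∩ ∏ [1, ⌊(n-1) t_i⌋ + 1]` (for `n ≥ 1`). -/
noncomputable def corner (n : ℕ) (t : Fin d → I) : Fin d → ℤ :=
  fun i => ⌊((n - 1 : ℕ) : ℝ) * (t i : ℝ)⌋ + 1

/-- The set `A_n(t)`. -/
noncomputable def timeBox (n : ℕ) (t : Fin d → I) : Finset (Fin d → ℤ) := box (corner n t)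

theorem floor_eventually_right (c : ℝ) (hc : 0 ≤ c) (t : I) :
    ∀ᶠ s : I in 𝓝[Set.Ici t] t, ⌊c * (s : ℝ)⌋ = ⌊c * (t : ℝ)⌋ := by
  have hcont : Tendsto (fun s : I => c * (s : ℝ)) (𝓝[Set.Ici t] t) (𝓝 (c * (t : ℝ))) :=
    ((continuous_const.mul continuous_subtype_val).tendsto t).mono_left nhdsWithin_le_nhds
  filter_upwards [hcont.eventually_lt_const (Int.lt_floor_add_one _), self_mem_nhdsWithin]
    with s hs hts
  rw [Int.floor_eq_iff]
  have hts' : (t : ℝ) ≤ s := hts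
  exact ⟨le_trans (Int.floor_le _) (mul_le_mul_of_nonneg_left hts' hc), hs⟩

theorem floor_eventually_left (c : ℝ) (hc : 0 ≤ c) (t : I) :
    ∃ m : ℤ, ∀ᶠ s : I in 𝓝[Set.Iio t] t, ⌊c * (s : ℝ)⌋ = m := by
  rcases hc.eq_or_lt with rfl | hc
  · exact ⟨0, by simp⟩
  have hcont : Tendsto (fun s : I => c * (s : ℝ)) (𝓝[Set.Iio t] t) (𝓝 (c * (t : ℝ))) :=
    ((continuous_const.mul continuous_subtype_val).tendsto t).mono_left nhdsWithin_le_nhds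
  refine ⟨⌈c * (t : ℝ)⌉ - 1, ?_⟩
  have hlt : ((⌈c * (t : ℝ)⌉ - 1 : ℤ) : ℝ) < c * t := by
    have := Int.ceil_lt_add_one (c * (t : ℝ)); push_cast; linarith
  filter_upwards [hcont.eventually_const_lt hlt, self_mem_nhdsWithin] with s hs hts
  rw [Int.floor_eq_iff]
  have hts' : (s : ℝ) < t := hts
  refine ⟨hs.le, ?_⟩
  have := Int.le_ceil (c * (t : ℝ))
  have h2 := mul_lt_mul_of_pos_left hts' hc
  push_cast; linarith

theorem isCadlag_corner (n : ℕ) (g : (Fin d → ℤ) → ℝ) :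
    IsCadlag (fun t : Fin d → I => g (corner n t)) := by
  have hc : (0 : ℝ) ≤ ((n - 1 : ℕ) : ℝ) := Nat.cast_nonneg _
  have key : ∀ (t : Fin d → I) (ρ : Fin d → Bool), ∃ m : Fin d → ℤ,
      (∀ᶠ s in 𝓝[quadrant ρ t] t, corner n s = m) ∧
        ((∀ i, ρ i = true) → m = corner n t) := by
    intro t ρ
    have hi : ∀ i, ∃ m : ℤ, (∀ᶠ s in 𝓝[quadrant ρ t] t, corner n s i = m) ∧
        (ρ i = true → m = corner n t i) := by
      intro i
      have hp : Tendsto (fun s : Fin d → I => s i) (𝓝[quadrant ρ t] t) (𝓝 (t i)) :=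
        ((continuous_apply i).tendsto t).mono_left nhdsWithin_le_nhds
      cases h : ρ i with
      | true =>
        refine ⟨corner n t i, ?_, fun _ => rfl⟩
        have hq : Tendsto (fun s : Fin d → I => s i) (𝓝[quadrant ρ t] t)
            (𝓝[Set.Ici (t i)] (t i)) := by
          refine tendsto_nhdsWithin_iff.2 ⟨hp, ?_⟩
          filter_upwards [self_mem_nhdsWithin] with s hs
          have := hs i
          simpa [h] using this
        filter_upwards [hq.eventually (floor_eventually_right _ hc (t i))] with s hs
        simp [corner, hs]
      | false =>
        obtain ⟨m, hm⟩ := floor_eventually_left _ hc (t i)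
        refine ⟨m + 1, ?_, fun h' => by simp at h'⟩
        have hq : Tendsto (fun s : Fin d → I => s i) (𝓝[quadrant ρ t] t)
            (𝓝[Set.Iio (t i)] (t i)) := by
          refine tendsto_nhdsWithin_iff.2 ⟨hp, ?_⟩
          filter_upwards [self_mem_nhdsWithin] with s hs
          have := hs i
          simpa [h] using this
        filter_upwards [hq.eventually hm] with s hs
        simp [corner, hs]
    choose m hm hm' using hi
    refine ⟨m, ?_, fun h => funext fun i => hm' i (h i)⟩
    filter_upwards [eventually_all.2 hm] with s hs
    exact funext hs
  refine ⟨fun t ρ => ?_, fun t => ?_⟩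
  · obtain ⟨m, hm, -⟩ := key t ρ
    refine ⟨g m, tendsto_nhds_of_eventually_eq ?_⟩
    filter_upwards [hm] with s hs
    rw [hs]
  · obtain ⟨m, hm, hm'⟩ := key t (fun _ => true)
    refine tendsto_nhds_of_eventually_eq ?_
    filter_upwards [hm] with s hs
    rw [hs, hm' fun _ => rfl]

variable {Ω : Type*} [MeasurableSpace Ω]

/-- The centered and normalized partial-sum process
`t ↦ a⁻¹ ∑_{k ∈ A_n(t)} (X_k - E X_0)`, as a random element of `D([0,1]^d)`. -/
noncomputable def partialSumProcess (X : (Fin d → ℤ) → Ω → ℝ) (P : Measure Ω)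
    (n : ℕ) (a : ℝ) (ω : Ω) : SkorokhodSpace d where
  toFun t := a⁻¹ * ∑ k ∈ timeBox n t, (X k ω - ∫ ω', X 0 ω' ∂P)
  isCadlag := isCadlag_corner n fun c => a⁻¹ * ∑ k ∈ box c, (X k ω - ∫ ω', X 0 ω' ∂P)

end PartialSums

/-! ### The V/S statistic -/

section Statistic

variable {d : ℕ} {Ω : Type*}

/-- The sample mean `X̄_n` over `A_n`. -/
noncomputable def sampleMean (X : (Fin d → ℤ) → Ω → ℝ) (n : ℕ) (ω : Ω) : ℝ :=
  ((n : ℝ) ^ d)⁻¹ * ∑ k ∈ cube d n, X k ω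

/-- The empirical covariance at the lag `j`:
`n^{-d} ∑ (X_k - X̄_n)(X_{k+j} - X̄_n)` over the `k` such that `k` and `k + j` lie in `A_n`. -/
noncomputable def empCov (X : (Fin d → ℤ) → Ω → ℝ) (n : ℕ) (j : Fin d → ℤ) (ω : Ω) : ℝ :=
  ((n : ℝ) ^ d)⁻¹ * ∑ k ∈ (cube d n).filter (fun k => k + j ∈ cube d n),
    (X k ω - sampleMean X n ω) * (X (k + j) ω - sampleMean X n ω)

/-- The Bartlett weight `∏ (1 - |j_i| / q)`. -/
noncomputable def bartlett (q : ℕ) (j : Fin d → ℤ) : ℝ :=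
  ∏ i, (1 - |(j i : ℝ)| / (q : ℝ))

/-- The variance estimator `ŝ_n²` with bandwidth `q`: the sum of the weighted empirical
covariances over the lags in `{-(q-1), …, q-1}^d`. -/
noncomputable def sHatSq (X : (Fin d → ℤ) → Ω → ℝ) (n q : ℕ) (ω : Ω) : ℝ :=
  ∑ j ∈ Finset.Icc (fun _ : Fin d => -((q : ℤ) - 1)) (fun _ => (q : ℤ) - 1),
    bartlett q j * empCov X n j ω

/-- The sums `S*_{n,j} = ∑_{i ∈ A_j} (X_i - X̄_n)`, where `A_j = ∏ [1, j_i]`. -/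
noncomputable def sStar (X : (Fin d → ℤ) → Ω → ℝ) (n : ℕ) (j : Fin d → ℤ) (ω : Ω) : ℝ :=
  ∑ i ∈ box j, (X i ω - sampleMean X n ω)

/-- The empirical mean of the `S*_{n,j}`, `j ∈ A_n`. -/
noncomputable def sStarMean (X : (Fin d → ℤ) → Ω → ℝ) (n : ℕ) (ω : Ω) : ℝ :=
  ((n : ℝ) ^ d)⁻¹ * ∑ j ∈ cube d n, sStar X n j ω

/-- The empirical variance of the `S*_{n,j}`, `j ∈ A_n`. -/
noncomputable def sStarVar (X : (Fin d → ℤ) → Ω → ℝ) (n : ℕ) (ω : Ω) : ℝ :=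
  ((n : ℝ) ^ d)⁻¹ * ∑ j ∈ cube d n, (sStar X n j ω - sStarMean X n ω) ^ 2

/-- The V/S statistic `M_n` with bandwidth `q`. -/
noncomputable def vsStat (X : (Fin d → ℤ) → Ω → ℝ) (n q : ℕ) (ω : Ω) : ℝ :=
  ((n : ℝ) ^ d)⁻¹ * (sStarVar X n ω / sHatSq X n q ω)

end Statistic

/-! ### The limit -/

section Limit

variable {d : ℕ}

/-- The bridge `t ↦ y(t) - (∏ t_i) y(1)` of a function on `[0,1]^d`. -/
noncomputable def bridge (y : (Fin d → I) → ℝ) (t : Fin d → I) : ℝ :=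
  y t - (∏ i, (t i : ℝ)) * y 1

/-- `∫ (bridge y)² - (∫ bridge y)²`, integrals over `[0,1]^d`. -/
noncomputable def vsFunctional (y : (Fin d → I) → ℝ) : ℝ :=
  (∫ t, bridge y t ^ 2) - (∫ t, bridge y t) ^ 2

/-- `B`, a random element of `D([0,1]^d)`, is a Brownian sheet: a centered Gaussian process with
covariance `E (B(s) B(t)) = ∏ min(s_i, t_i)`. -/
structure IsBrownianSheet {Ω : Type*} [MeasurableSpace Ω] (B : Ω → SkorokhodSpace d)
    (P : Measure Ω) : Prop where
  aemeasurable : AEMeasurable B P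
  gaussian : IsGaussianProcess (fun t ω => B ω t) P
  centered : ∀ t, ∫ ω, B ω t ∂P = 0
  covariance : ∀ s t : Fin d → I, ∫ ω, B ω s * B ω t ∂P = ∏ i, min (s i : ℝ) (t i : ℝ)

/-- A function on `[0,1]^d` is degenerate when it is almost everywhere equal to
`t ↦ a + b ∏ t_i` for some constants `a` and `b`. -/
def IsDegeneratePath (y : (Fin d → I) → ℝ) : Prop :=
  ∃ a b : ℝ, ∀ᵐ t : Fin d → I, y t = a + b * ∏ i, (t i : ℝ)

end Limit

/-! ### The hypotheses -/

section Hypotheses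

variable {d : ℕ} {Ω : Type*} [MeasurableSpace Ω]

/-- `X` is a second-order stationary random field. -/
structure IsStationary₂ (X : (Fin d → ℤ) → Ω → ℝ) (P : Measure Ω) : Prop where
  memLp : ∀ k, MemLp (X k) 2 P
  mean : ∀ k, ∫ ω, X k ω ∂P = ∫ ω, X 0 ω ∂P
  cov : ∀ k h, cov[X k, X (k + h); P] = cov[X 0, X h; P]

/-- The covariance function `r`. -/
noncomputable def autocov (X : (Fin d → ℤ) → Ω → ℝ) (P : Measure Ω) (h : Fin d → ℤ) : ℝ :=
  cov[X 0, X h; P]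

/-- `σ² = ∑ r(j)`. -/
noncomputable def longRunVar (X : (Fin d → ℤ) → Ω → ℝ) (P : Measure Ω) : ℝ :=
  ∑' j : Fin d → ℤ, autocov X P j

/-- The fourth-order central product moment `E[X̃_k X̃_{k+h} X̃_{k+j} X̃_{k+l}]`, where
`X̃ = X - E X`. -/
noncomputable def moment₄ (X : (Fin d → ℤ) → Ω → ℝ) (P : Measure Ω)
    (k h j l : Fin d → ℤ) : ℝ :=
  ∫ ω, (X k ω - ∫ ω', X k ω' ∂P) * (X (k + h) ω - ∫ ω', X (k + h) ω' ∂P) *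
    (X (k + j) ω - ∫ ω', X (k + j) ω' ∂P) * (X (k + l) ω - ∫ ω', X (k + l) ω' ∂P) ∂P

/-- `X` is stationary up to the fourth order. -/
structure IsStationary₄ (X : (Fin d → ℤ) → Ω → ℝ) (P : Measure Ω) : Prop
    extends IsStationary₂ X P where
  memLp₄ : ∀ k, MemLp (X k) 4 P
  moment : ∀ k h j l, moment₄ X P k h j l = moment₄ X P 0 h j l

/-- The fourth-order cumulants `c₄(h, j, l)`. -/
noncomputable def cumulant₄ (X : (Fin d → ℤ) → Ω → ℝ) (P : Measure Ω)
    (h j l : Fin d → ℤ) : ℝ :=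
  moment₄ X P 0 h j l - autocov X P h * autocov X P (l - j)
    - autocov X P j * autocov X P (l - h) - autocov X P l * autocov X P (j - h)

/-- The short-memory hypothesis, `B` being the Brownian sheet. -/
structure ShortMemory {Ω' : Type*} [MeasurableSpace Ω'] (X : (Fin d → ℤ) → Ω → ℝ)
    (P : Measure Ω) [IsProbabilityMeasure P] (B : Ω' → SkorokhodSpace d)
    (P' : Measure Ω') [IsProbabilityMeasure P'] : Prop where
  stationary : IsStationary₄ X P
  sheet : IsBrownianSheet B P'
  summable : Summable fun j => |autocov X P j|
  pos : 0 < longRunVar X P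
  invariance : TendstoInDistribution
    (fun n : ℕ => partialSumProcess X P n (√(longRunVar X P) * (n : ℝ) ^ ((d : ℝ) / 2)))
    atTop B (fun _ => P) P'
  cumulants : (⨆ h : Fin d → ℤ, ∑' p : (Fin d → ℤ) × (Fin d → ℤ),
    ENNReal.ofReal |cumulant₄ X P h p.1 p.2|) < ⊤

/-- `L` is slowly varying at infinity. -/
structure IsSlowlyVarying (L : ℝ → ℝ) : Prop where
  measurable : Measurable L
  eventually_pos : ∀ᶠ x in atTop, 0 < L x
  tendsto : ∀ c : ℝ, 0 < c → Tendsto (fun x => L (c * x) / L x) atTop (𝓝 1)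

/-- The long-memory hypothesis, with exponent `γ`, slowly varying function `L` and limit `Y`. -/
structure LongMemory {Ω' : Type*} [MeasurableSpace Ω'] (X : (Fin d → ℤ) → Ω → ℝ)
    (P : Measure Ω) [IsProbabilityMeasure P] (γ : ℝ) (L : ℝ → ℝ) (Y : Ω' → SkorokhodSpace d)
    (P' : Measure Ω') [IsProbabilityMeasure P'] : Prop where
  stationary : IsStationary₂ X P
  exponent : (d : ℝ) / 2 < γ
  slowlyVarying : IsSlowlyVarying L
  nondegenerate : ∀ᵐ ω ∂P', ¬ IsDegeneratePath (Y ω)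
  invariance : TendstoInDistribution
    (fun n : ℕ => partialSumProcess X P n ((n : ℝ) ^ γ * L n)) atTop Y (fun _ => P) P'
  variance : (fun n : ℕ => Var[fun ω => ∑ k ∈ cube d n, X k ω; P])
    =O[atTop] fun n : ℕ => (n : ℝ) ^ (2 * γ) * L n ^ 2

end Hypotheses

end VSTest

/-!
# The V/S statistic under short and long memory

Write `Z_n` for the normalized partial-sum process, with normalization `a_n`. The sums `S*_{n,j}`
are the values at grid points of the bridge of `a_n Z_n`, up to replacing `∏ j_i / n^d` by `∏ t_i`
and averages over `A_n` by integrals. The numerator of the statistic, divided by `a_n ^ 2`,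
therefore differs from `vsFunctional Z_n` by at most `discretizationError d n` times the squared
uniform norm of `Z_n` (`abs_sStarVar_sub_le`). Since `vsFunctional` and the uniform norm are
continuous for the Skorokhod topology (`continuous_vsFunctional`,
`SkorokhodSpace.continuous_supNorm`), the continuous mapping theorem and Slutsky's lemma give the
limit of the numerator in both regimes (`tendstoInDistribution_sStarVar`). The rest of the proof
concerns the denominator.

The Bartlett weights are the autocorrelation of the indicator of a cube, so `ŝ_n²` is a sum of
squares of sums over windows of side `q_n` (`quadForm_eq_sum_windows`). In particular it is the
square of a seminorm of the centered data, and the Cauchy–Schwarz inequality reduces it to the same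
expression in `X_k - E X_0` plus a contribution of the sample mean, of order
`q_n ^ d * (X̄_n - E X_0) ^ 2`, which is negligible as `q_n / n → 0`.

* Short memory. The expectation of the quadratic form tends to `∑ r(j)` by dominated convergence,
  and its variance is `O((q_n / n) ^ d)`: the covariance of two products is a fourth-order cumulant
  plus two products of covariances (`IsStationary₄.cov_mul_mul`), all of them summable. Hence `ŝ_n²
  → ∑ r(j)` in probability (`tendstoInMeasure_sHatSq`), and Slutsky's lemma concludes.

* Long memory. It is enough that `n ^ d * ŝ_n² / a_n ^ 2 → 0` in probability, because the limit of
  the numerator is almost surely positive (`vsFunctional_pos`). The expectation of the quadratic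
  form is an average of variances of window sums. The hypothesis only bounds the variance for
  cubes, whereas the windows at the boundary of `A_n` are boxes of any proportions with sides at
  most `q_n`. These are dominated, up to a constant, by an average of the variances for cubes of
  side at most a multiple of `q_n` (`exists_sum_box_le_sum_cube`): in the spectral domain this is
  the inequality `∏ |1 - z_i ^ (l_i)|² ≤ (C / Q) ∑_{n ≤ K Q} ∏ |1 - z_i ^ n|²` for unimodular `z_i`
  and `l_i ≤ Q` (`exists_prod_sq_norm_one_sub_pow_le`), and it passes to every positive-definite
  `r` without reference to its spectral measure, by integration against Fejér sums of `r`
  (`sum_nonneg_of_trigPoly_nonneg`). The kernel inequality holds because `n ↦ ∏ (1 - z_i ^ n)` is a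
  sum of `2 ^ d` exponentials, hence satisfies linear recurrences with bounded coefficients along
  all arithmetic progressions: one large value forces many. Potter's bound
  (`IsSlowlyVarying.exists_le_rpow_mul`), with an exponent strictly between `d` and `2 γ`, then
  compares the variances at scale `q_n` with `a_n ^ 2`.
-/

namespace VSTest

/-! ### Cadlag functions and functionals on the Skorokhod space -/

/-- A cadlag function oscillates by less than `ε` on each cell of a suitable finite grid; the grid
is given by a finite set `F` of thresholds used in all coordinates, and two points lie in the same
cell when their coordinates lie on the same side of every threshold. -/
theorem IsCadlag.exists_thresholds {d : ℕ} {x : (Fin d → I) → ℝ} (hx : IsCadlag x) {ε : ℝ}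
    (hε : 0 < ε) :
    ∃ F : Finset ℝ, ∀ s s' : Fin d → I,
      (∀ i, ∀ c ∈ F, c ≤ (s i : ℝ) ↔ c ≤ (s' i : ℝ)) → |x s - x s'| < ε := by
  classical
  have hloc : ∀ t : Fin d → I, ∃ δ > 0, ∀ ρ : Fin d → Bool, ∀ s s' : Fin d → I,
      dist s t < δ → dist s' t < δ → s ∈ quadrant ρ t → s' ∈ quadrant ρ t →
        |x s - x s'| < ε := by
    intro t
    have h1 : ∀ ρ : Fin d → Bool, ∃ δ > 0, ∀ s s' : Fin d → I,
        dist s t < δ → dist s' t < δ → s ∈ quadrant ρ t → s' ∈ quadrant ρ t →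
          |x s - x s'| < ε := by
      intro ρ
      obtain ⟨l, hl⟩ := hx.exists_limit t ρ
      obtain ⟨δ, hδ, h⟩ := (Metric.tendsto_nhdsWithin_nhds.1 hl) (ε / 2) (half_pos hε)
      refine ⟨δ, hδ, fun s s' hs hs' hq hq' => ?_⟩
      have a := h hq hs
      have b := h hq' hs'
      rw [Real.dist_eq] at a b
      rw [abs_lt] at a b ⊢
      constructor <;> linarith [a.1, a.2, b.1, b.2]
    choose δ hδ h using h1
    refine ⟨Finset.univ.inf' Finset.univ_nonempty δ, ?_, fun ρ s s' hs hs' => ?_⟩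
    · exact (Finset.lt_inf'_iff _).2 fun ρ _ => hδ ρ
    · exact h ρ s s' (hs.trans_le (Finset.inf'_le _ (Finset.mem_univ ρ)))
        (hs'.trans_le (Finset.inf'_le _ (Finset.mem_univ ρ)))
  choose δ hδ h using hloc
  obtain ⟨T, -, hT⟩ := (isCompact_univ (X := Fin d → I)).elim_nhds_subcover
    (fun t => Metric.ball t (δ t / 2)) (fun t _ => Metric.ball_mem_nhds t (half_pos (hδ t)))
  refine ⟨T.biUnion fun t => Finset.univ.biUnion fun i =>
    {(t i : ℝ), (t i : ℝ) - δ t / 2, (t i : ℝ) + δ t / 2}, fun s s' hss => ?_⟩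
  obtain ⟨t, ht, hst⟩ : ∃ t ∈ T, s ∈ Metric.ball t (δ t / 2) := by
    simpa using hT (Set.mem_univ s)
  have hp : ∀ i, ∀ c : ℝ, c = t i ∨ c = t i - δ t / 2 ∨ c = t i + δ t / 2 →
      (c ≤ (s i : ℝ) ↔ c ≤ (s' i : ℝ)) := by
    intro i c hc
    refine hss i c ?_
    simp only [Finset.mem_biUnion, Finset.mem_univ, true_and, Finset.mem_insert,
      Finset.mem_singleton]
    exact ⟨t, ht, i, hc⟩
  rw [Metric.mem_ball] at hst
  have hst' : ∀ i, |(s i : ℝ) - t i| < δ t / 2 := fun i =>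
    lt_of_le_of_lt (dist_le_pi_dist s t i) hst
  refine h t (fun i => decide (t i ≤ s i)) s s' (hst.trans (half_lt_self (hδ t))) ?_ ?_ ?_
  · rw [dist_pi_lt_iff (hδ t)]
    intro i
    have h1 := abs_lt.1 (hst' i)
    have h2 := (hp i _ (Or.inr (Or.inl rfl))).1 (by linarith [h1.1])
    have h3 := (not_congr (hp i _ (Or.inr (Or.inr rfl)))).1 (by linarith [h1.2])
    change |(s' i : ℝ) - t i| < δ t
    rw [abs_lt]
    constructor <;> linarith [hδ t]
  · intro i
    by_cases hi : t i ≤ s i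
    · simp [hi]
    · simpa [hi] using lt_of_not_ge hi
  · intro i
    have := hp i _ (Or.inl rfl)
    by_cases hi : t i ≤ s i
    · simpa [hi] using this.1 hi
    · have h4 : ¬ t i ≤ s' i := fun h => hi (this.2 h)
      simpa [hi] using lt_of_not_ge h4

theorem IsCadlag.exists_bound {d : ℕ} {x : (Fin d → I) → ℝ} (hx : IsCadlag x) :
    ∃ C : ℝ, ∀ t, |x t| ≤ C := by
  obtain ⟨F, hF⟩ := hx.exists_thresholds one_pos
  let p : (Fin d → I) → (Fin d → F → Prop) := fun s i c => (c : ℝ) ≤ (s i : ℝ)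
  obtain ⟨C, hC⟩ := (Set.finite_range fun π => |x (Function.invFun p π)|).bddAbove
  refine ⟨1 + C, fun t => ?_⟩
  have h1 : p (Function.invFun p (p t)) = p t := Function.invFun_eq ⟨t, rfl⟩
  have h2 := hF t (Function.invFun p (p t)) fun i c hc =>
    (iff_of_eq (congrFun (congrFun h1 i) ⟨c, hc⟩)).symm
  have h3 : |x (Function.invFun p (p t))| ≤ C := hC ⟨p t, rfl⟩
  have h4 := abs_sub_abs_le_abs_sub (x t) (x (Function.invFun p (p t)))
  linarith

/-- The discontinuities of a cadlag function lie on countably many hyperplanes `{t i = c}`. -/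
theorem IsCadlag.exists_countable_continuousAt {d : ℕ} {x : (Fin d → I) → ℝ} (hx : IsCadlag x) :
    ∃ C : Set ℝ, C.Countable ∧ ∀ t : Fin d → I, (∀ i, (t i : ℝ) ∉ C) → ContinuousAt x t := by
  choose F hF using fun n : ℕ => hx.exists_thresholds (Nat.one_div_pos_of_nat (α := ℝ) (n := n))
  refine ⟨⋃ n, (F n : Set ℝ), Set.countable_iUnion fun n => (F n).countable_toSet, ?_⟩
  intro t ht
  rw [ContinuousAt, Metric.tendsto_nhds]
  intro ε hε
  obtain ⟨n, hn⟩ := exists_nat_one_div_lt hε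
  have hev : ∀ i, ∀ c ∈ F n, ∀ᶠ s : Fin d → I in 𝓝 t, (c ≤ (s i : ℝ) ↔ c ≤ (t i : ℝ)) := by
    intro i c hc
    have hcont : Tendsto (fun s : Fin d → I => (s i : ℝ)) (𝓝 t) (𝓝 (t i : ℝ)) :=
      (continuous_subtype_val.comp (continuous_apply i)).tendsto t
    have hne : (t i : ℝ) ≠ c := fun h => ht i (Set.mem_iUnion.2 ⟨n, by rw [h]; exact hc⟩)
    rcases lt_or_gt_of_ne hne with h | h
    · filter_upwards [hcont.eventually_lt_const h] with s hs
      exact iff_of_false (not_le.2 hs) (not_le.2 h)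
    · filter_upwards [hcont.eventually_const_lt h] with s hs
      exact iff_of_true hs.le h.le
  have hall : ∀ᶠ s : Fin d → I in 𝓝 t, ∀ i, ∀ c ∈ F n, (c ≤ (s i : ℝ) ↔ c ≤ (t i : ℝ)) :=
    eventually_all.2 fun i => (Finset.eventually_all _).2 (hev i)
  filter_upwards [hall] with s hs
  exact (hF n s t hs).trans hn

theorem ae_coord_notMem {d : ℕ} {C : Set ℝ} (hC : C.Countable) :
    ∀ᵐ t : Fin d → I, ∀ i, (t i : ℝ) ∉ C := by
  refine ae_all_iff.2 fun i => ?_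
  have h1 : ∀ᵐ s : I, (s : ℝ) ∉ C :=
    (hC.preimage Subtype.val_injective).ae_notMem volume
  exact (Measure.quasiMeasurePreserving_eval (fun _ : Fin d => (volume : Measure I)) i).ae h1

theorem IsCadlag.ae_continuousAt {d : ℕ} {x : (Fin d → I) → ℝ} (hx : IsCadlag x) :
    ∀ᵐ t : Fin d → I, ContinuousAt x t := by
  obtain ⟨C, hC, h⟩ := hx.exists_countable_continuousAt
  filter_upwards [ae_coord_notMem hC] with t ht using h t ht

theorem IsCadlag.aestronglyMeasurable {d : ℕ} {x : (Fin d → I) → ℝ} (hx : IsCadlag x) :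
    AEStronglyMeasurable x := by
  obtain ⟨C, hC, h⟩ := hx.exists_countable_continuousAt
  have hm : MeasurableSet {t : Fin d → I | ∀ i, (t i : ℝ) ∉ C} := by
    rw [Set.ofPred_forall]
    exact MeasurableSet.iInter fun i =>
      (measurable_subtype_coe.comp (measurable_pi_apply i)) hC.measurableSet.compl
  have hcont : ContinuousOn x {t : Fin d → I | ∀ i, (t i : ℝ) ∉ C} :=
    fun t ht => (h t ht).continuousWithinAt
  have := hcont.aestronglyMeasurable (μ := volume) hm
  have hae : ∀ᵐ t : Fin d → I, t ∈ {t : Fin d → I | ∀ i, (t i : ℝ) ∉ C} := ae_coord_notMem hC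
  rwa [Measure.restrict_eq_self_of_ae_mem hae] at this

namespace SkorokhodSpace

variable {d : ℕ}

/-- The uniform norm of a cadlag function. -/
noncomputable def supNorm (x : SkorokhodSpace d) : ℝ := ⨆ t, |x t|

theorem abs_le_supNorm (x : SkorokhodSpace d) (t : Fin d → I) : |x t| ≤ supNorm x := by
  obtain ⟨C, hC⟩ := x.isCadlag.exists_bound
  exact le_ciSup (f := fun t => |x t|) ⟨C, by rintro _ ⟨t, rfl⟩; exact hC t⟩ t

theorem supNorm_nonneg (x : SkorokhodSpace d) : 0 ≤ supNorm x :=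
  (abs_nonneg _).trans (abs_le_supNorm x 0)

theorem exists_timeChange {x y : SkorokhodSpace d} {r : ℝ} (h : edist x y < ENNReal.ofReal r) :
    ∃ l : TimeChange d, ∀ t, dist (l.act t) t ≤ r ∧ |x t - y (l.act t)| ≤ r := by
  have hr : 0 < r := ENNReal.ofReal_pos.1 (bot_le.trans_lt h)
  obtain ⟨l, hl⟩ := iInf_lt_iff.1 (show (⨅ l : TimeChange d, cost l x y) < _ from h)
  refine ⟨l, fun t => ?_⟩
  have h1 := (le_iSup (fun t : Fin d → I =>
    max (edist (l.act t) t) (edist (x t) (y (l.act t)))) t).trans hl.le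
  rw [max_le_iff, edist_le_ofReal hr.le, edist_le_ofReal hr.le] at h1
  exact h1

theorem supNorm_le_add {x y : SkorokhodSpace d} {r : ℝ} (h : edist x y < ENNReal.ofReal r) :
    supNorm x ≤ supNorm y + r := by
  obtain ⟨l, hl⟩ := exists_timeChange h
  refine ciSup_le fun t => ?_
  have h1 := abs_sub_abs_le_abs_sub (x t) (y (l.act t))
  linarith [(hl t).2, abs_le_supNorm y (l.act t)]

theorem continuous_supNorm : Continuous (supNorm (d := d)) := by
  rw [continuous_iff_continuousAt]
  intro x
  rw [ContinuousAt, Metric.tendsto_nhds]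
  intro ε hε
  filter_upwards [Metric.eball_mem_nhds x (ENNReal.ofReal_pos.2 (half_pos hε))] with y hy
  have h1 := supNorm_le_add (show edist y x < _ from hy)
  have h2 := supNorm_le_add (show edist x y < _ by rw [edist_comm]; exact hy)
  rw [Real.dist_eq, abs_lt]
  constructor <;> linarith

theorem tendsto_apply {x : SkorokhodSpace d} {u : ℕ → SkorokhodSpace d}
    (hu : Tendsto u atTop (𝓝 x)) {t : Fin d → I} (ht : ContinuousAt x t) :
    Tendsto (fun n => u n t) atTop (𝓝 (x t)) := by
  rw [Metric.tendsto_nhds]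
  intro ε hε
  obtain ⟨δ, hδ, h⟩ := Metric.continuousAt_iff.1 ht (ε / 2) (half_pos hε)
  have hη : 0 < min (δ / 2) (ε / 2) := lt_min (half_pos hδ) (half_pos hε)
  filter_upwards [hu (Metric.eball_mem_nhds x (ENNReal.ofReal_pos.2 hη))] with n hn
  obtain ⟨l, hl⟩ := exists_timeChange (show edist (u n) x < _ from hn)
  have h1 := h (show dist (l.act t) t < δ from
    ((hl t).1.trans (min_le_left _ _)).trans_lt (half_lt_self hδ))
  have h2 := (hl t).2.trans (min_le_right _ _)
  calc dist (u n t) (x t) ≤ dist (u n t) (x (l.act t)) + dist (x (l.act t)) (x t) :=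
        dist_triangle _ _ _
    _ < ε / 2 + ε / 2 := add_lt_add_of_le_of_lt h2 h1
    _ = ε := add_halves ε

theorem tendsto_apply_one {x : SkorokhodSpace d} {u : ℕ → SkorokhodSpace d}
    (hu : Tendsto u atTop (𝓝 x)) : Tendsto (fun n => u n 1) atTop (𝓝 (x 1)) := by
  rw [Metric.tendsto_nhds]
  intro ε hε
  filter_upwards [hu (Metric.eball_mem_nhds x (ENNReal.ofReal_pos.2 (half_pos hε)))] with n hn
  obtain ⟨l, hl⟩ := exists_timeChange (show edist (u n) x < _ from hn)
  have h1 : l.act 1 = 1 := funext fun i => (l i).map_top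
  have h2 := (hl 1).2
  rw [h1] at h2
  exact lt_of_le_of_lt h2 (half_lt_self hε)

end SkorokhodSpace

section Bridge

variable {d : ℕ}

theorem prod_coe_nonneg (t : Fin d → I) : 0 ≤ ∏ i, (t i : ℝ) :=
  Finset.prod_nonneg fun i _ => (t i).2.1

theorem prod_coe_le_one (t : Fin d → I) : ∏ i, (t i : ℝ) ≤ 1 :=
  Finset.prod_le_one (fun i _ => (t i).2.1) fun i _ => (t i).2.2

theorem abs_bridge_le (y : SkorokhodSpace d) (t : Fin d → I) :
    |bridge y t| ≤ 2 * y.supNorm := by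
  have h1 := abs_sub (y t) ((∏ i, (t i : ℝ)) * y 1)
  have h2 : |(∏ i, (t i : ℝ)) * y 1| ≤ 1 * y.supNorm := by
    rw [abs_mul, abs_of_nonneg (prod_coe_nonneg t)]
    exact mul_le_mul (prod_coe_le_one t) (y.abs_le_supNorm 1) (abs_nonneg _) zero_le_one
  unfold bridge
  linarith [y.abs_le_supNorm t]

theorem aestronglyMeasurable_bridge (y : SkorokhodSpace d) :
    AEStronglyMeasurable (bridge y) := by
  have h : Continuous fun t : Fin d → I => ∏ i, (t i : ℝ) := by fun_prop
  exact y.isCadlag.aestronglyMeasurable.sub (h.aestronglyMeasurable.mul_const _)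

theorem memLp_bridge (y : SkorokhodSpace d) (p : ℝ≥0∞) : MemLp (bridge y) p :=
  MemLp.of_bound (aestronglyMeasurable_bridge y) (2 * y.supNorm)
    (ae_of_all _ fun t => abs_bridge_le y t)

theorem continuous_vsFunctional :
    Continuous fun y : SkorokhodSpace d => vsFunctional (y : (Fin d → I) → ℝ) := by
  refine SeqContinuous.continuous fun u x hu => ?_
  have hb : ∀ᶠ n in atTop, ∀ t, |bridge (u n) t| ≤ 2 * (x.supNorm + 1) := by
    have := ((SkorokhodSpace.continuous_supNorm (d := d)).tendsto x).comp hu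
    filter_upwards [this.eventually_lt_const (lt_add_one _)] with n hn t
    exact (abs_bridge_le (u n) t).trans (by simp only [Function.comp] at hn; linarith)
  have hlim : ∀ᵐ t : Fin d → I, Tendsto (fun n => bridge (u n) t) atTop (𝓝 (bridge x t)) := by
    filter_upwards [x.isCadlag.ae_continuousAt] with t ht
    exact (SkorokhodSpace.tendsto_apply hu ht).sub
      ((SkorokhodSpace.tendsto_apply_one hu).const_mul _)
  have h1 : Tendsto (fun n => ∫ t, bridge (u n) t) atTop (𝓝 (∫ t, bridge x t)) := by
    refine tendsto_integral_filter_of_dominated_convergence (fun _ => 2 * (x.supNorm + 1))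
      (Eventually.of_forall fun n => aestronglyMeasurable_bridge _) ?_ (integrable_const _) hlim
    filter_upwards [hb] with n hn using ae_of_all _ hn
  have h2 : Tendsto (fun n => ∫ t, bridge (u n) t ^ 2) atTop (𝓝 (∫ t, bridge x t ^ 2)) := by
    refine tendsto_integral_filter_of_dominated_convergence
      (fun _ => (2 * (x.supNorm + 1)) ^ 2)
      (Eventually.of_forall fun n => (aestronglyMeasurable_bridge _).pow 2) ?_
      (integrable_const _) (hlim.mono fun t ht => ht.pow 2)
    filter_upwards [hb] with n hn
    refine ae_of_all _ fun t => ?_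
    rw [norm_pow]
    exact pow_le_pow_left₀ (norm_nonneg _) (hn t) 2
  exact h2.sub (h1.pow 2)

theorem vsFunctional_eq_variance (y : SkorokhodSpace d) :
    vsFunctional y = Var[bridge y] := by
  rw [variance_eq_sub (memLp_bridge y 2)]
  rfl

/-- The variance of the bridge vanishes only if the bridge is almost everywhere constant. -/
theorem vsFunctional_pos {y : SkorokhodSpace d} (hy : ¬ IsDegeneratePath y) :
    0 < vsFunctional y := by
  rw [vsFunctional_eq_variance]
  refine lt_of_le_of_ne (variance_nonneg _ _) fun h => hy ?_
  refine ⟨∫ t, bridge y t, y 1, ?_⟩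
  filter_upwards [ae_eq_integral_of_variance_eq_zero (memLp_bridge y 2) h.symm] with t ht
  rw [← ht, bridge]
  ring

end Bridge

/-! ### The statistic as a functional of the partial-sum process -/

section Boxes

variable {d : ℕ}

theorem mem_box {j k : Fin d → ℤ} : k ∈ box j ↔ ∀ i, 1 ≤ k i ∧ k i ≤ j i := by
  simp only [box, Finset.mem_Icc, Pi.le_def, Pi.one_apply, forall_and]

theorem mem_cube {n : ℕ} {k : Fin d → ℤ} : k ∈ cube d n ↔ ∀ i, 1 ≤ k i ∧ k i ≤ n := mem_box

theorem card_cube (d n : ℕ) : (cube d n).card = n ^ d := by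
  simp [cube, box, Pi.card_Icc]

theorem cast_card_box {j : Fin d → ℤ} (hj : ∀ i, 0 ≤ j i) :
    ((box j).card : ℝ) = ∏ i, (j i : ℝ) := by
  rw [box, Pi.card_Icc, Nat.cast_prod]
  refine Finset.prod_congr rfl fun i _ => ?_
  rw [Int.card_Icc, ← Int.cast_natCast, Int.toNat_of_nonneg (by simpa using hj i)]
  simp

theorem corner_succ_apply (c : ℕ) (t : Fin d → I) (i : Fin d) :
    corner (c + 1) t i = ⌊(c : ℝ) * (t i : ℝ)⌋ + 1 := by
  simp [corner]

theorem corner_mem_cube (c : ℕ) (t : Fin d → I) : corner (c + 1) t ∈ cube d (c + 1) := by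
  rw [mem_cube]
  intro i
  rw [corner_succ_apply]
  have h0 : 0 ≤ ⌊(c : ℝ) * (t i : ℝ)⌋ :=
    Int.floor_nonneg.2 (mul_nonneg (Nat.cast_nonneg _) (t i).2.1)
  have h1 : ⌊(c : ℝ) * (t i : ℝ)⌋ ≤ c := by
    have := Int.floor_le_floor (mul_le_mul_of_nonneg_left (t i).2.2 (Nat.cast_nonneg (α := ℝ) c))
    simpa using this
  push_cast
  omega

theorem exists_corner_eq {c : ℕ} (hc : 1 ≤ c) {j : Fin d → ℤ} (hj : j ∈ cube d (c + 1)) :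
    ∃ t : Fin d → I, corner (c + 1) t = j := by
  rw [mem_cube] at hj
  have hc' : (0 : ℝ) < c := by exact_mod_cast hc
  have h1 : ∀ i, ((j i : ℝ) - 1) / c ∈ Set.Icc (0 : ℝ) 1 := by
    intro i
    have a : (1 : ℝ) ≤ j i := by exact_mod_cast (hj i).1
    have b : (j i : ℝ) ≤ c + 1 := by exact_mod_cast (hj i).2
    exact ⟨div_nonneg (by linarith) hc'.le, (div_le_one hc').2 (by linarith)⟩
  refine ⟨fun i => ⟨_, h1 i⟩, funext fun i => ?_⟩
  rw [corner_succ_apply]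
  have h2 : (c : ℝ) * (((j i : ℝ) - 1) / c) = ((j i - 1 : ℤ) : ℝ) := by
    push_cast; field_simp
  simp only [h2, Int.floor_intCast]
  ring

theorem corner_one (c : ℕ) : corner (d := d) (c + 1) 1 = fun _ => ((c + 1 : ℕ) : ℤ) := by
  funext i
  simp [corner]

theorem volume_floor_eq {c : ℕ} (hc : 1 ≤ c) {m : ℤ} (h1 : 1 ≤ m) (h2 : m ≤ c) :
    volume {s : I | ⌊(c : ℝ) * (s : ℝ)⌋ + 1 = m} = ENNReal.ofReal (c : ℝ)⁻¹ := by
  have hc' : (0 : ℝ) < c := by exact_mod_cast hc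
  have a : (1 : ℝ) ≤ m := by exact_mod_cast h1
  have b : (m : ℝ) ≤ c := by exact_mod_cast h2
  have e : {s : I | ⌊(c : ℝ) * (s : ℝ)⌋ + 1 = m} = Set.Ico
      ⟨((m : ℝ) - 1) / c, div_nonneg (by linarith) hc'.le, (div_le_one hc').2 (by linarith)⟩
      ⟨(m : ℝ) / c, div_nonneg (by linarith) hc'.le, (div_le_one hc').2 b⟩ := by
    ext s
    simp only [Set.mem_ofPred_eq, Set.mem_Ico]
    rw [← eq_sub_iff_add_eq, Int.floor_eq_iff]
    change _ ↔ ((m : ℝ) - 1) / c ≤ s ∧ (s : ℝ) < m / c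
    rw [div_le_iff₀ hc', lt_div_iff₀ hc', mul_comm (s : ℝ)]
    push_cast
    simp
  rw [e, unitInterval.volume_Ico]
  congr 1
  field_simp
  ring

/-- The corner of `A_n(t)` is uniformly distributed over `{1, …, n - 1}^d`: the points of `A_n`
with a coordinate `n` are attained only when some `t i` equals `1`. -/
theorem integral_corner {c : ℕ} (hc : 1 ≤ c) (g : (Fin d → ℤ) → ℝ) :
    ∫ t : Fin d → I, g (corner (c + 1) t) = ((c : ℝ) ^ d)⁻¹ * ∑ j ∈ cube d c, g j := by
  classical
  have hms : ∀ j : Fin d → ℤ, {t : Fin d → I | corner (c + 1) t = j} =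
      Set.univ.pi fun i => {s : I | ⌊(c : ℝ) * (s : ℝ)⌋ + 1 = j i} := by
    intro j
    ext t
    simp [funext_iff, corner_succ_apply]
  have hm1 : ∀ m : ℤ, MeasurableSet {s : I | ⌊(c : ℝ) * (s : ℝ)⌋ + 1 = m} := by
    intro m
    have : Measurable fun s : I => ⌊(c : ℝ) * (s : ℝ)⌋ + 1 :=
      (Int.measurable_floor.comp (measurable_const.mul measurable_subtype_coe)).add_const 1
    exact this (measurableSet_singleton m)
  have hm : ∀ j : Fin d → ℤ, MeasurableSet {t : Fin d → I | corner (c + 1) t = j} := by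
    intro j
    rw [hms]
    exact MeasurableSet.univ_pi fun i => hm1 _
  have hae : ∀ᵐ t : Fin d → I, g (corner (c + 1) t) =
      ∑ j ∈ cube d c, {t : Fin d → I | corner (c + 1) t = j}.indicator (fun _ => g j) t := by
    filter_upwards [ae_coord_notMem (Set.countable_singleton (1 : ℝ))] with t ht
    have hmem : corner (c + 1) t ∈ cube d c := by
      have h0 := mem_cube.1 (corner_mem_cube c t)
      refine mem_cube.2 fun i => ⟨(h0 i).1, ?_⟩
      rw [corner_succ_apply]
      have h1 : (t i : ℝ) < 1 := lt_of_le_of_ne (t i).2.2 (ht i)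
      have hc' : (0 : ℝ) < c := by exact_mod_cast hc
      have : ⌊(c : ℝ) * (t i : ℝ)⌋ < (c : ℤ) := by
        rw [Int.floor_lt]
        have := mul_lt_mul_of_pos_left h1 hc'
        simpa using this
      omega
    rw [Finset.sum_eq_single (corner (c + 1) t)]
    · simp
    · intro j _ hj
      exact Set.indicator_of_notMem (fun h => hj (Eq.symm h)) _
    · exact fun h => absurd hmem h
  rw [integral_congr_ae hae, integral_finsetSum]
  · rw [Finset.mul_sum]
    refine Finset.sum_congr rfl fun j hj => ?_
    rw [integral_indicator_const _ (hm j), smul_eq_mul, hms, Measure.real, volume_pi_pi,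
      Finset.prod_congr rfl fun i _ => volume_floor_eq hc (mem_cube.1 hj i).1 (mem_cube.1 hj i).2,
      Finset.prod_const, Finset.card_univ, Fintype.card_fin, ENNReal.toReal_pow,
      ENNReal.toReal_ofReal (by positivity), inv_pow]
  · intro j _
    exact (integrable_const (g j)).indicator (hm j)

theorem cube_subset_succ (c : ℕ) : cube d c ⊆ cube d (c + 1) := by
  intro k hk
  rw [mem_cube] at hk ⊢
  intro i
  have := hk i
  push_cast
  omega

/-- Removing the outer layer of the cube hardly changes an average. -/
theorem abs_avg_cube_succ_sub_le {c : ℕ} (hc : 1 ≤ c) {b : (Fin d → ℤ) → ℝ} {M : ℝ}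
    (hb : ∀ j ∈ cube d (c + 1), |b j| ≤ M) :
    |(((c + 1 : ℕ) : ℝ) ^ d)⁻¹ * ∑ j ∈ cube d (c + 1), b j -
        ((c : ℝ) ^ d)⁻¹ * ∑ j ∈ cube d c, b j| ≤
      2 * (1 - ((c : ℝ) / ((c + 1 : ℕ) : ℝ)) ^ d) * M := by
  have hc' : (0 : ℝ) < (c : ℝ) ^ d := pow_pos (by exact_mod_cast hc) d
  have hn : (0 : ℝ) < ((c + 1 : ℕ) : ℝ) ^ d := pow_pos (by positivity) d
  have hle : (c : ℝ) ^ d ≤ ((c + 1 : ℕ) : ℝ) ^ d :=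
    pow_le_pow_left₀ (Nat.cast_nonneg _) (by push_cast; linarith) d
  rw [← Finset.sum_sdiff (cube_subset_succ c), div_pow]
  have h1 : |∑ j ∈ cube d (c + 1) \ cube d c, b j| ≤
      (((c + 1 : ℕ) : ℝ) ^ d - (c : ℝ) ^ d) * M := by
    refine (Finset.abs_sum_le_sum_abs _ _).trans ((Finset.sum_le_card_nsmul _ _ M fun j hj =>
      hb j (Finset.mem_sdiff.1 hj).1).trans_eq ?_)
    rw [Finset.card_sdiff_of_subset (cube_subset_succ c), card_cube, card_cube, nsmul_eq_mul,
      Nat.cast_sub (Nat.pow_le_pow_left (Nat.le_succ c) d)]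
    push_cast
    ring
  have h2 : |∑ j ∈ cube d c, b j| ≤ (c : ℝ) ^ d * M := by
    refine (Finset.abs_sum_le_sum_abs _ _).trans ((Finset.sum_le_card_nsmul _ _ M fun j hj =>
      hb j (cube_subset_succ c hj)).trans_eq ?_)
    rw [card_cube, nsmul_eq_mul]
    push_cast
    ring
  set N := ((c + 1 : ℕ) : ℝ) ^ d
  set K := (c : ℝ) ^ d
  have e : N⁻¹ * (∑ j ∈ cube d (c + 1) \ cube d c, b j + ∑ j ∈ cube d c, b j) -
      K⁻¹ * ∑ j ∈ cube d c, b j = N⁻¹ * (∑ j ∈ cube d (c + 1) \ cube d c, b j) -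
      (K⁻¹ - N⁻¹) * ∑ j ∈ cube d c, b j := by ring
  rw [e]
  have hinv : 0 ≤ K⁻¹ - N⁻¹ := sub_nonneg.2 (inv_anti₀ hc' hle)
  refine (abs_sub _ _).trans ?_
  rw [abs_mul, abs_mul, abs_of_pos (inv_pos.2 hn), abs_of_nonneg hinv]
  refine (add_le_add (mul_le_mul_of_nonneg_left h1 (inv_pos.2 hn).le)
    (mul_le_mul_of_nonneg_left h2 hinv)).trans_eq ?_
  field_simp
  ring

theorem abs_prod_sub_prod_le {ι : Type*} (s : Finset ι) {u v : ι → ℝ} {η : ℝ}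
    (hu : ∀ i ∈ s, |u i| ≤ 1) (hv : ∀ i ∈ s, |v i| ≤ 1) (h : ∀ i ∈ s, |u i - v i| ≤ η) :
    |∏ i ∈ s, u i - ∏ i ∈ s, v i| ≤ s.card * η := by
  classical
  induction s using Finset.induction_on with
  | empty => simp
  | insert a s ha ih =>
    rw [Finset.prod_insert ha, Finset.prod_insert ha, Finset.card_insert_of_notMem ha]
    have e : u a * ∏ i ∈ s, u i - v a * ∏ i ∈ s, v i =
        (u a - v a) * ∏ i ∈ s, u i + v a * (∏ i ∈ s, u i - ∏ i ∈ s, v i) := by ring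
    rw [e]
    refine (abs_add_le _ _).trans ?_
    rw [abs_mul, abs_mul, Finset.abs_prod]
    have h1 : ∏ i ∈ s, |u i| ≤ 1 := Finset.prod_le_one (fun i _ => abs_nonneg _)
      fun i hi => hu i (Finset.mem_insert_of_mem hi)
    have h2 := ih (fun i hi => hu i (Finset.mem_insert_of_mem hi))
      (fun i hi => hv i (Finset.mem_insert_of_mem hi))
      (fun i hi => h i (Finset.mem_insert_of_mem hi))
    have h3 := h a (Finset.mem_insert_self a s)
    have h4 := hv a (Finset.mem_insert_self a s)
    have h5 := mul_le_mul h3 h1 (Finset.prod_nonneg fun i _ => abs_nonneg _)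
      ((abs_nonneg _).trans h3)
    have h6 := mul_le_mul h4 h2 (abs_nonneg _) zero_le_one
    push_cast
    linarith

theorem abs_sub_corner_div_le (c : ℕ) (t : Fin d → I) (i : Fin d) :
    |(t i : ℝ) - (corner (c + 1) t i : ℝ) / ((c + 1 : ℕ) : ℝ)| ≤ 1 / ((c + 1 : ℕ) : ℝ) := by
  have hc : (0 : ℝ) < ((c + 1 : ℕ) : ℝ) := by positivity
  have e : (t i : ℝ) - (corner (c + 1) t i : ℝ) / ((c + 1 : ℕ) : ℝ) =
      (((c + 1 : ℕ) : ℝ) * t i - (⌊(c : ℝ) * (t i : ℝ)⌋ + 1)) / ((c + 1 : ℕ) : ℝ) := by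
    rw [corner_succ_apply]
    push_cast
    field_simp
  rw [e, abs_div, abs_of_pos hc]
  refine div_le_div_of_nonneg_right ?_ hc.le
  have h1 := Int.floor_le ((c : ℝ) * (t i : ℝ))
  have h2 := Int.lt_floor_add_one ((c : ℝ) * (t i : ℝ))
  have h3 := (t i).2.1
  have h4 := (t i).2.2
  rw [abs_le]
  push_cast
  constructor <;> linarith

end Boxes

section Discretization

variable {d : ℕ} {Ω : Type*}

theorem sampleMean_eq (X : (Fin d → ℤ) → Ω → ℝ) (m : ℝ) {n : ℕ} (hn : 1 ≤ n) (ω : Ω) :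
    sampleMean X n ω = m + ((n : ℝ) ^ d)⁻¹ * ∑ k ∈ cube d n, (X k ω - m) := by
  have : (n : ℝ) ^ d ≠ 0 := pow_ne_zero _ (by exact_mod_cast (by omega : n ≠ 0))
  rw [Finset.sum_sub_distrib, Finset.sum_const, card_cube, sampleMean, nsmul_eq_mul]
  push_cast
  field_simp
  ring

theorem sStar_eq (X : (Fin d → ℤ) → Ω → ℝ) (m : ℝ) {n : ℕ} (hn : 1 ≤ n) {j : Fin d → ℤ}
    (hj : j ∈ cube d n) (ω : Ω) :
    sStar X n j ω = ∑ k ∈ box j, (X k ω - m) -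
      (∏ i, ((j i : ℝ) / n)) * ∑ k ∈ cube d n, (X k ω - m) := by
  have h0 : ∀ i, 0 ≤ j i := fun i => by have := (mem_cube.1 hj i).1; omega
  simp only [sStar, sampleMean_eq X m hn, Finset.sum_sub_distrib, Finset.sum_const, nsmul_eq_mul,
    cast_card_box h0, Finset.prod_div_distrib, Finset.card_univ, Fintype.card_fin,
    Finset.prod_const]
  field_simp
  ring

theorem sStarVar_eq (X : (Fin d → ℤ) → Ω → ℝ) {n : ℕ} (hn : 1 ≤ n) (ω : Ω) :
    sStarVar X n ω = ((n : ℝ) ^ d)⁻¹ * ∑ j ∈ cube d n, sStar X n j ω ^ 2 -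
      (((n : ℝ) ^ d)⁻¹ * ∑ j ∈ cube d n, sStar X n j ω) ^ 2 := by
  have : (n : ℝ) ^ d ≠ 0 := pow_ne_zero _ (by exact_mod_cast (by omega : n ≠ 0))
  simp only [sStarVar, sub_sq, Finset.sum_add_distrib, Finset.sum_sub_distrib, ← Finset.sum_mul,
    ← Finset.mul_sum, Finset.sum_const, card_cube, nsmul_eq_mul, sStarMean]
  push_cast
  field_simp
  ring

/-- The relative error made when the empirical variance of the `S*_{n,j}` is replaced by the
functional `vsFunctional` of the partial-sum process. -/
noncomputable def discretizationError (d n : ℕ) : ℝ :=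
  24 * (1 - (((n - 1 : ℕ) : ℝ) / (n : ℝ)) ^ d) + 8 * (d / (n : ℝ))

theorem tendsto_discretizationError (d : ℕ) :
    Tendsto (discretizationError d) atTop (𝓝 0) := by
  have h1 : Tendsto (fun n : ℕ => ((n - 1 : ℕ) : ℝ) / (n : ℝ)) atTop (𝓝 1) := by
    have h := (tendsto_const_nhds (x := (1 : ℝ)) (f := atTop)).sub
      (tendsto_one_div_atTop_nhds_zero_nat (𝕜 := ℝ))
    rw [sub_zero] at h
    refine h.congr' ?_
    filter_upwards [eventually_ge_atTop 1] with n hn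
    have : (n : ℝ) ≠ 0 := by exact_mod_cast (by omega : n ≠ 0)
    rw [Nat.cast_sub hn]
    field_simp
    simp
  have h2 : Tendsto (fun n : ℕ => (d : ℝ) / (n : ℝ)) atTop (𝓝 0) :=
    tendsto_const_div_atTop_nhds_zero_nat _
  have := (((h1.pow d).const_sub 1).const_mul 24).add (h2.const_mul 8)
  simpa [discretizationError, funext_iff] using! this

theorem abs_sStarVar_sub_le [MeasurableSpace Ω] (X : (Fin d → ℤ) → Ω → ℝ) (P : Measure Ω)
    {n : ℕ} (hn : 2 ≤ n)
    (a : ℝ) (ω : Ω) :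
    |a⁻¹ ^ 2 * sStarVar X n ω - vsFunctional (partialSumProcess X P n a ω)| ≤
      discretizationError d n * (partialSumProcess X P n a ω).supNorm ^ 2 := by
  obtain ⟨c, rfl⟩ : ∃ c, n = c + 1 := ⟨n - 1, by omega⟩
  have hc : 1 ≤ c := by omega
  set y := partialSumProcess X P (c + 1) a ω with hy
  set M := y.supNorm
  have hM : 0 ≤ M := y.supNorm_nonneg
  set m := ∫ ω', X 0 ω' ∂P with hm
  have hyt : ∀ t, y t = a⁻¹ * ∑ k ∈ box (corner (c + 1) t), (X k ω - m) := fun t => rfl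
  have hy1 : y 1 = a⁻¹ * ∑ k ∈ cube d (c + 1), (X k ω - m) := by rw [hyt, corner_one]; rfl
  set b : (Fin d → ℤ) → ℝ := fun j => a⁻¹ * ∑ k ∈ box j, (X k ω - m) -
    (∏ i, ((j i : ℝ) / ((c + 1 : ℕ) : ℝ))) * y 1 with hbdef
  have hbs : ∀ j ∈ cube d (c + 1), a⁻¹ * sStar X (c + 1) j ω = b j := by
    intro j hj
    rw [sStar_eq X m (by omega) hj, hbdef, hy1]
    ring
  have hV : a⁻¹ ^ 2 * sStarVar X (c + 1) ω =
      (((c + 1 : ℕ) : ℝ) ^ d)⁻¹ * ∑ j ∈ cube d (c + 1), b j ^ 2 -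
        ((((c + 1 : ℕ) : ℝ) ^ d)⁻¹ * ∑ j ∈ cube d (c + 1), b j) ^ 2 := by
    rw [sStarVar_eq X (by omega), ← Finset.sum_congr rfl hbs,
      ← Finset.sum_congr rfl fun j hj => congrArg (· ^ 2) (hbs j hj)]
    simp only [mul_pow, ← Finset.mul_sum]
    ring
  have hratio : ∀ j ∈ cube d (c + 1), ∀ i, |(j i : ℝ) / ((c + 1 : ℕ) : ℝ)| ≤ 1 := by
    intro j hj i
    have h := mem_cube.1 hj i
    have h1 : (1 : ℝ) ≤ j i := by exact_mod_cast h.1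
    have h2 : (j i : ℝ) ≤ ((c + 1 : ℕ) : ℝ) := by exact_mod_cast h.2
    rw [abs_of_nonneg (div_nonneg (by linarith) (Nat.cast_nonneg _))]
    exact (div_le_one (by positivity)).2 h2
  have hb : ∀ j ∈ cube d (c + 1), |b j| ≤ 2 * M := by
    intro j hj
    obtain ⟨t, ht⟩ := exists_corner_eq hc hj
    have h1 : |a⁻¹ * ∑ k ∈ box j, (X k ω - m)| ≤ M := by
      rw [← ht, ← hyt]; exact y.abs_le_supNorm t
    have h2 : |∏ i, ((j i : ℝ) / ((c + 1 : ℕ) : ℝ))| ≤ 1 := by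
      rw [Finset.abs_prod]
      exact Finset.prod_le_one (fun i _ => abs_nonneg _) fun i _ => hratio j hj i
    have h3 : |(∏ i, ((j i : ℝ) / ((c + 1 : ℕ) : ℝ))) * y 1| ≤ 1 * M := by
      rw [abs_mul]
      exact mul_le_mul h2 (y.abs_le_supNorm 1) (abs_nonneg _) zero_le_one
    have h4 := abs_sub (a⁻¹ * ∑ k ∈ box j, (X k ω - m))
      ((∏ i, ((j i : ℝ) / ((c + 1 : ℕ) : ℝ))) * y 1)
    simp only [hbdef]
    linarith
  have hβ : ∀ t, |b (corner (c + 1) t) - bridge y t| ≤ d / ((c + 1 : ℕ) : ℝ) * M := by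
    intro t
    have e : b (corner (c + 1) t) - bridge y t = (∏ i, (t i : ℝ) -
        ∏ i, ((corner (c + 1) t i : ℝ) / ((c + 1 : ℕ) : ℝ))) * y 1 := by
      simp only [hbdef, bridge, hyt t]
      ring
    rw [e, abs_mul]
    refine mul_le_mul ?_ (y.abs_le_supNorm 1) (abs_nonneg _) (by positivity)
    refine (abs_prod_sub_prod_le _ (η := 1 / ((c + 1 : ℕ) : ℝ)) (fun i _ => ?_)
      (fun i _ => hratio _ (corner_mem_cube c t) i)
      (fun i _ => abs_sub_corner_div_le c t i)).trans_eq ?_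
    · rw [abs_of_nonneg (t i).2.1]; exact (t i).2.2
    · rw [Finset.card_univ, Fintype.card_fin]
      ring
  have hbm : AEStronglyMeasurable fun t : Fin d → I => b (corner (c + 1) t) :=
    (isCadlag_corner (c + 1) b).aestronglyMeasurable
  have hbb : ∀ t : Fin d → I, |b (corner (c + 1) t)| ≤ 2 * M := fun t =>
    hb _ (corner_mem_cube c t)
  have hbL : ∀ p, MemLp (fun t : Fin d → I => b (corner (c + 1) t)) p := fun p =>
    MemLp.of_bound hbm (2 * M) (ae_of_all _ hbb)
  have i1 : |(∫ t : Fin d → I, b (corner (c + 1) t)) - ∫ t, bridge y t| ≤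
      d / ((c + 1 : ℕ) : ℝ) * M := by
    rw [← integral_sub ((hbL 1).integrable le_rfl) ((memLp_bridge y 1).integrable le_rfl)]
    have := norm_integral_le_of_norm_le_const (μ := (volume : Measure (Fin d → I)))
      (f := fun t => b (corner (c + 1) t) - bridge y t) (ae_of_all _ hβ)
    simpa using this
  have i2 : |(∫ t : Fin d → I, b (corner (c + 1) t) ^ 2) - ∫ t, bridge y t ^ 2| ≤
      d / ((c + 1 : ℕ) : ℝ) * M * (4 * M) := by
    rw [← integral_sub (hbL 2).integrable_sq (memLp_bridge y 2).integrable_sq]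
    have := norm_integral_le_of_norm_le_const (μ := (volume : Measure (Fin d → I)))
      (f := fun t => b (corner (c + 1) t) ^ 2 - bridge y t ^ 2)
      (C := d / ((c + 1 : ℕ) : ℝ) * M * (4 * M))
      (ae_of_all _ fun t => ?_)
    · simpa using this
    · rw [sq_sub_sq, mul_comm, Real.norm_eq_abs, abs_mul]
      refine mul_le_mul (hβ t) ((abs_add_le _ _).trans ?_) (abs_nonneg _) (by positivity)
      linarith [hbb t, abs_bridge_le y t]
  have a1 := abs_avg_cube_succ_sub_le hc hb
  have a2 := abs_avg_cube_succ_sub_le (b := fun j => b j ^ 2) (M := (2 * M) ^ 2) hc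
    (fun j hj => by rw [abs_pow]; exact pow_le_pow_left₀ (abs_nonneg _) (hb j hj) 2)
  rw [← integral_corner hc] at a1 a2
  have hA : |(((c + 1 : ℕ) : ℝ) ^ d)⁻¹ * ∑ j ∈ cube d (c + 1), b j| ≤ 2 * M := by
    rw [abs_mul, abs_of_nonneg (by positivity)]
    have h2 : |∑ j ∈ cube d (c + 1), b j| ≤ ((c + 1 : ℕ) : ℝ) ^ d * (2 * M) := by
      refine (Finset.abs_sum_le_sum_abs _ _).trans
        ((Finset.sum_le_card_nsmul _ _ _ hb).trans_eq ?_)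
      rw [card_cube, nsmul_eq_mul]
      push_cast
      ring
    rw [inv_mul_le_iff₀ (by positivity)]
    exact h2
  have hB : |∫ t, bridge y t| ≤ 2 * M := by
    have := norm_integral_le_of_norm_le_const (μ := (volume : Measure (Fin d → I)))
      (f := bridge y) (ae_of_all _ (abs_bridge_le y))
    simpa using this
  rw [hV, vsFunctional]
  set A1 := (((c + 1 : ℕ) : ℝ) ^ d)⁻¹ * ∑ j ∈ cube d (c + 1), b j
  set A2 := (((c + 1 : ℕ) : ℝ) ^ d)⁻¹ * ∑ j ∈ cube d (c + 1), b j ^ 2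
  set B1 := ∫ t, bridge y t
  set B2 := ∫ t, bridge y t ^ 2
  have hη : 0 ≤ 1 - ((c : ℝ) / ((c + 1 : ℕ) : ℝ)) ^ d := by
    have : (c : ℝ) / ((c + 1 : ℕ) : ℝ) ≤ 1 :=
      (div_le_one (by positivity)).2 (by push_cast; linarith)
    have := pow_le_one₀ (n := d) (by positivity) this
    linarith
  set η := 1 - ((c : ℝ) / ((c + 1 : ℕ) : ℝ)) ^ d
  set κ := (d : ℝ) / ((c + 1 : ℕ) : ℝ)
  have hκ : 0 ≤ κ := by positivity
  have s1 : |A1 - B1| ≤ 2 * η * (2 * M) + κ * M := (abs_sub_le _ _ _).trans (add_le_add a1 i1)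
  have s2 : |A2 - B2| ≤ 2 * η * (2 * M) ^ 2 + κ * M * (4 * M) :=
    (abs_sub_le _ _ _).trans (add_le_add a2 i2)
  have s3 : |A1 ^ 2 - B1 ^ 2| ≤ (2 * η * (2 * M) + κ * M) * (4 * M) := by
    rw [sq_sub_sq, mul_comm, abs_mul]
    refine mul_le_mul s1 ((abs_add_le _ _).trans (by linarith)) (abs_nonneg _) (by positivity)
  have e : A2 - A1 ^ 2 - (B2 - B1 ^ 2) = (A2 - B2) - (A1 ^ 2 - B1 ^ 2) := by ring
  rw [e]
  refine ((abs_sub _ _).trans (add_le_add s2 s3)).trans_eq ?_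
  simp only [discretizationError, Nat.add_sub_cancel]
  change _ = (24 * η + 8 * κ) * M ^ 2
  ring

end Discretization

/-! ### An inequality for products of Dirichlet kernels -/

section Kernel

/-- A sum of `N` exponentials with unimodular frequencies satisfies a linear recurrence along every
arithmetic progression, with coefficients bounded in terms of `N` and unimodular extreme
coefficients. Hence one value is controlled by the next `N` values. -/
theorem norm_expSum_le {ι : Type*} (T : Finset ι) (w : ι → ℂ) (hw : ∀ s ∈ T, ‖w s‖ = 1)
    (h : ℕ) (c : ι → ℂ) (m : ℕ) (B : ℝ) (hB0 : 0 ≤ B)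
    (hB : ∀ k ∈ Finset.Icc 1 T.card, ‖∑ s ∈ T, c s * w s ^ (m + k * h)‖ ≤ B) :
    ‖∑ s ∈ T, c s * w s ^ m‖ ≤ 3 ^ T.card * B := by
  classical
  induction T using Finset.induction_on generalizing c m B with
  | empty => simpa using hB0
  | insert a T ha ih =>
    -- the difference operator `g ↦ g (m + h) - (w a) ^ h * g m` removes the frequency `w a`
    set g : ℕ → ℂ := fun m => ∑ s ∈ insert a T, c s * w s ^ m with hg
    have hdiff : ∀ m, ∑ s ∈ T, (c s * (w s ^ h - w a ^ h)) * w s ^ m =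
        g (m + h) - w a ^ h * g m := by
      intro m
      simp only [hg, Finset.sum_insert ha, mul_add, Finset.mul_sum]
      have : ∑ s ∈ T, c s * (w s ^ h - w a ^ h) * w s ^ m =
          ∑ s ∈ T, c s * w s ^ (m + h) - ∑ s ∈ T, w a ^ h * (c s * w s ^ m) := by
        rw [← Finset.sum_sub_distrib]
        refine Finset.sum_congr rfl fun s _ => ?_
        ring
      rw [this]
      ring
    have hwa : ∀ n, ‖w a ^ n‖ = 1 := fun n => by
      rw [norm_pow, hw a (Finset.mem_insert_self a T), one_pow]
    rw [Finset.card_insert_of_notMem ha] at hB ⊢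
    have hB' : ∀ k ∈ Finset.Icc 1 (T.card + 1), ‖g (m + k * h)‖ ≤ B := hB
    have h1 := ih (fun s hs => hw s (Finset.mem_insert_of_mem hs))
      (fun s => c s * (w s ^ h - w a ^ h)) m (2 * B) (by positivity) fun k hk => by
        rw [Finset.mem_Icc] at hk
        rw [hdiff]
        refine (norm_sub_le _ _).trans ?_
        rw [norm_mul, hwa, one_mul, two_mul]
        refine add_le_add ?_ (hB' k (Finset.mem_Icc.2 (by omega)))
        have := hB' (k + 1) (Finset.mem_Icc.2 (by omega))
        rwa [add_mul, one_mul, ← add_assoc] at this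
    rw [hdiff] at h1
    have h2 : ‖g (m + h)‖ ≤ B := by
      have := hB' 1 (Finset.mem_Icc.2 (by omega))
      rwa [one_mul] at this
    have h3 : ‖g m‖ ≤ ‖g (m + h)‖ + ‖g (m + h) - w a ^ h * g m‖ := by
      have e : w a ^ h * g m = g (m + h) - (g (m + h) - w a ^ h * g m) := by ring
      calc ‖g m‖ = ‖w a ^ h * g m‖ := by rw [norm_mul, hwa, one_mul]
        _ ≤ _ := by
          conv_lhs => rw [e]
          exact norm_sub_le _ _
    have h4 : (1 : ℝ) ≤ 3 ^ T.card := one_le_pow₀ (by norm_num)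
    have h5 : B ≤ 3 ^ T.card * B := le_mul_of_one_le_left hB0 h4
    calc ‖g m‖ ≤ B + 3 ^ T.card * (2 * B) := h3.trans (add_le_add h2 h1)
      _ ≤ 3 ^ T.card * B + 3 ^ T.card * (2 * B) := by linarith
      _ = 3 ^ (T.card + 1) * B := by ring

theorem exists_norm_prod_one_sub_pow_le {ι : Type*} (s : Finset ι) (z : ι → ℂ)
    (hz : ∀ i ∈ s, ‖z i‖ = 1) (m h : ℕ) :
    ∃ k ∈ Finset.Icc 1 (2 ^ s.card), ∏ i ∈ s, ‖1 - z i ^ m‖ ≤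
      3 ^ 2 ^ s.card * ∏ i ∈ s, ‖1 - z i ^ (m + k * h)‖ := by
  classical
  have hexp : ∀ n, ∏ i ∈ s, ‖1 - z i ^ n‖ =
      ‖∑ S ∈ s.powerset, (-1 : ℂ) ^ S.card * (∏ i ∈ S, z i) ^ n‖ := by
    intro n
    rw [← norm_prod]
    congr 1
    have := Finset.prod_add (fun i => -(z i ^ n)) (fun _ => (1 : ℂ)) s
    simp only [Finset.prod_const_one, mul_one] at this
    rw [Finset.prod_congr rfl fun i _ => (by ring : 1 - z i ^ n = -(z i ^ n) + 1), this]
    refine Finset.sum_congr rfl fun S _ => ?_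
    rw [Finset.prod_neg, Finset.prod_pow]
  have hN : (Finset.Icc 1 (2 ^ s.card)).Nonempty :=
    Finset.nonempty_Icc.2 (Nat.one_le_two_pow)
  obtain ⟨k, hk, hmax⟩ := Finset.exists_max_image _
    (fun k => ∏ i ∈ s, ‖1 - z i ^ (m + k * h)‖) hN
  refine ⟨k, hk, ?_⟩
  have := norm_expSum_le s.powerset (fun S => ∏ i ∈ S, z i) (fun S hS => by
    rw [norm_prod]
    exact Finset.prod_eq_one fun i hi => hz i (Finset.mem_powerset.1 hS hi)) h
    (fun S => (-1 : ℂ) ^ S.card) m (∏ i ∈ s, ‖1 - z i ^ (m + k * h)‖)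
    (Finset.prod_nonneg fun _ _ => norm_nonneg _) fun k' hk' => by
      rw [← hexp]
      rw [Finset.card_powerset] at hk'
      exact hmax k' hk'
  rw [← hexp, Finset.card_powerset] at this
  exact this

theorem norm_one_sub_pow_le {z : ℂ} (hz : ‖z‖ = 1) (m : ℕ) : ‖1 - z ^ m‖ ≤ m * ‖1 - z‖ := by
  rw [← mul_neg_geom_sum, norm_mul, mul_comm]
  refine mul_le_mul_of_nonneg_right ?_ (norm_nonneg _)
  refine (norm_sum_le _ _).trans ?_
  simp [hz]

/-- As long as the powers of `z` have not turned by more than an angle of order one, `1 - z ^ m`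
grows linearly. -/
theorem le_norm_one_sub_pow {z : ℂ} (hz : ‖z‖ = 1) {m : ℕ} (hm : m * ‖1 - z‖ ≤ 1) :
    m * ‖1 - z‖ / 2 ≤ ‖1 - z ^ m‖ := by
  have h1 : ‖(m : ℂ) - ∑ k ∈ Finset.range m, z ^ k‖ ≤ m / 2 := by
    have e : (m : ℂ) - ∑ k ∈ Finset.range m, z ^ k = ∑ k ∈ Finset.range m, (1 - z ^ k) := by
      simp
    rw [e]
    calc ‖∑ k ∈ Finset.range m, (1 - z ^ k)‖ ≤ ∑ k ∈ Finset.range m, (k : ℝ) * ‖1 - z‖ :=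
          (norm_sum_le _ _).trans (Finset.sum_le_sum fun k _ => norm_one_sub_pow_le hz k)
      _ = (∑ k ∈ Finset.range m, (k : ℝ)) * ‖1 - z‖ := by rw [Finset.sum_mul]
      _ ≤ ((m : ℝ) * m / 2) * ‖1 - z‖ := by
          refine mul_le_mul_of_nonneg_right ?_ (norm_nonneg _)
          rw [← Nat.cast_sum, Finset.sum_range_id]
          refine Nat.cast_div_le.trans ?_
          rw [Nat.cast_mul]
          have : ((m - 1 : ℕ) : ℝ) ≤ m := by exact_mod_cast Nat.sub_le m 1
          push_cast
          gcongr
      _ = (m / 2) * (m * ‖1 - z‖) := by ring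
      _ ≤ m / 2 := mul_le_of_le_one_right (by positivity) hm
  have h2 : (m : ℝ) / 2 ≤ ‖∑ k ∈ Finset.range m, z ^ k‖ := by
    have := norm_sub_norm_le (m : ℂ) ((m : ℂ) - ∑ k ∈ Finset.range m, z ^ k)
    rw [sub_sub_cancel, Complex.norm_natCast] at this
    linarith
  rw [← mul_neg_geom_sum, norm_mul]
  have := mul_le_mul_of_nonneg_left h2 (norm_nonneg (1 - z))
  linarith

/-- Some `m ≤ Q` makes all the factors `1 - z i ^ m` simultaneously as large as possible, up to
constants. The slowest frequency is treated last: as long as it has not turned, its factor grows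
linearly, and the recurrence along arithmetic progressions moves an `m` that is good for the other
frequencies to the far end of this range. -/
theorem exists_le_prod_norm_one_sub_pow (p : ℕ) : ∃ c : ℝ, 0 < c ∧
    ∀ (ι : Type) (s : Finset ι) (z : ι → ℂ) (Q : ℕ), s.card = p → (∀ i ∈ s, ‖z i‖ = 1) → 1 ≤ Q →
      ∃ m ∈ Finset.Icc 1 Q,
        c * ∏ i ∈ s, min 1 (Q * ‖1 - z i‖) ≤ ∏ i ∈ s, ‖1 - z i ^ m‖ := by
  classical
  induction p with
  | zero =>
    refine ⟨1, one_pos, fun ι s z Q hs _ hQ => ⟨1, Finset.mem_Icc.2 ⟨le_rfl, hQ⟩, ?_⟩⟩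
    rw [Finset.card_eq_zero.1 hs]
    simp
  | succ p ih =>
    obtain ⟨c', hc', ih⟩ := ih
    set N : ℕ := 2 ^ p with hN
    have hN1 : 1 ≤ N := Nat.one_le_two_pow
    have hN0 : (0 : ℝ) < N := by exact_mod_cast hN1
    set κ : ℝ := 1 / (16 * N) with hκ
    have hκ0 : 0 < κ := by positivity
    have hκN : κ * (16 * N) = 1 := by rw [hκ]; field_simp
    refine ⟨(3 ^ N)⁻¹ * min c' 1 * κ ^ (p + 1), by positivity, ?_⟩
    intro ι s z Q hs hz hQ
    have hQ0 : (0 : ℝ) < Q := by exact_mod_cast hQ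
    obtain ⟨a, has, hmin⟩ := Finset.exists_min_image s (fun i => ‖1 - z i‖)
      (Finset.card_pos.1 (by omega))
    rcases (norm_nonneg (1 - z a)).eq_or_lt with h0 | hδ
    · refine ⟨1, Finset.mem_Icc.2 ⟨le_rfl, hQ⟩, ?_⟩
      rw [Finset.prod_eq_zero has (by rw [← h0]; simp), mul_zero]
      exact Finset.prod_nonneg fun _ _ => norm_nonneg _
    have h3N : (1 : ℝ) ≤ 3 ^ N := one_le_pow₀ (by norm_num)
    have hc1 : (3 ^ N)⁻¹ * min c' 1 ≤ 1 :=
      mul_le_one₀ (inv_le_one_of_one_le₀ h3N) (by positivity) (min_le_right _ _)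
    have hmn : ∀ i, 0 ≤ min 1 (Q * ‖1 - z i‖) := fun i => by positivity
    -- `M` is the time up to which the slowest frequency has not turned
    set M : ℕ := min Q ⌊1 / ‖1 - z a‖⌋₊ with hM
    have hMa : (M : ℝ) * ‖1 - z a‖ ≤ 1 := by
      have h1 : (M : ℝ) ≤ 1 / ‖1 - z a‖ := by
        refine le_trans ?_ (Nat.floor_le (by positivity))
        exact_mod_cast min_le_right _ _
      exact (le_div_iff₀ hδ).1 h1
    by_cases hMN : M < 2 * N
    · refine ⟨1, Finset.mem_Icc.2 ⟨le_rfl, hQ⟩, ?_⟩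
      have key : ∀ i ∈ s, κ * min 1 (Q * ‖1 - z i‖) ≤ ‖1 - z i ^ 1‖ := by
        intro i hi
        rw [pow_one]
        have hκi : κ * (2 * N) ≤ 1 := by nlinarith
        rcases min_choice Q ⌊1 / ‖1 - z a‖⌋₊ with hc | hc
        · rw [← hM] at hc
          have hQN : (Q : ℝ) ≤ 2 * N := by
            have : Q < 2 * N := hc ▸ hMN
            exact_mod_cast this.le
          calc κ * min 1 (Q * ‖1 - z i‖) ≤ κ * (Q * ‖1 - z i‖) :=
                mul_le_mul_of_nonneg_left (min_le_right _ _) hκ0.le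
            _ ≤ κ * (2 * N * ‖1 - z i‖) := by gcongr
            _ = κ * (2 * N) * ‖1 - z i‖ := by ring
            _ ≤ ‖1 - z i‖ := mul_le_of_le_one_left (norm_nonneg _) hκi
        · rw [← hM] at hc
          have h1 : 1 / ‖1 - z a‖ < 2 * N := by
            have h2 := Nat.lt_floor_add_one (1 / ‖1 - z a‖)
            rw [← hc] at h2
            have h3 : (M : ℝ) + 1 ≤ 2 * N := by exact_mod_cast hMN
            linarith
          have h2 : 1 < 2 * N * ‖1 - z a‖ := (div_lt_iff₀ hδ).1 h1
          calc κ * min 1 (Q * ‖1 - z i‖) ≤ κ * 1 :=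
                mul_le_mul_of_nonneg_left (min_le_left _ _) hκ0.le
            _ ≤ κ * (2 * N * ‖1 - z a‖) := mul_le_mul_of_nonneg_left h2.le hκ0.le
            _ = κ * (2 * N) * ‖1 - z a‖ := by ring
            _ ≤ ‖1 - z a‖ := mul_le_of_le_one_left (norm_nonneg _) hκi
            _ ≤ ‖1 - z i‖ := hmin i hi
      calc (3 ^ N)⁻¹ * min c' 1 * κ ^ (p + 1) * ∏ i ∈ s, min 1 (Q * ‖1 - z i‖)
          ≤ 1 * κ ^ (p + 1) * ∏ i ∈ s, min 1 (Q * ‖1 - z i‖) := by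
            refine mul_le_mul_of_nonneg_right ?_ (Finset.prod_nonneg fun i _ => hmn i)
            exact mul_le_mul_of_nonneg_right hc1 (by positivity)
        _ = ∏ i ∈ s, κ * min 1 (Q * ‖1 - z i‖) := by
            rw [Finset.prod_mul_distrib, Finset.prod_const, hs, one_mul]
        _ ≤ _ := Finset.prod_le_prod (fun i _ => mul_nonneg hκ0.le (hmn i)) key
    · push Not at hMN
      set h : ℕ := M / (2 * N) with hh
      have hh1 : 1 ≤ h := (Nat.one_le_div_iff (by omega)).2 hMN
      have hhM : h * (2 * N) ≤ M := Nat.div_mul_le_self M (2 * N)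
      have hMh : (M : ℝ) ≤ h * (4 * N) := by
        have h1 : M < h * (2 * N) + 2 * N := Nat.lt_div_mul_add (by omega)
        have h2 : 2 * N ≤ h * (2 * N) := Nat.le_mul_of_pos_left _ hh1
        have : M ≤ h * (4 * N) := by nlinarith
        exact_mod_cast this
      have hscale : ∀ i ∈ s, 2 * κ * min 1 (Q * ‖1 - z i‖) ≤ h * ‖1 - z i‖ := by
        intro i hi
        have h1 : min 1 (Q * ‖1 - z i‖) / 2 ≤ M * ‖1 - z i‖ := by
          rcases min_choice Q ⌊1 / ‖1 - z a‖⌋₊ with hc | hc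
          · rw [← hM] at hc
            rw [hc]
            have := min_le_right 1 (Q * ‖1 - z i‖)
            have := hmn i
            linarith
          · rw [← hM] at hc
            have h2 := Nat.lt_floor_add_one (1 / ‖1 - z a‖)
            rw [← hc] at h2
            have h3 : (1 : ℝ) ≤ M := by exact_mod_cast (by omega : 1 ≤ M)
            have h4 : 1 / ‖1 - z a‖ ≤ 2 * M := by linarith
            have h5 := (div_le_iff₀ hδ).1 h4
            have h6 := mul_le_mul_of_nonneg_left (hmin i hi) (Nat.cast_nonneg (α := ℝ) M)
            have := min_le_left 1 (Q * ‖1 - z i‖)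
            linarith
        have h2 := mul_le_mul_of_nonneg_right hMh (norm_nonneg (1 - z i))
        have h3 : min 1 (Q * ‖1 - z i‖) ≤ h * ‖1 - z i‖ * (8 * N) := by nlinarith
        calc 2 * κ * min 1 (Q * ‖1 - z i‖) ≤ 2 * κ * (h * ‖1 - z i‖ * (8 * N)) :=
              mul_le_mul_of_nonneg_left h3 (by positivity)
          _ = (κ * (16 * N)) * (h * ‖1 - z i‖) := by ring
          _ = h * ‖1 - z i‖ := by rw [hκN, one_mul]
      have hcard : (s.erase a).card = p := by rw [Finset.card_erase_of_mem has, hs]; rfl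
      have hz' : ∀ i ∈ s.erase a, ‖z i‖ = 1 := fun i hi => hz i (Finset.mem_of_mem_erase hi)
      obtain ⟨m, hm, hprod⟩ := ih ι (s.erase a) z h hcard hz' hh1
      obtain ⟨k, hk, hrec⟩ := exists_norm_prod_one_sub_pow_le (s.erase a) z hz' m h
      rw [hcard, ← hN] at hk hrec
      rw [Finset.mem_Icc] at hm hk
      have hle : m + k * h ≤ M := by nlinarith
      have hge : h ≤ m + k * h := by nlinarith
      refine ⟨m + k * h, Finset.mem_Icc.2 ⟨by omega, hle.trans (min_le_left _ _)⟩, ?_⟩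
      have hafac : κ * min 1 (Q * ‖1 - z a‖) ≤ ‖1 - z a ^ (m + k * h)‖ := by
        have h1 : ((m + k * h : ℕ) : ℝ) * ‖1 - z a‖ ≤ 1 :=
          (mul_le_mul_of_nonneg_right (by exact_mod_cast hle) hδ.le).trans hMa
        have h2 := le_norm_one_sub_pow (hz a has) h1
        have h3 : (h : ℝ) * ‖1 - z a‖ ≤ ((m + k * h : ℕ) : ℝ) * ‖1 - z a‖ :=
          mul_le_mul_of_nonneg_right (by exact_mod_cast hge) hδ.le
        have h4 := hscale a has
        linarith
      have hother : c' * ∏ i ∈ s.erase a, κ * min 1 (Q * ‖1 - z i‖) ≤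
          3 ^ N * ∏ i ∈ s.erase a, ‖1 - z i ^ (m + k * h)‖ := by
        refine le_trans (mul_le_mul_of_nonneg_left ?_ hc'.le) (hprod.trans hrec)
        refine Finset.prod_le_prod (fun i _ => mul_nonneg hκ0.le (hmn i)) fun i hi => ?_
        have h1 := hscale i (Finset.mem_of_mem_erase hi)
        refine le_min ?_ ?_
        · have := min_le_left 1 (Q * ‖1 - z i‖)
          have hκ1 : κ ≤ 1 := by
            have : (1 : ℝ) ≤ N := by exact_mod_cast hN1
            nlinarith
          nlinarith [hmn i]
        · have := mul_nonneg hκ0.le (hmn i)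
          linarith
      rw [← Finset.mul_prod_erase s _ has, ← Finset.mul_prod_erase s _ has]
      rw [Finset.prod_mul_distrib, Finset.prod_const, hcard] at hother
      set A := ∏ i ∈ s.erase a, min 1 (Q * ‖1 - z i‖)
      set A' := ∏ i ∈ s.erase a, ‖1 - z i ^ (m + k * h)‖
      have hA : 0 ≤ A := Finset.prod_nonneg fun i _ => hmn i
      have hother' : (3 ^ N)⁻¹ * min c' 1 * (κ ^ p * A) ≤ A' := by
        have h1 : min c' 1 * (κ ^ p * A) ≤ 3 ^ N * A' :=
          (mul_le_mul_of_nonneg_right (min_le_left _ _) (by positivity)).trans hother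
        rw [mul_assoc]
        exact (inv_mul_le_iff₀ (by positivity)).2 h1
      calc (3 ^ N)⁻¹ * min c' 1 * κ ^ (p + 1) * (min 1 (Q * ‖1 - z a‖) * A)
          = (κ * min 1 (Q * ‖1 - z a‖)) * ((3 ^ N)⁻¹ * min c' 1 * (κ ^ p * A)) := by ring
        _ ≤ ‖1 - z a ^ (m + k * h)‖ * A' :=
            mul_le_mul hafac hother' (by positivity) (norm_nonneg _)

/-- A product of the factors `1 - z i ^ l i` with different exponents `l i ≤ Q` is dominated, in
square mean, by the products in which all the exponents agree. -/
theorem exists_prod_sq_norm_one_sub_pow_le (d : ℕ) : ∃ (C : ℝ) (K : ℕ), 0 < C ∧ 1 ≤ K ∧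
    ∀ (z : Fin d → ℂ) (Q : ℕ) (l : Fin d → ℕ), (∀ i, ‖z i‖ = 1) → 1 ≤ Q → (∀ i, l i ≤ Q) →
      ∏ i, ‖1 - z i ^ l i‖ ^ 2 ≤
        C / Q * ∑ n ∈ Finset.Icc 1 (K * Q), ∏ i, ‖1 - z i ^ n‖ ^ 2 := by
  obtain ⟨c, hc, H⟩ := exists_le_prod_norm_one_sub_pow d
  set N : ℕ := 2 ^ d with hN
  have hN1 : 1 ≤ N := Nat.one_le_two_pow
  refine ⟨(2 ^ d / c * 3 ^ N) ^ 2 * N, N + 1, by positivity, by omega, ?_⟩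
  intro z Q l hz hQ hl
  have hQ0 : (0 : ℝ) < Q := by exact_mod_cast hQ
  obtain ⟨m, hm, hmc⟩ := H (Fin d) Finset.univ z Q (by simp) (fun i _ => hz i) hQ
  rw [Finset.mem_Icc] at hm
  set f : ℕ → ℝ := fun n => ∏ i, ‖1 - z i ^ n‖ with hf
  have hf0 : ∀ n, 0 ≤ f n := fun n => Finset.prod_nonneg fun _ _ => norm_nonneg _
  have h1 : ∏ i, ‖1 - z i ^ l i‖ ≤ 2 ^ d / c * f m := by
    have h2 : ∏ i, ‖1 - z i ^ l i‖ ≤ ∏ i, 2 * min 1 (Q * ‖1 - z i‖) := by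
      refine Finset.prod_le_prod (fun _ _ => norm_nonneg _) fun i _ => ?_
      rw [mul_min_of_nonneg _ _ zero_le_two]
      refine le_min ?_ ?_
      · refine (norm_sub_le _ _).trans ?_
        rw [norm_pow, hz i]
        norm_num
      · have h3 := norm_one_sub_pow_le (hz i) (l i)
        have h4 : (l i : ℝ) * ‖1 - z i‖ ≤ Q * ‖1 - z i‖ :=
          mul_le_mul_of_nonneg_right (by exact_mod_cast hl i) (norm_nonneg _)
        have h5 : 0 ≤ (Q : ℝ) * ‖1 - z i‖ := by positivity
        linarith
    rw [Finset.prod_mul_distrib, Finset.prod_const, Finset.card_univ, Fintype.card_fin] at h2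
    refine h2.trans ?_
    rw [div_mul_eq_mul_div, mul_div_assoc]
    refine mul_le_mul_of_nonneg_left ?_ (by positivity)
    rw [le_div_iff₀ hc, mul_comm]
    exact hmc
  have h2 : ∀ h ∈ Finset.Icc 1 Q, f m ^ 2 ≤
      (3 ^ N) ^ 2 * ∑ k ∈ Finset.Icc 1 N, f (m + k * h) ^ 2 := by
    intro h _
    obtain ⟨k, hk, hrec⟩ := exists_norm_prod_one_sub_pow_le Finset.univ z (fun i _ => hz i) m h
    rw [Finset.card_univ, Fintype.card_fin, ← hN] at hk hrec
    have h3 := pow_le_pow_left₀ (hf0 m) hrec 2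
    rw [mul_pow] at h3
    refine h3.trans (mul_le_mul_of_nonneg_left ?_ (by positivity))
    exact Finset.single_le_sum (f := fun k => f (m + k * h) ^ 2) (fun _ _ => sq_nonneg _) hk
  have h3 : (Q : ℝ) * f m ^ 2 ≤
      (3 ^ N) ^ 2 * (N * ∑ n ∈ Finset.Icc 1 ((N + 1) * Q), f n ^ 2) := by
    have h4 := Finset.sum_le_sum h2
    rw [Finset.sum_const, Nat.card_Icc, Nat.add_sub_cancel, nsmul_eq_mul, ← Finset.mul_sum,
      Finset.sum_comm] at h4
    refine h4.trans (mul_le_mul_of_nonneg_left ?_ (by positivity))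
    have h5 : ∀ k ∈ Finset.Icc 1 N, ∑ h ∈ Finset.Icc 1 Q, f (m + k * h) ^ 2 ≤
        ∑ n ∈ Finset.Icc 1 ((N + 1) * Q), f n ^ 2 := by
      intro k hk
      rw [Finset.mem_Icc] at hk
      have hinj : Set.InjOn (fun h => m + k * h) (Finset.Icc 1 Q) := by
        intro x _ y _ hxy
        have : k * x = k * y := by simpa using hxy
        exact Nat.eq_of_mul_eq_mul_left (by omega) this
      rw [← Finset.sum_image (f := fun n => f n ^ 2) hinj]
      refine Finset.sum_le_sum_of_subset_of_nonneg ?_ fun _ _ _ => sq_nonneg _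
      intro n hn
      obtain ⟨h, hh, rfl⟩ := Finset.mem_image.1 hn
      rw [Finset.mem_Icc] at hh ⊢
      have : k * h ≤ N * Q := Nat.mul_le_mul hk.2 hh.2
      constructor
      · omega
      · rw [add_mul, one_mul]; omega
    refine (Finset.sum_le_card_nsmul _ _ _ h5).trans_eq ?_
    rw [Nat.card_Icc, Nat.add_sub_cancel, nsmul_eq_mul]
  have hsq : ∀ n, ∏ i, ‖1 - z i ^ n‖ ^ 2 = f n ^ 2 := fun n => Finset.prod_pow _ _ _
  simp only [hsq]
  rw [Finset.prod_pow]
  calc (∏ i, ‖1 - z i ^ l i‖) ^ 2 ≤ (2 ^ d / c * f m) ^ 2 :=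
        pow_le_pow_left₀ (Finset.prod_nonneg fun _ _ => norm_nonneg _) h1 2
    _ = (2 ^ d / c) ^ 2 / Q * (Q * f m ^ 2) := by field_simp
    _ ≤ (2 ^ d / c) ^ 2 / Q *
        ((3 ^ N) ^ 2 * (N * ∑ n ∈ Finset.Icc 1 ((N + 1) * Q), f n ^ 2)) :=
        mul_le_mul_of_nonneg_left h3 (by positivity)
    _ = _ := by ring

end Kernel

/-! ### Triangular weights and positive-definite functions -/

section Triangle

variable {d : ℕ}

/-- The product of triangles `∏ max 0 (1 - |j i| / n)`: the Bartlett weight, extended by zero. -/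
noncomputable def triangle (n : ℕ) (j : Fin d → ℤ) : ℝ := ∏ i, max 0 (1 - |(j i : ℝ)| / n)

theorem triangle_nonneg (n : ℕ) (j : Fin d → ℤ) : 0 ≤ triangle n j :=
  Finset.prod_nonneg fun _ _ => le_max_left _ _

theorem triangle_le_one (n : ℕ) (j : Fin d → ℤ) : triangle n j ≤ 1 :=
  Finset.prod_le_one (fun _ _ => le_max_left _ _) fun _ _ =>
    max_le zero_le_one (sub_le_self _ (by positivity))

theorem triangle_neg (n : ℕ) (j : Fin d → ℤ) : triangle n (-j) = triangle n j := by
  simp [triangle]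

theorem tendsto_triangle (j : Fin d → ℤ) :
    Tendsto (fun n : ℕ => triangle n j) atTop (𝓝 1) := by
  have h : ∀ i, Tendsto (fun n : ℕ => max 0 (1 - |(j i : ℝ)| / n)) atTop (𝓝 1) := by
    intro i
    have h1 : Tendsto (fun n : ℕ => |(j i : ℝ)| / n) atTop (𝓝 0) :=
      tendsto_const_div_atTop_nhds_zero_nat _
    have := (tendsto_const_nhds (x := (0 : ℝ))).max (h1.const_sub 1)
    simpa using this
  have := tendsto_finsetProd (Finset.univ : Finset (Fin d)) fun i _ => h i
  simpa [triangle] using! this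

theorem toNat_sub_abs_eq {n : ℕ} (hn : 1 ≤ n) (m : ℤ) :
    (((n : ℤ) - |m|).toNat : ℝ) = n * max 0 (1 - |(m : ℝ)| / n) := by
  have hn' : (0 : ℝ) < n := by exact_mod_cast hn
  have e : (((n : ℤ) - |m|).toNat : ℝ) = ((((n : ℤ) - |m|).toNat : ℤ) : ℝ) := by norm_cast
  rw [e, Int.toNat_eq_max, mul_max_of_nonneg _ _ hn'.le, mul_sub, mul_div_cancel₀ _ hn'.ne',
    max_comm]
  push_cast
  simp

theorem prod_toNat_sub_abs {n : ℕ} (hn : 1 ≤ n) (j : Fin d → ℤ) :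
    ((∏ i, ((n : ℤ) - |j i|).toNat : ℕ) : ℝ) = (n : ℝ) ^ d * triangle n j := by
  rw [Nat.cast_prod, Finset.prod_congr rfl fun i _ => toNat_sub_abs_eq hn (j i),
    Finset.prod_mul_distrib, Finset.prod_const, Finset.card_univ, Fintype.card_fin, triangle]

theorem card_filter_add_mem_cube {n : ℕ} (hn : 1 ≤ n) (j : Fin d → ℤ) :
    (((cube d n).filter fun k => k + j ∈ cube d n).card : ℝ) = (n : ℝ) ^ d * triangle n j := by
  rw [← prod_toNat_sub_abs hn]
  have e : (cube d n).filter (fun k => k + j ∈ cube d n) =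
      Finset.Icc (fun i => max 1 (1 - j i)) (fun i => min (n : ℤ) (n - j i)) := by
    ext k
    simp only [Finset.mem_filter, mem_cube, Finset.mem_Icc, Pi.le_def, Pi.add_apply,
      ← forall_and]
    refine forall_congr' fun i => ?_
    omega
  rw [e, Pi.card_Icc]
  congr 1
  refine Finset.prod_congr rfl fun i _ => ?_
  rw [Int.card_Icc]
  congr 1
  rcases le_total 0 (j i) with h | h
  · rw [abs_of_nonneg h]; omega
  · rw [abs_of_nonpos h]; omega

end Triangle

section PositiveDefinite

variable {d : ℕ}

/-- The point `exp (2πi s)` of the unit circle. -/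
noncomputable def circlePoint (s : I) : ℂ := Complex.exp (2 * Real.pi * Complex.I * (s : ℝ))

/-- The character `t ↦ exp (2πi ⟨n, t⟩)` of the torus, as a function on the unit cube. -/
noncomputable def torusChar (n : Fin d → ℤ) (t : Fin d → I) : ℂ := ∏ i, circlePoint (t i) ^ n i

theorem norm_circlePoint (s : I) : ‖circlePoint s‖ = 1 := by
  rw [circlePoint, mul_right_comm, mul_comm]
  have := Complex.norm_exp_ofReal_mul_I (2 * Real.pi * s)
  rw [← this]
  congr 2
  push_cast
  ring

theorem circlePoint_ne_zero (s : I) : circlePoint s ≠ 0 := Complex.exp_ne_zero _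

theorem circlePoint_ne_one {s : I} (hs : (s : ℝ) ∉ ({0, 1} : Set ℝ)) : circlePoint s ≠ 1 := by
  intro h
  obtain ⟨n, hn⟩ := Complex.exp_eq_one_iff.1 h
  have h2 : (2 * Real.pi * Complex.I : ℂ) ≠ 0 := Complex.two_pi_I_ne_zero
  have h3 : ((s : ℝ) : ℂ) = (n : ℂ) := mul_left_cancel₀ h2 (hn.trans (mul_comm _ _))
  have h4 : (s : ℝ) = n := by exact_mod_cast h3
  have h0 := s.2.1
  have h1 := s.2.2
  rw [h4] at h0 h1
  have h5 : 0 ≤ n := by exact_mod_cast h0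
  have h6 : n ≤ 1 := by exact_mod_cast h1
  refine hs ?_
  rw [h4]
  obtain rfl | rfl : n = 0 ∨ n = 1 := by omega
  · simp
  · simp

theorem continuous_circlePoint : Continuous circlePoint := by
  unfold circlePoint
  fun_prop

theorem continuous_torusChar (n : Fin d → ℤ) : Continuous (torusChar n) := by
  refine continuous_finsetProd _ fun i _ => ?_
  exact (continuous_circlePoint.comp (continuous_apply i)).zpow₀ _ fun t =>
    Or.inl (circlePoint_ne_zero _)

theorem torusChar_add (m n : Fin d → ℤ) (t : Fin d → I) :
    torusChar (m + n) t = torusChar m t * torusChar n t := by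
  simp only [torusChar, ← Finset.prod_mul_distrib]
  exact Finset.prod_congr rfl fun i _ => zpow_add₀ (circlePoint_ne_zero _) _ _

theorem torusChar_neg (n : Fin d → ℤ) (t : Fin d → I) :
    torusChar (-n) t = (starRingEnd ℂ) (torusChar n t) := by
  simp only [torusChar, map_prod, Pi.neg_apply]
  refine Finset.prod_congr rfl fun i _ => ?_
  rw [map_zpow₀, zpow_neg, ← inv_zpow]
  congr 1
  exact Complex.inv_eq_conj (norm_circlePoint _)

theorem integral_circlePoint_zpow (n : ℤ) :
    ∫ s : I, circlePoint s ^ n = if n = 0 then 1 else 0 := by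
  split_ifs with hn
  · simp [hn]
  · have h1 : ∫ s : I, circlePoint s ^ n =
        ∫ x in (0 : ℝ)..1, Complex.exp ((n * (2 * Real.pi * Complex.I)) * x) := by
      have h2 := unitInterval.measurePreserving_coe.integral_comp
        (MeasurableEmbedding.subtype_coe measurableSet_Icc)
        (fun x : ℝ => Complex.exp ((n * (2 * Real.pi * Complex.I)) * x))
      rw [intervalIntegral.integral_of_le zero_le_one, ← integral_Icc_eq_integral_Ioc, ← h2]
      refine integral_congr_ae (ae_of_all _ fun s => ?_)
      simp only [circlePoint]
      rw [← Complex.exp_int_mul]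
      congr 1
      ring
    have hne : ((n : ℂ) * (2 * Real.pi * Complex.I)) ≠ 0 :=
      mul_ne_zero (by exact_mod_cast hn) Complex.two_pi_I_ne_zero
    rw [h1, integral_exp_mul_complex hne]
    simp [Complex.exp_int_mul_two_pi_mul_I]

theorem integral_torusChar (n : Fin d → ℤ) :
    ∫ t : Fin d → I, torusChar n t = if n = 0 then 1 else 0 := by
  simp only [torusChar]
  rw [integral_fintype_prod_volume_eq_prod (fun i (s : I) => circlePoint s ^ n i)]
  simp only [integral_circlePoint_zpow]
  split_ifs with h
  · simp [h]
  · obtain ⟨i, hi⟩ := Function.ne_iff.1 h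
    exact Finset.prod_eq_zero (Finset.mem_univ i) (if_neg hi)

theorem integral_trigPoly_mul {α β : Type*} (S : Finset α) (S' : Finset β)
    (f : α → Fin d → ℤ) (g : β → Fin d → ℤ) (v : β → ℂ) :
    ∫ t : Fin d → I, (∑ x ∈ S, torusChar (f x) t) * ∑ y ∈ S', v y * torusChar (g y) t =
      ∑ x ∈ S, ∑ y ∈ S', v y * if f x + g y = 0 then 1 else 0 := by
  have hint : ∀ m : Fin d → ℤ, Integrable (torusChar m) := fun m =>
    (continuous_torusChar m).integrable_of_hasCompactSupport (HasCompactSupport.of_compactSpace _)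
  have e : ∀ t : Fin d → I,
      (∑ x ∈ S, torusChar (f x) t) * ∑ y ∈ S', v y * torusChar (g y) t =
        ∑ x ∈ S, ∑ y ∈ S', v y * torusChar (f x + g y) t := by
    intro t
    rw [Finset.sum_mul_sum]
    refine Finset.sum_congr rfl fun x _ => Finset.sum_congr rfl fun y _ => ?_
    rw [torusChar_add]
    ring
  simp only [e]
  rw [integral_finsetSum _ fun x _ => integrable_finsetSum _ fun y _ => (hint _).const_mul _]
  refine Finset.sum_congr rfl fun x _ => ?_
  rw [integral_finsetSum _ fun y _ => (hint _).const_mul _]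
  refine Finset.sum_congr rfl fun y _ => ?_
  rw [integral_const_mul, integral_torusChar]

theorem sum_sum_torusChar (B : Finset (Fin d → ℤ)) (t : Fin d → I) :
    ((‖∑ k ∈ B, torusChar k t‖ ^ 2 : ℝ) : ℂ) =
      ∑ p ∈ B ×ˢ B, torusChar (p.1 - p.2) t := by
  rw [← Complex.normSq_eq_norm_sq, ← Complex.mul_conj, map_sum, Finset.sum_mul_sum,
    Finset.sum_product]
  refine Finset.sum_congr rfl fun k _ => Finset.sum_congr rfl fun l _ => ?_
  rw [sub_eq_add_neg, torusChar_add, torusChar_neg]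

/-- An even positive-definite function `r` on `ℤ^d` has nonnegative Fejér sums. Integrating these
against a nonnegative combination of squared moduli of exponential sums gives the corresponding
inequality between the quadratic expressions in `r`. -/
theorem sum_nonneg_of_trigPoly_nonneg {r : (Fin d → ℤ) → ℝ} (heven : ∀ j, r (-j) = r j)
    (hpd : ∀ (s : Finset (Fin d → ℤ)) (c : (Fin d → ℤ) → ℝ),
      0 ≤ ∑ k ∈ s, ∑ l ∈ s, c k * c l * r (k - l))
    {α : Type*} (A : Finset α) (b : α → ℝ) (B : α → Finset (Fin d → ℤ))
    (h : ∀ᵐ t : Fin d → I, 0 ≤ ∑ a ∈ A, b a * ‖∑ k ∈ B a, torusChar k t‖ ^ 2) :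
    0 ≤ ∑ a ∈ A, b a * ∑ k ∈ B a, ∑ l ∈ B a, r (k - l) := by
  have hfin : ∀ N : ℕ, 1 ≤ N →
      0 ≤ ∑ a ∈ A, b a * ∑ k ∈ B a, ∑ l ∈ B a, r (k - l) * triangle N (k - l) := by
    intro N hN
    have hN' : (0 : ℝ) < (N : ℝ) ^ d := pow_pos (by exact_mod_cast hN) d
    set S := cube d N with hS
    set φ : (Fin d → I) → ℝ := fun t => ∑ k ∈ S, ∑ l ∈ S,
      r (k - l) * ((torusChar k t).re * (torusChar l t).re +
        (torusChar k t).im * (torusChar l t).im) with hφ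
    have hφ0 : ∀ t, 0 ≤ φ t := by
      intro t
      have h1 := hpd S fun k => (torusChar k t).re
      have h2 := hpd S fun k => (torusChar k t).im
      have h3 := add_nonneg h1 h2
      simp only [← Finset.sum_add_distrib] at h3
      refine h3.trans_eq (Finset.sum_congr rfl fun k _ => Finset.sum_congr rfl fun l _ => ?_)
      ring
    have hφc : ∀ t, (φ t : ℂ) = ∑ p ∈ S ×ˢ S, (r (p.1 - p.2) : ℂ) * torusChar (p.1 - p.2) t := by
      intro t
      have hre : ∀ k l : Fin d → ℤ, (r (k - l) : ℂ) * torusChar (k - l) t =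
          ((r (k - l) * ((torusChar k t).re * (torusChar l t).re +
            (torusChar k t).im * (torusChar l t).im) : ℝ) : ℂ) +
          ((r (k - l) * ((torusChar k t).im * (torusChar l t).re -
            (torusChar k t).re * (torusChar l t).im) : ℝ) : ℂ) * Complex.I := by
        intro k l
        rw [sub_eq_add_neg k l, torusChar_add, torusChar_neg]
        apply Complex.ext
        · simp [-mul_eq_mul_left_iff]
        · simp [-mul_eq_mul_left_iff]; ring
      have him : ∑ k ∈ S, ∑ l ∈ S, (r (k - l) * ((torusChar k t).im * (torusChar l t).re -
            (torusChar k t).re * (torusChar l t).im)) = 0 := by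
        have hswap := Finset.sum_comm (s := S) (t := S) (f := fun k l =>
          (r (k - l) * ((torusChar k t).im * (torusChar l t).re -
            (torusChar k t).re * (torusChar l t).im)))
        have hneg : ∑ l ∈ S, ∑ k ∈ S, (r (k - l) * ((torusChar k t).im * (torusChar l t).re -
            (torusChar k t).re * (torusChar l t).im)) =
            -∑ k ∈ S, ∑ l ∈ S, (r (k - l) * ((torusChar k t).im * (torusChar l t).re -
            (torusChar k t).re * (torusChar l t).im)) := by
          simp only [← Finset.sum_neg_distrib]
          refine Finset.sum_congr rfl fun k _ => Finset.sum_congr rfl fun l _ => ?_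
          rw [← heven (l - k), neg_sub]
          ring
        linarith
      rw [Finset.sum_product]
      simp only [hre, Finset.sum_add_distrib, ← Finset.sum_mul, ← Complex.ofReal_sum, him]
      simp [hφ]
    have hcount : ∀ k l : Fin d → ℤ, ∑ p ∈ S ×ˢ S, (r (p.1 - p.2) : ℂ) *
        (if (k - l) + (p.1 - p.2) = 0 then 1 else 0) =
          (((N : ℝ) ^ d * (r (k - l) * triangle N (k - l)) : ℝ) : ℂ) := by
      intro k l
      have e1 : ∀ p ∈ S ×ˢ S, (r (p.1 - p.2) : ℂ) *
          (if (k - l) + (p.1 - p.2) = 0 then 1 else 0) =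
          (r (k - l) : ℂ) * (if p.2 = p.1 + (k - l) then 1 else 0) := by
        intro p _
        by_cases hp : p.2 = p.1 + (k - l)
        · have h0 : (k - l) + (p.1 - p.2) = 0 := by rw [hp]; abel
          have h1 : p.1 - p.2 = -(k - l) := by rw [hp]; abel
          rw [if_pos hp, if_pos h0, h1, heven]
        · have h0 : ¬ (k - l) + (p.1 - p.2) = 0 := fun h0 => hp (by
            rw [← sub_eq_zero, ← neg_eq_zero, ← h0]; abel)
          rw [if_neg hp, if_neg h0, mul_zero, mul_zero]
      rw [Finset.sum_congr rfl e1, ← Finset.mul_sum, Finset.sum_product]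
      have e2 : ∀ x ∈ S, ∑ y ∈ S, (if y = x + (k - l) then (1 : ℂ) else 0) =
          if x + (k - l) ∈ S then 1 else 0 := fun x _ => Finset.sum_ite_eq' S _ _
      rw [Finset.sum_congr rfl e2, Finset.sum_boole]
      have := card_filter_add_mem_cube hN (k - l)
      rw [← hS] at this
      have h2 : (((S.filter fun x => x + (k - l) ∈ S).card : ℕ) : ℂ) =
          (((N : ℝ) ^ d * triangle N (k - l) : ℝ) : ℂ) := by
        rw [← this]; norm_cast
      rw [h2]
      push_cast
      ring
    have hI : (∫ t : Fin d → I, (∑ a ∈ A, b a * ‖∑ k ∈ B a, torusChar k t‖ ^ 2) * φ t) =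
        (N : ℝ) ^ d *
          ∑ a ∈ A, b a * ∑ k ∈ B a, ∑ l ∈ B a, r (k - l) * triangle N (k - l) := by
      apply Complex.ofReal_injective
      rw [← integral_complex_ofReal]
      have e1 : ∀ t : Fin d → I,
          (((∑ a ∈ A, b a * ‖∑ k ∈ B a, torusChar k t‖ ^ 2) * φ t : ℝ) : ℂ) =
            ∑ a ∈ A, (b a : ℂ) * ((∑ p ∈ B a ×ˢ B a, torusChar (p.1 - p.2) t) *
              ∑ p ∈ S ×ˢ S, (r (p.1 - p.2) : ℂ) * torusChar (p.1 - p.2) t) := by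
        intro t
        rw [Complex.ofReal_mul, hφc, Complex.ofReal_sum, Finset.sum_mul]
        refine Finset.sum_congr rfl fun a _ => ?_
        rw [Complex.ofReal_mul, sum_sum_torusChar, mul_assoc]
      simp only [e1]
      rw [integral_finsetSum]
      · simp only [integral_const_mul, integral_trigPoly_mul, hcount]
        push_cast
        rw [Finset.mul_sum]
        refine Finset.sum_congr rfl fun a _ => ?_
        rw [Finset.sum_product]
        simp only [← Finset.mul_sum]
        ring
      · intro a _
        refine Continuous.integrable_of_hasCompactSupport ?_
          (HasCompactSupport.of_compactSpace _)
        have := fun m => continuous_torusChar (d := d) m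
        fun_prop
    have h0 : 0 ≤ ∫ t : Fin d → I, (∑ a ∈ A, b a * ‖∑ k ∈ B a, torusChar k t‖ ^ 2) * φ t :=
      integral_nonneg_of_ae (h.mono fun t ht => mul_nonneg ht (hφ0 t))
    rw [hI] at h0
    exact nonneg_of_mul_nonneg_right h0 hN'
  have hlim : Tendsto (fun N : ℕ => ∑ a ∈ A, b a * ∑ k ∈ B a, ∑ l ∈ B a,
      r (k - l) * triangle N (k - l)) atTop
      (𝓝 (∑ a ∈ A, b a * ∑ k ∈ B a, ∑ l ∈ B a, r (k - l) * 1)) :=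
    tendsto_finsetSum _ fun a _ => (tendsto_finsetSum _ fun k _ => tendsto_finsetSum _ fun l _ =>
      (tendsto_triangle (k - l)).const_mul _).const_mul _
  have := ge_of_tendsto hlim (eventually_atTop.2 ⟨1, hfin⟩)
  simpa using this

/-- For an even positive-definite function `r` on `ℤ^d`, the quadratic expressions of boxes with
sides at most `Q` are controlled by the averages of those of cubes. -/
theorem exists_sum_box_le_sum_cube (d : ℕ) : ∃ (C : ℝ) (K : ℕ), 0 < C ∧ 1 ≤ K ∧
    ∀ r : (Fin d → ℤ) → ℝ, (∀ j, r (-j) = r j) →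
    (∀ (s : Finset (Fin d → ℤ)) (c : (Fin d → ℤ) → ℝ),
      0 ≤ ∑ k ∈ s, ∑ l ∈ s, c k * c l * r (k - l)) →
    ∀ (Q : ℕ) (l : Fin d → ℕ), 1 ≤ Q → (∀ i, l i ≤ Q) →
      ∑ k ∈ box (fun i => (l i : ℤ)), ∑ k' ∈ box (fun i => (l i : ℤ)), r (k - k') ≤
        C / Q * ∑ n ∈ Finset.Icc 1 (K * Q), ∑ k ∈ cube d n, ∑ k' ∈ cube d n, r (k - k') := by
  classical
  obtain ⟨C, K, hC, hK, H⟩ := exists_prod_sq_norm_one_sub_pow_le d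
  refine ⟨C, K, hC, hK, ?_⟩
  intro r heven hpd Q l hQ hl
  have hbox : ∀ (m : Fin d → ℕ) (t : Fin d → I), (∀ i, circlePoint (t i) ≠ 1) →
      ‖∑ k ∈ box (fun i => (m i : ℤ)), torusChar k t‖ ^ 2 * ∏ i, ‖1 - circlePoint (t i)‖ ^ 2 =
        ∏ i, ‖1 - circlePoint (t i) ^ m i‖ ^ 2 := by
    intro m t ht
    have e1 : ∑ k ∈ box (fun i => (m i : ℤ)), torusChar k t =
        ∏ i, ∑ k ∈ Finset.Icc (1 : ℤ) (m i), circlePoint (t i) ^ k := by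
      rw [Finset.prod_univ_sum]
      rfl
    have e2 : ∀ i, ‖∑ k ∈ Finset.Icc (1 : ℤ) (m i), circlePoint (t i) ^ k‖ *
        ‖1 - circlePoint (t i)‖ = ‖1 - circlePoint (t i) ^ m i‖ := by
      intro i
      have e3 : ∑ k ∈ Finset.Icc (1 : ℤ) (m i), circlePoint (t i) ^ k =
          circlePoint (t i) * ∑ k ∈ Finset.range (m i), circlePoint (t i) ^ k := by
        rw [Finset.mul_sum]
        symm
        refine Finset.sum_bij (fun k _ => (k : ℤ) + 1) ?_ ?_ ?_ ?_
        · intro k hk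
          rw [Finset.mem_range] at hk
          rw [Finset.mem_Icc]
          omega
        · intro k _ k' _ hkk
          omega
        · intro k hk
          rw [Finset.mem_Icc] at hk
          exact ⟨(k - 1).toNat, Finset.mem_range.2 (by omega), by omega⟩
        · intro k _
          rw [zpow_add_one₀ (circlePoint_ne_zero _), zpow_natCast, mul_comm]
      rw [e3, norm_mul, norm_circlePoint, one_mul, mul_comm, ← norm_mul, mul_neg_geom_sum]
    rw [e1, norm_prod, ← Finset.prod_pow, ← Finset.prod_mul_distrib]
    refine Finset.prod_congr rfl fun i _ => ?_
    rw [← mul_pow, e2]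
  have hsplit : ∀ G : Finset (Fin d → ℤ) → ℝ, ∑ a ∈ insert 0 (Finset.Icc 1 (K * Q)),
      (if a = 0 then -1 else C / Q) *
        G (if a = 0 then box (fun i => (l i : ℤ)) else cube d a) =
      -G (box fun i => (l i : ℤ)) + C / Q * ∑ n ∈ Finset.Icc 1 (K * Q), G (cube d n) := by
    intro G
    rw [Finset.sum_insert (by simp), if_pos rfl, if_pos rfl, Finset.mul_sum, neg_one_mul]
    congr 1
    refine Finset.sum_congr rfl fun n hn => ?_
    have : n ≠ 0 := by rw [Finset.mem_Icc] at hn; omega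
    rw [if_neg this, if_neg this]
  have hae : ∀ᵐ t : Fin d → I, 0 ≤ ∑ a ∈ insert 0 (Finset.Icc 1 (K * Q)),
      (if a = 0 then -1 else C / Q) *
        ‖∑ k ∈ (if a = 0 then box (fun i => (l i : ℤ)) else cube d a), torusChar k t‖ ^ 2 := by
    filter_upwards [ae_coord_notMem (Set.toFinite ({0, 1} : Set ℝ)).countable] with t ht
    have hz : ∀ i, circlePoint (t i) ≠ 1 := fun i => circlePoint_ne_one (ht i)
    have hpos : 0 < ∏ i, ‖1 - circlePoint (t i)‖ ^ 2 :=
      Finset.prod_pos fun i _ => pow_pos (norm_pos_iff.2 (sub_ne_zero.2 (hz i).symm)) 2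
    have h1 := H (fun i => circlePoint (t i)) Q l (fun i => norm_circlePoint _) hQ hl
    rw [← hbox l t hz] at h1
    have h2 : ∀ n ∈ Finset.Icc 1 (K * Q), ∏ i, ‖1 - circlePoint (t i) ^ n‖ ^ 2 =
        ‖∑ k ∈ cube d n, torusChar k t‖ ^ 2 * ∏ i, ‖1 - circlePoint (t i)‖ ^ 2 :=
      fun n _ => (hbox (fun _ => n) t hz).symm
    rw [Finset.sum_congr rfl h2, ← Finset.sum_mul, ← mul_assoc] at h1
    have h3 := le_of_mul_le_mul_right h1 hpos
    rw [hsplit fun B => ‖∑ k ∈ B, torusChar k t‖ ^ 2]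
    linarith
  have := sum_nonneg_of_trigPoly_nonneg heven hpd _ _ _ hae
  rw [hsplit fun B => ∑ k ∈ B, ∑ k' ∈ B, r (k - k')] at this
  linarith

end PositiveDefinite

/-! ### Slowly varying functions -/

section SlowlyVarying

/-- The uniform convergence theorem for slowly varying functions, in additive form: pointwise
convergence of the increments of a measurable function is uniform over increments in `[0, 1]`.
If it failed along `u k` with increments `v k`, then the increments `s` that are harmless from
`u k` on and those that are harmless from `u k + v k` on would fill most of `[0, 2]`; the former
set and the translate by `v k` of the latter lie in `[0, 3]`, so they meet. -/
theorem exists_abs_sub_le_of_tendsto {h : ℝ → ℝ} (hm : Measurable h)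
    (hlim : ∀ s, Tendsto (fun u => h (u + s) - h u) atTop (𝓝 0)) {ε : ℝ} (hε : 0 < ε) :
    ∃ u₀ : ℝ, ∀ u ≥ u₀, ∀ v ∈ Set.Icc (0 : ℝ) 1, |h (u + v) - h u| ≤ ε := by
  by_contra hcon
  push Not at hcon
  choose u hu v hv huv using fun n : ℕ => hcon n
  have hutop : Tendsto u atTop atTop :=
    tendsto_atTop_mono hu tendsto_natCast_atTop_atTop
  -- the set of increments that are harmless from the base points `w k`, `k ≥ n`, on
  have main : ∀ w : ℕ → ℝ, Tendsto w atTop atTop → ∃ n₀, ∀ n ≥ n₀, ∃ A ⊆ Set.Icc (0 : ℝ) 2,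
      MeasurableSet A ∧ ENNReal.ofReal (3 / 2) < volume A ∧
        ∀ s ∈ A, |h (w n + s) - h (w n)| < ε / 2 := by
    intro w hw
    set A : ℕ → Set ℝ := fun n =>
      Set.Icc (0 : ℝ) 2 ∩ ⋂ k, ⋂ (_ : n ≤ k), {s | |h (w k + s) - h (w k)| < ε / 2} with hA
    have hAm : ∀ n, MeasurableSet (A n) := fun n =>
      measurableSet_Icc.inter <| MeasurableSet.iInter fun k => MeasurableSet.iInter fun _ =>
        measurableSet_lt (by fun_prop) measurable_const
    have hmono : Monotone A := by
      intro n m hnm s hs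
      refine ⟨hs.1, Set.mem_iInter₂.2 fun k hk => ?_⟩
      exact Set.mem_iInter₂.1 hs.2 k (hnm.trans hk)
    have hunion : ⋃ n, A n = Set.Icc (0 : ℝ) 2 := by
      refine Set.Subset.antisymm (Set.iUnion_subset fun n => Set.inter_subset_left) ?_
      intro s hs
      have h1 := (hlim s).comp hw
      obtain ⟨n, hn⟩ := eventually_atTop.1 ((Metric.tendsto_nhds.1 h1) (ε / 2) (half_pos hε))
      refine Set.mem_iUnion.2 ⟨n, hs, Set.mem_iInter₂.2 fun k hk => ?_⟩
      have := hn k hk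
      rw [Real.dist_eq, sub_zero] at this
      exact this
    have hlimA := tendsto_measure_iUnion_atTop (μ := (volume : Measure ℝ)) hmono
    rw [hunion, Real.volume_Icc] at hlimA
    obtain ⟨n₀, hn₀⟩ := eventually_atTop.1 (hlimA.eventually_const_lt
      (show ENNReal.ofReal (3 / 2) < ENNReal.ofReal (2 - 0) from
        (ENNReal.ofReal_lt_ofReal_iff (by norm_num)).2 (by norm_num)))
    exact ⟨n₀, fun n hn => ⟨A n, Set.inter_subset_left, hAm n, hn₀ n hn, fun s hs =>
      Set.mem_iInter₂.1 hs.2 n le_rfl⟩⟩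
  obtain ⟨n₁, h₁⟩ := main u hutop
  obtain ⟨n₂, h₂⟩ := main (fun n => u n + v n)
    (tendsto_atTop_mono (fun n => le_add_of_nonneg_right (hv n).1) hutop)
  set n := max n₁ n₂
  obtain ⟨A, hA, -, hAv, hAs⟩ := h₁ n (le_max_left _ _)
  obtain ⟨B, hB, hBm, hBv, hBs⟩ := h₂ n (le_max_right _ _)
  -- the translate of `B` by `v n`
  set B' : Set ℝ := (fun s => s - v n) ⁻¹' B with hB'
  have hB'm : MeasurableSet B' := (measurable_id.sub_const (v n)) hBm
  have hB'v : volume B' = volume B := by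
    simp only [hB', sub_eq_add_neg]
    exact measure_preimage_add_right volume (-v n) B
  have hdisj : ¬ Disjoint A B' := by
    intro hd
    have h3 : A ∪ B' ⊆ Set.Icc (0 : ℝ) 3 := by
      refine Set.union_subset (hA.trans (Set.Icc_subset_Icc_right (by norm_num))) fun s hs => ?_
      have h4 := hB hs
      simp only [Set.mem_Icc] at h4 ⊢
      have h5 := hv n
      simp only [Set.mem_Icc] at h5
      constructor <;> linarith
    have h4 := measure_mono (μ := (volume : Measure ℝ)) h3
    rw [measure_union hd hB'm, Real.volume_Icc, hB'v] at h4
    have h5 := ENNReal.add_lt_add hAv hBv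
    rw [← ENNReal.ofReal_add (by norm_num) (by norm_num)] at h5
    have h6 := h5.trans_le h4
    rw [ENNReal.ofReal_lt_ofReal_iff (by norm_num)] at h6
    norm_num at h6
  obtain ⟨s, hsA, hsB⟩ := Set.not_disjoint_iff.1 hdisj
  have h3 := hAs s hsA
  have h4 := hBs _ hsB
  have e : u n + v n + (s - v n) = u n + s := by ring
  rw [e] at h4
  have h5 : |h (u n + v n) - h (u n)| < ε := by
    rw [abs_lt] at h3 h4 ⊢
    constructor <;> linarith [h3.1, h3.2, h4.1, h4.2]
  exact absurd (huv n) (not_lt.2 h5.le)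

/-- Potter's bound. -/
theorem IsSlowlyVarying.exists_le_rpow_mul {L : ℝ → ℝ} (hL : IsSlowlyVarying L) {δ : ℝ}
    (hδ : 0 < δ) : ∃ x₀ > 0, (∀ x ≥ x₀, 0 < L x) ∧ ∀ y ≥ x₀, ∀ x ≥ y,
      L y ≤ Real.exp δ * (x / y) ^ δ * L x := by
  set h : ℝ → ℝ := fun u => Real.log (L (Real.exp u)) with hh
  have hm : Measurable h := Real.measurable_log.comp (hL.measurable.comp Real.measurable_exp)
  have hlim : ∀ s, Tendsto (fun u => h (u + s) - h u) atTop (𝓝 0) := by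
    intro s
    have h1 := (hL.tendsto (Real.exp s) (Real.exp_pos s)).comp Real.tendsto_exp_atTop
    have h2 := h1.log one_ne_zero
    rw [Real.log_one] at h2
    refine h2.congr' ?_
    have h3 : Tendsto (fun u => Real.exp (u + s)) atTop atTop :=
      Real.tendsto_exp_atTop.comp (tendsto_atTop_add_const_right _ s tendsto_id)
    filter_upwards [Real.tendsto_exp_atTop.eventually hL.eventually_pos,
      h3.eventually hL.eventually_pos] with u hu hus
    simp only [Function.comp, hh]
    rw [mul_comm, ← Real.exp_add, Real.log_div hus.ne' hu.ne']
  obtain ⟨u₀, hu₀⟩ := exists_abs_sub_le_of_tendsto hm hlim hδ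
  obtain ⟨x₁, hx₁⟩ := eventually_atTop.1 hL.eventually_pos
  have hiter : ∀ (n : ℕ) (w : ℝ), u₀ ≤ w → ∀ v ∈ Set.Icc (0 : ℝ) 1,
      |h (w + n + v) - h w| ≤ (n + 1) * δ := by
    intro n
    induction n with
    | zero =>
      intro w hw v hv
      simpa using hu₀ w hw v hv
    | succ n ih =>
      intro w hw v hv
      have h1 := ih (w + 1) (by linarith) v hv
      have h2 := hu₀ w hw 1 ⟨zero_le_one, le_rfl⟩
      have e : w + ((n + 1 : ℕ) : ℝ) + v = w + 1 + n + v := by push_cast; ring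
      rw [e]
      refine (abs_sub_le _ (h (w + 1)) _).trans ((add_le_add h1 h2).trans_eq ?_)
      push_cast
      ring
  have hx₀ : 0 < max x₁ (Real.exp u₀) := lt_max_of_lt_right (Real.exp_pos _)
  have hpos : ∀ x ≥ max x₁ (Real.exp u₀), 0 < L x := fun x hx =>
    hx₁ x ((le_max_left _ _).trans hx)
  refine ⟨max x₁ (Real.exp u₀), hx₀, hpos, fun y hy x hx => ?_⟩
  have hy0 : 0 < y := hx₀.trans_le hy
  have hx0 : 0 < x := hy0.trans_le hx
  have hw : u₀ ≤ Real.log y :=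
    (Real.le_log_iff_exp_le hy0).2 ((le_max_right _ _).trans hy)
  have hD : 0 ≤ Real.log x - Real.log y := sub_nonneg.2 (Real.log_le_log hy0 hx)
  have h1 := hiter ⌊Real.log x - Real.log y⌋₊ (Real.log y) hw
    (Real.log x - Real.log y - ⌊Real.log x - Real.log y⌋₊)
    ⟨sub_nonneg.2 (Nat.floor_le hD), by
      have := Nat.lt_floor_add_one (Real.log x - Real.log y); linarith⟩
  have e : Real.log y + ⌊Real.log x - Real.log y⌋₊ +
      (Real.log x - Real.log y - ⌊Real.log x - Real.log y⌋₊) = Real.log x := by ring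
  rw [e] at h1
  simp only [hh, Real.exp_log hy0, Real.exp_log hx0] at h1
  have h2 : (⌊Real.log x - Real.log y⌋₊ + 1 : ℝ) * δ ≤ (Real.log x - Real.log y + 1) * δ :=
    mul_le_mul_of_nonneg_right (by linarith [Nat.floor_le hD]) hδ.le
  have h3 : Real.log (L y) ≤ δ + Real.log (x / y) * δ + Real.log (L x) := by
    rw [Real.log_div hx0.ne' hy0.ne']
    have := (abs_le.1 (h1.trans h2)).1
    linarith
  have h4 := Real.exp_le_exp.2 h3
  rw [Real.exp_log (hpos y hy), Real.exp_add, Real.exp_add,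
    Real.exp_log (hpos x (hy.trans hx)), ← Real.rpow_def_of_pos (div_pos hx0 hy0)] at h4
  exact h4

end SlowlyVarying

/-! ### The variance estimator as a sum of squares of window sums -/

section QuadForm

variable {d : ℕ}

/-- The quadratic form `n^{-d} ∑_{k, l ∈ A_n} ∏ max 0 (1 - |k_i - l_i| / q) x_k x_l`, which is the
variance estimator without its centering. -/
noncomputable def quadForm (n q : ℕ) (x : (Fin d → ℤ) → ℝ) : ℝ :=
  ((n : ℝ) ^ d)⁻¹ * ∑ k ∈ cube d n, ∑ l ∈ cube d n, triangle q (k - l) * (x k * x l)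

/-- The part in `A_n` of the window of side `q` with lowest corner `m`. -/
noncomputable def window (n q : ℕ) (m : Fin d → ℤ) : Finset (Fin d → ℤ) :=
  (cube d n).filter fun k => k ∈ Finset.Icc m (m + fun _ => (q : ℤ) - 1)

theorem mem_window {n q : ℕ} {m k : Fin d → ℤ} :
    k ∈ window n q m ↔ k ∈ cube d n ∧ m ≤ k ∧ k ≤ m + fun _ => (q : ℤ) - 1 := by
  rw [window, Finset.mem_filter, Finset.mem_Icc]

/-- The lowest corners of the windows of side `q` that meet `A_n`. -/
noncomputable def windowCorners (d n q : ℕ) : Finset (Fin d → ℤ) :=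
  Finset.Icc (fun _ => 2 - (q : ℤ)) fun _ => (n : ℤ)

theorem sHatSq_eq_quadForm {Ω : Type*} (X : (Fin d → ℤ) → Ω → ℝ) (n : ℕ) {q : ℕ} (hq : 1 ≤ q)
    (ω : Ω) : sHatSq X n q ω = quadForm n q fun k => X k ω - sampleMean X n ω := by
  classical
  have hq' : (0 : ℝ) < q := by exact_mod_cast hq
  set x : (Fin d → ℤ) → ℝ := fun k => X k ω - sampleMean X n ω with hx
  set J := Finset.Icc (fun _ : Fin d => -((q : ℤ) - 1)) (fun _ => (q : ℤ) - 1) with hJ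
  have hbart : ∀ j ∈ J, bartlett q j = triangle q j := by
    intro j hj
    rw [hJ, Finset.mem_Icc] at hj
    refine Finset.prod_congr rfl fun i _ => (max_eq_right ?_).symm
    have h1 : -((q : ℤ) - 1) ≤ j i := hj.1 i
    have h2 : j i ≤ (q : ℤ) - 1 := hj.2 i
    have h3 : |j i| ≤ q := abs_le.2 ⟨by omega, by omega⟩
    have h4 : |(j i : ℝ)| ≤ q := by exact_mod_cast h3
    exact sub_nonneg.2 ((div_le_one hq').2 h4)
  have hzero : ∀ j ∉ J, triangle q j = 0 := by
    intro j hj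
    rw [hJ, Finset.mem_Icc, Pi.le_def, Pi.le_def, ← forall_and, not_forall] at hj
    obtain ⟨i, hi⟩ := hj
    refine Finset.prod_eq_zero (Finset.mem_univ i) (max_eq_left ?_)
    have h3 : (q : ℤ) ≤ |j i| := by
      rcases le_total 0 (j i) with h | h
      · rw [abs_of_nonneg h]; omega
      · rw [abs_of_nonpos h]; omega
    have h4 : (q : ℝ) ≤ |(j i : ℝ)| := by exact_mod_cast h3
    exact sub_nonpos.2 ((one_le_div hq').2 h4)
  have e1 : sHatSq X n q ω = ((n : ℝ) ^ d)⁻¹ * ∑ k ∈ cube d n, ∑ j ∈ J,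
      if k + j ∈ cube d n then triangle q j * (x k * x (k + j)) else 0 := by
    rw [Finset.sum_comm, Finset.mul_sum]
    refine Finset.sum_congr rfl fun j hj => ?_
    rw [hbart j hj, empCov, Finset.sum_filter, mul_left_comm, Finset.mul_sum]
    congr 1
    refine Finset.sum_congr rfl fun k _ => ?_
    rw [mul_ite, mul_zero]
  rw [e1, quadForm]
  congr 1
  refine Finset.sum_congr rfl fun k _ => ?_
  rw [← Finset.sum_filter]
  have e2 : ∀ l ∈ cube d n, l - k ∉ J → triangle q (k - l) * (x k * x l) = 0 := by
    intro l _ hl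
    rw [← triangle_neg, neg_sub, hzero _ hl, zero_mul]
  have e3 : ∑ l ∈ cube d n, triangle q (k - l) * (x k * x l) =
      ∑ l ∈ (cube d n).filter (fun l => l - k ∈ J), triangle q (k - l) * (x k * x l) :=
    (Finset.sum_filter_of_ne fun l hl hne => by by_contra h; exact hne (e2 l hl h)).symm
  rw [e3]
  refine Finset.sum_bij (fun j _ => k + j) ?_ ?_ ?_ ?_
  · intro j hj
    rw [Finset.mem_filter] at hj ⊢
    exact ⟨hj.2, by rw [add_sub_cancel_left]; exact hj.1⟩
  · intro j _ j' _ h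
    exact add_left_cancel h
  · intro l hl
    rw [Finset.mem_filter] at hl
    exact ⟨l - k, Finset.mem_filter.2 ⟨hl.2, by rw [add_sub_cancel]; exact hl.1⟩,
      add_sub_cancel _ _⟩
  · intro j _
    rw [← triangle_neg]
    congr 2
    abel

theorem quadForm_eq_sum_windows (n : ℕ) {q : ℕ} (hq : 1 ≤ q) (x : (Fin d → ℤ) → ℝ) :
    quadForm n q x = ((n : ℝ) ^ d)⁻¹ * ((q : ℝ) ^ d)⁻¹ *
      ∑ m ∈ windowCorners d n q, (∑ k ∈ window n q m, x k) ^ 2 := by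
  classical
  have hq' : (0 : ℝ) < (q : ℝ) ^ d := pow_pos (by exact_mod_cast hq) d
  have hcount : ∀ k ∈ cube d n, ∀ l ∈ cube d n,
      ((windowCorners d n q).filter fun m => (m ≤ k ∧ k ≤ m + fun _ => (q : ℤ) - 1) ∧
        (m ≤ l ∧ l ≤ m + fun _ => (q : ℤ) - 1)).card = (q : ℝ) ^ d * triangle q (k - l) := by
    intro k hk l hl
    rw [← prod_toNat_sub_abs hq]
    have e : ((windowCorners d n q).filter fun m => (m ≤ k ∧ k ≤ m + fun _ => (q : ℤ) - 1) ∧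
        (m ≤ l ∧ l ≤ m + fun _ => (q : ℤ) - 1)) =
        Finset.Icc (fun i => max (k i) (l i) - ((q : ℤ) - 1)) fun i => min (k i) (l i) := by
      ext m
      rw [mem_cube] at hk hl
      simp only [windowCorners, Finset.mem_filter, Finset.mem_Icc, Pi.le_def, Pi.add_apply]
      constructor
      · rintro ⟨-, ⟨h1, h2⟩, h3, h4⟩
        refine ⟨fun i => ?_, fun i => ?_⟩
        · have := h2 i; have := h4 i; omega
        · have := h1 i; have := h3 i; omega
      · rintro ⟨h1, h2⟩
        refine ⟨⟨fun i => ?_, fun i => ?_⟩, ⟨fun i => ?_, fun i => ?_⟩, fun i => ?_,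
          fun i => ?_⟩ <;>
        · have := h1 i; have := h2 i; have := hk i; have := hl i; omega
    rw [e, Pi.card_Icc]
    congr 1
    refine Finset.prod_congr rfl fun i _ => ?_
    rw [Int.card_Icc]
    congr 1
    rw [Pi.sub_apply]
    rcases le_total (k i) (l i) with h | h
    · rw [abs_of_nonpos (by omega)]; omega
    · rw [abs_of_nonneg (by omega)]; omega
  have e1 : ∑ m ∈ windowCorners d n q, (∑ k ∈ window n q m, x k) ^ 2 =
      ∑ k ∈ cube d n, ∑ l ∈ cube d n, (q : ℝ) ^ d * triangle q (k - l) * (x k * x l) := by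
    have e2 : ∀ m ∈ windowCorners d n q, (∑ k ∈ window n q m, x k) ^ 2 =
        ∑ k ∈ cube d n, ∑ l ∈ cube d n,
          if (m ≤ k ∧ k ≤ m + fun _ => (q : ℤ) - 1) ∧ (m ≤ l ∧ l ≤ m + fun _ => (q : ℤ) - 1)
          then x k * x l else 0 := by
      intro m _
      rw [sq, window, Finset.sum_filter, Finset.sum_mul_sum]
      simp only [Finset.mem_Icc]
      refine Finset.sum_congr rfl fun k _ => Finset.sum_congr rfl fun l _ => ?_
      by_cases h1 : m ≤ k ∧ k ≤ m + fun _ => (q : ℤ) - 1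
      · by_cases h2 : m ≤ l ∧ l ≤ m + fun _ => (q : ℤ) - 1
        · rw [if_pos h1, if_pos h2, if_pos ⟨h1, h2⟩]
        · rw [if_neg h2, mul_zero, if_neg fun h => h2 h.2]
      · rw [if_neg h1, zero_mul, if_neg fun h => h1 h.1]
    rw [Finset.sum_congr rfl e2, Finset.sum_comm]
    refine Finset.sum_congr rfl fun k hk => ?_
    rw [Finset.sum_comm]
    refine Finset.sum_congr rfl fun l hl => ?_
    rw [← Finset.sum_filter, Finset.sum_const, nsmul_eq_mul, hcount k hk l hl]
  rw [e1, quadForm, mul_assoc]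
  congr 1
  rw [Finset.mul_sum]
  refine Finset.sum_congr rfl fun k _ => ?_
  rw [Finset.mul_sum]
  refine Finset.sum_congr rfl fun l _ => ?_
  field_simp

theorem quadForm_nonneg (n : ℕ) {q : ℕ} (hq : 1 ≤ q) (x : (Fin d → ℤ) → ℝ) :
    0 ≤ quadForm n q x := by
  rw [quadForm_eq_sum_windows n hq]
  positivity

theorem quadForm_sub_le (n : ℕ) {q : ℕ} (hq : 1 ≤ q) (x y : (Fin d → ℤ) → ℝ) :
    quadForm n q (fun k => x k - y k) ≤ 2 * quadForm n q x + 2 * quadForm n q y := by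
  simp only [quadForm_eq_sum_windows n hq, mul_left_comm (2 : ℝ), ← mul_add, Finset.mul_sum,
    ← Finset.sum_add_distrib]
  refine Finset.sum_le_sum fun m _ => ?_
  refine mul_le_mul_of_nonneg_left ?_ (by positivity)
  rw [Finset.sum_sub_distrib]
  nlinarith [sq_nonneg (∑ k ∈ window n q m, x k + ∑ k ∈ window n q m, y k)]

/-- The Cauchy–Schwarz inequality for the quadratic form. -/
theorem abs_quadForm_sub_sub_le (n : ℕ) {q : ℕ} (hq : 1 ≤ q) (x y : (Fin d → ℤ) → ℝ) :
    |quadForm n q (fun k => x k - y k) - quadForm n q x| ≤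
      2 * √(quadForm n q x * quadForm n q y) + quadForm n q y := by
  set w := ((n : ℝ) ^ d)⁻¹ * ((q : ℝ) ^ d)⁻¹ with hw
  have hw0 : 0 ≤ w := by positivity
  set u : (Fin d → ℤ) → ℝ := fun m => ∑ k ∈ window n q m, x k
  set v : (Fin d → ℤ) → ℝ := fun m => ∑ k ∈ window n q m, y k
  have hx : quadForm n q x = w * ∑ m ∈ windowCorners d n q, u m ^ 2 :=
    quadForm_eq_sum_windows n hq x
  have hy : quadForm n q y = w * ∑ m ∈ windowCorners d n q, v m ^ 2 :=
    quadForm_eq_sum_windows n hq y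
  have hxy : quadForm n q (fun k => x k - y k) =
      w * ∑ m ∈ windowCorners d n q, (u m - v m) ^ 2 := by
    rw [quadForm_eq_sum_windows n hq]
    simp only [Finset.sum_sub_distrib, u, v, hw]
  have hcs : |∑ m ∈ windowCorners d n q, u m * v m| ≤
      √((∑ m ∈ windowCorners d n q, u m ^ 2) * ∑ m ∈ windowCorners d n q, v m ^ 2) :=
    Real.abs_le_sqrt (Finset.sum_mul_sq_le_sq_mul_sq _ _ _)
  have hsq : √(quadForm n q x * quadForm n q y) =
      w * √((∑ m ∈ windowCorners d n q, u m ^ 2) * ∑ m ∈ windowCorners d n q, v m ^ 2) := by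
    rw [hx, hy, mul_mul_mul_comm, Real.sqrt_mul (mul_self_nonneg w), Real.sqrt_mul_self hw0]
  have e : quadForm n q (fun k => x k - y k) - quadForm n q x =
      quadForm n q y - 2 * (w * ∑ m ∈ windowCorners d n q, u m * v m) := by
    rw [hx, hy, hxy]
    simp only [sub_sq, Finset.sum_add_distrib, Finset.sum_sub_distrib, mul_assoc,
      ← Finset.mul_sum]
    ring
  have hy0 := quadForm_nonneg n hq y
  rw [e, hsq]
  refine (abs_sub _ _).trans ?_
  rw [abs_of_nonneg hy0, abs_mul, abs_mul, abs_of_nonneg hw0, abs_two, add_comm]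
  gcongr

theorem card_windowCorners_le {n q : ℕ} (hq : 1 ≤ q) (hqn : q ≤ n) :
    ((windowCorners d n q).card : ℝ) ≤ 2 ^ d * (n : ℝ) ^ d := by
  rw [windowCorners, Pi.card_Icc, ← mul_pow]
  simp only [Finset.prod_const, Finset.card_univ, Fintype.card_fin, Int.card_Icc]
  have h : ((n : ℤ) + 1 - (2 - (q : ℤ))).toNat ≤ 2 * n := by omega
  have := Nat.pow_le_pow_left h d
  exact_mod_cast this

theorem window_subset (n q : ℕ) (m : Fin d → ℤ) :
    window n q m ⊆ Finset.Icc m (m + fun _ => (q : ℤ) - 1) := by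
  intro k hk
  exact Finset.mem_Icc.2 (mem_window.1 hk).2

theorem card_window_le (n q : ℕ) (m : Fin d → ℤ) :
    ((window n q m).card : ℝ) ≤ (q : ℝ) ^ d := by
  have h := Finset.card_le_card (window_subset n q m)
  rw [Pi.card_Icc] at h
  simp only [Int.card_Icc, Pi.add_apply] at h
  have e : ∀ i : Fin d, (m i + ((q : ℤ) - 1) + 1 - m i).toNat = q := fun i => by omega
  simp only [e, Finset.prod_const, Finset.card_univ, Fintype.card_fin] at h
  exact_mod_cast h

theorem quadForm_const_le {n q : ℕ} (hq : 1 ≤ q) (hqn : q ≤ n) (c : ℝ) :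
    quadForm (d := d) n q (fun _ => c) ≤ 2 ^ d * (q : ℝ) ^ d * c ^ 2 := by
  have hq' : (0 : ℝ) < (q : ℝ) ^ d := pow_pos (by exact_mod_cast hq) d
  have hn' : (0 : ℝ) < (n : ℝ) ^ d := pow_pos (by exact_mod_cast hq.trans hqn) d
  rw [quadForm_eq_sum_windows n hq]
  have h : ∑ m ∈ windowCorners d n q, (∑ _k ∈ window n q m, c) ^ 2 ≤
      2 ^ d * (n : ℝ) ^ d * ((q : ℝ) ^ d * (q : ℝ) ^ d * c ^ 2) := by
    refine (Finset.sum_le_card_nsmul _ _ ((q : ℝ) ^ d * (q : ℝ) ^ d * c ^ 2) fun m _ => ?_).trans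
      ?_
    · rw [Finset.sum_const, nsmul_eq_mul, mul_pow, sq]
      have := card_window_le n q m
      gcongr
    · rw [nsmul_eq_mul]
      exact mul_le_mul_of_nonneg_right (card_windowCorners_le hq hqn) (by positivity)
  refine (mul_le_mul_of_nonneg_left h (by positivity)).trans_eq ?_
  field_simp

/-- If the quadratic form vanishes then so do the data: at a minimal point `k` of `A_n` with
`x k ≠ 0`, the window with highest corner `k` would have the sum `x k`. -/
theorem eq_zero_of_quadForm_eq_zero {n q : ℕ} (hn : 1 ≤ n) (hq : 1 ≤ q) {x : (Fin d → ℤ) → ℝ}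
    (h : quadForm n q x = 0) : ∀ k ∈ cube d n, x k = 0 := by
  classical
  by_contra! hcon
  obtain ⟨k₀, hk₀, hx₀⟩ := hcon
  obtain ⟨k, hk⟩ := ((cube d n).filter fun k => x k ≠ 0).exists_minimal
    ⟨k₀, Finset.mem_filter.2 ⟨hk₀, hx₀⟩⟩
  have hk1 := Finset.mem_filter.1 hk.prop
  have hq' : (0 : ℝ) < (q : ℝ) ^ d := pow_pos (by exact_mod_cast hq) d
  have hn' : (0 : ℝ) < (n : ℝ) ^ d := pow_pos (by exact_mod_cast hn) d
  rw [quadForm_eq_sum_windows n hq] at h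
  have h1 := (mul_eq_zero.1 h).resolve_left (by positivity)
  have hmem : (k - fun _ => (q : ℤ) - 1) ∈ windowCorners d n q := by
    rw [windowCorners, Finset.mem_Icc]
    have := mem_cube.1 hk1.1
    constructor <;>
    · intro i
      have := this i
      simp only [Pi.sub_apply]
      omega
  have h2 := (Finset.sum_eq_zero_iff_of_nonneg fun m _ => sq_nonneg _).1 h1 _ hmem
  rw [sq_eq_zero_iff, Finset.sum_eq_single k] at h2
  · exact hk1.2 h2
  · intro l hl hlk
    by_contra hxl
    have hl' := mem_window.1 hl
    have hle : l ≤ k := by simpa using hl'.2.2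
    exact hlk (le_antisymm hle (hk.le_of_le (Finset.mem_filter.2 ⟨hl'.1, hxl⟩) hle))
  · intro hnot
    refine absurd (mem_window.2 ⟨hk1.1, ?_, ?_⟩) hnot
    · intro i
      simp only [Pi.sub_apply]
      omega
    · simp

theorem sStarVar_eq_zero_of_sHatSq_eq_zero {Ω : Type*} {X : (Fin d → ℤ) → Ω → ℝ} {n q : ℕ}
    (hn : 1 ≤ n) (hq : 1 ≤ q) {ω : Ω} (h : sHatSq X n q ω = 0) : sStarVar X n ω = 0 := by
  rw [sHatSq_eq_quadForm X n hq] at h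
  have h0 := eq_zero_of_quadForm_eq_zero hn hq h
  have h1 : ∀ j ∈ cube d n, sStar X n j ω = 0 := by
    intro j hj
    refine Finset.sum_eq_zero fun k hk => h0 k (mem_cube.2 fun i => ?_)
    have h2 := mem_box.1 hk i
    exact ⟨h2.1, h2.2.trans (mem_cube.1 hj i).2⟩
  rw [sStarVar_eq X hn, Finset.sum_eq_zero h1, Finset.sum_eq_zero fun j hj => by rw [h1 j hj]; simp]
  simp

end QuadForm

/-! ### Second moments of sums over finite sets -/

section SecondMoments

variable {d : ℕ}

/-- `∑_{k, l ∈ B} r (k - l)`: for a covariance function `r`, the variance of the sum over `B`. -/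
noncomputable def covSum (r : (Fin d → ℤ) → ℝ) (B : Finset (Fin d → ℤ)) : ℝ :=
  ∑ k ∈ B, ∑ l ∈ B, r (k - l)

theorem covSum_image_add (r : (Fin d → ℤ) → ℝ) (B : Finset (Fin d → ℤ)) (v : Fin d → ℤ) :
    covSum r (B.image (· + v)) = covSum r B := by
  have hinj : Set.InjOn (· + v) (B : Set (Fin d → ℤ)) := fun _ _ _ _ h => add_right_cancel h
  simp only [covSum, Finset.sum_image hinj, add_sub_add_right_eq_sub]

theorem covSum_Icc (r : (Fin d → ℤ) → ℝ) (a b : Fin d → ℤ) :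
    covSum r (Finset.Icc a b) = covSum r (box fun i => ((b i - a i + 1).toNat : ℤ)) := by
  have e : Finset.Icc a b =
      (box fun i => ((b i - a i + 1).toNat : ℤ)).image (· + (a - 1)) := by
    ext k
    rw [Finset.mem_image, Finset.mem_Icc, Pi.le_def, Pi.le_def]
    constructor
    · rintro ⟨h1, h2⟩
      refine ⟨k - (a - 1), mem_box.2 fun i => ?_, by abel⟩
      have := h1 i
      have := h2 i
      simp only [Pi.sub_apply, Pi.one_apply]
      omega
    · rintro ⟨l, hl, rfl⟩
      constructor <;>
      · intro i
        have := mem_box.1 hl i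
        simp only [Pi.add_apply, Pi.sub_apply, Pi.one_apply]
        omega
  rw [e, covSum_image_add]

variable {Ω : Type*} [MeasurableSpace Ω] {X : (Fin d → ℤ) → Ω → ℝ} {P : Measure Ω}

/-- The centered field `X_k - E X_0`. -/
noncomputable def centered (X : (Fin d → ℤ) → Ω → ℝ) (P : Measure Ω) (k : Fin d → ℤ) (ω : Ω) : ℝ :=
  X k ω - ∫ ω', X 0 ω' ∂P

theorem sHatSq_eq_quadForm_centered (X : (Fin d → ℤ) → Ω → ℝ) (P : Measure Ω) (n : ℕ) {q : ℕ}
    (hq : 1 ≤ q) (ω : Ω) : sHatSq X n q ω = quadForm n q fun k =>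
      centered X P k ω - (sampleMean X n ω - ∫ ω', X 0 ω' ∂P) := by
  rw [sHatSq_eq_quadForm X n hq]
  congr 1
  funext k
  simp only [centered]
  ring

theorem IsStationary₂.memLp_centered [IsProbabilityMeasure P]
    (hX : IsStationary₂ X P) (k : Fin d → ℤ) :
    MemLp (centered X P k) 2 P :=
  (hX.memLp k).sub (memLp_const _)

theorem IsStationary₂.integrable_mul [IsProbabilityMeasure P]
    (hX : IsStationary₂ X P) (k l : Fin d → ℤ) :
    Integrable (fun ω => centered X P k ω * centered X P l ω) P :=
  (hX.memLp_centered k).integrable_mul (hX.memLp_centered l)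

theorem IsStationary₂.autocov_neg (hX : IsStationary₂ X P) (h : Fin d → ℤ) :
    autocov X P (-h) = autocov X P h := by
  rw [autocov, covariance_comm]
  have := hX.cov (-h) h
  rw [neg_add_cancel] at this
  exact this

theorem IsStationary₂.integral_mul (hX : IsStationary₂ X P) (k l : Fin d → ℤ) :
    ∫ ω, centered X P k ω * centered X P l ω ∂P = autocov X P (k - l) := by
  rw [← hX.autocov_neg, neg_sub, autocov, ← hX.cov k (l - k), add_sub_cancel, covariance,
    hX.mean k, hX.mean l]
  rfl

theorem IsStationary₂.integral_sum_mul_sum [IsProbabilityMeasure P]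
    (hX : IsStationary₂ X P) (s : Finset (Fin d → ℤ))
    (c : (Fin d → ℤ) → ℝ) : ∫ ω, (∑ k ∈ s, c k * centered X P k ω) ^ 2 ∂P =
      ∑ k ∈ s, ∑ l ∈ s, c k * c l * autocov X P (k - l) := by
  have e : ∀ ω, (∑ k ∈ s, c k * centered X P k ω) ^ 2 =
      ∑ k ∈ s, ∑ l ∈ s, c k * c l * (centered X P k ω * centered X P l ω) := by
    intro ω
    rw [sq, Finset.sum_mul_sum]
    refine Finset.sum_congr rfl fun k _ => Finset.sum_congr rfl fun l _ => ?_
    ring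
  simp only [e]
  rw [integral_finsetSum _ fun k _ => integrable_finsetSum _ fun l _ =>
    (hX.integrable_mul k l).const_mul _]
  refine Finset.sum_congr rfl fun k _ => ?_
  rw [integral_finsetSum _ fun l _ => (hX.integrable_mul k l).const_mul _]
  refine Finset.sum_congr rfl fun l _ => ?_
  rw [integral_const_mul, hX.integral_mul]

/-- The covariance function is positive definite. -/
theorem IsStationary₂.autocov_posDef [IsProbabilityMeasure P]
    (hX : IsStationary₂ X P) (s : Finset (Fin d → ℤ))
    (c : (Fin d → ℤ) → ℝ) : 0 ≤ ∑ k ∈ s, ∑ l ∈ s, c k * c l * autocov X P (k - l) := by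
  rw [← hX.integral_sum_mul_sum]
  exact integral_nonneg fun _ => sq_nonneg _

theorem IsStationary₂.integral_sum_sq [IsProbabilityMeasure P]
    (hX : IsStationary₂ X P) (s : Finset (Fin d → ℤ)) :
    ∫ ω, (∑ k ∈ s, centered X P k ω) ^ 2 ∂P = covSum (autocov X P) s := by
  simpa [covSum] using hX.integral_sum_mul_sum s fun _ => 1

theorem IsStationary₂.covSum_nonneg [IsProbabilityMeasure P]
    (hX : IsStationary₂ X P) (s : Finset (Fin d → ℤ)) :
    0 ≤ covSum (autocov X P) s := by
  rw [← hX.integral_sum_sq]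
  exact integral_nonneg fun _ => sq_nonneg _

theorem IsStationary₂.integrable_sum_sq [IsProbabilityMeasure P]
    (hX : IsStationary₂ X P) (s : Finset (Fin d → ℤ)) :
    Integrable (fun ω => (∑ k ∈ s, centered X P k ω) ^ 2) P :=
  (memLp_finsetSum s fun k _ => hX.memLp_centered k).integrable_sq

theorem IsStationary₂.variance_sum_eq [IsProbabilityMeasure P]
    (hX : IsStationary₂ X P) (s : Finset (Fin d → ℤ)) :
    Var[fun ω => ∑ k ∈ s, X k ω; P] = covSum (autocov X P) s := by
  rw [variance_fun_sum' fun k _ => hX.memLp k]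
  refine Finset.sum_congr rfl fun k _ => Finset.sum_congr rfl fun l _ => ?_
  rw [← hX.integral_mul, covariance, hX.mean k, hX.mean l]
  rfl

theorem IsStationary₂.integrable_quadForm [IsProbabilityMeasure P]
    (hX : IsStationary₂ X P) (n q : ℕ) :
    Integrable (fun ω => quadForm n q fun k => centered X P k ω) P :=
  (integrable_finsetSum _ fun k _ => integrable_finsetSum _ fun l _ =>
    (hX.integrable_mul k l).const_mul _).const_mul _

theorem IsStationary₂.integral_quadForm [IsProbabilityMeasure P]
    (hX : IsStationary₂ X P) (n q : ℕ) :
    ∫ ω, quadForm n q (fun k => centered X P k ω) ∂P = ((n : ℝ) ^ d)⁻¹ *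
      ∑ k ∈ cube d n, ∑ l ∈ cube d n, triangle q (k - l) * autocov X P (k - l) := by
  simp only [quadForm]
  rw [integral_const_mul, integral_finsetSum _ fun k _ => integrable_finsetSum _ fun l _ =>
    (hX.integrable_mul k l).const_mul _]
  congr 1
  refine Finset.sum_congr rfl fun k _ => ?_
  rw [integral_finsetSum _ fun l _ => (hX.integrable_mul k l).const_mul _]
  refine Finset.sum_congr rfl fun l _ => ?_
  rw [integral_const_mul, hX.integral_mul]

theorem IsStationary₂.integral_quadForm_eq_sum_windows [IsProbabilityMeasure P]
    (hX : IsStationary₂ X P) (n : ℕ) {q : ℕ}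
    (hq : 1 ≤ q) : ∫ ω, quadForm n q (fun k => centered X P k ω) ∂P =
      ((n : ℝ) ^ d)⁻¹ * ((q : ℝ) ^ d)⁻¹ *
        ∑ m ∈ windowCorners d n q, covSum (autocov X P) (window n q m) := by
  simp only [quadForm_eq_sum_windows n hq]
  rw [integral_const_mul, integral_finsetSum _ fun m _ => hX.integrable_sum_sq _]
  simp only [hX.integral_sum_sq]

theorem sampleMean_sub_sq {n : ℕ} (hn : 1 ≤ n) (ω : Ω) :
    (sampleMean X n ω - ∫ ω', X 0 ω' ∂P) ^ 2 =
      (((n : ℝ) ^ d)⁻¹) ^ 2 * (∑ k ∈ cube d n, centered X P k ω) ^ 2 := by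
  rw [sampleMean_eq X (∫ ω', X 0 ω' ∂P) hn, add_sub_cancel_left, mul_pow]
  rfl

/-! ### Convergence in probability -/

/-- A form of the continuous mapping theorem for limits in probability: `Z n` is close to `z` as
soon as `U n` and `W n` are close to their limits, pointwise in `ω`. -/
theorem tendstoInMeasure_of_implication {U W Z : ℕ → Ω → ℝ} {u w z : ℝ}
    (hU : TendstoInMeasure P U atTop fun _ => u) (hW : TendstoInMeasure P W atTop fun _ => w)
    (H : ∀ ε > 0, ∃ δ > 0, ∀ᶠ n in atTop, ∀ ω, |U n ω - u| < δ → |W n ω - w| < δ →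
      |Z n ω - z| < ε) : TendstoInMeasure P Z atTop fun _ => z := by
  rw [tendstoInMeasure_iff_dist] at hU hW ⊢
  intro ε hε
  obtain ⟨δ, hδ, hn⟩ := H ε hε
  have h := (hU δ hδ).add (hW δ hδ)
  rw [add_zero] at h
  refine tendsto_of_tendsto_of_tendsto_of_le_of_le' tendsto_const_nhds h
    (Eventually.of_forall fun _ => bot_le) ?_
  filter_upwards [hn] with n hn
  refine (measure_mono fun ω hω => ?_).trans (measure_union_le _ _)
  by_contra hcon
  rw [Set.mem_union, not_or] at hcon
  exact absurd (hn ω (not_le.1 hcon.1) (not_le.1 hcon.2)) (not_lt.2 hω)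

theorem tendstoInMeasure_of_variance [IsProbabilityMeasure P]
    {Y : ℕ → Ω → ℝ} {c : ℝ} (hY : ∀ n, MemLp (Y n) 2 P)
    (hmean : Tendsto (fun n => ∫ ω, Y n ω ∂P) atTop (𝓝 c))
    (hvar : Tendsto (fun n => Var[Y n; P]) atTop (𝓝 0)) :
    TendstoInMeasure P Y atTop fun _ => c := by
  rw [tendstoInMeasure_iff_dist]
  intro ε hε
  have h1 : Tendsto (fun n => ENNReal.ofReal (Var[Y n; P] / (ε / 2) ^ 2)) atTop (𝓝 0) := by
    have := (ENNReal.tendsto_ofReal (hvar.div_const ((ε / 2) ^ 2)))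
    simpa using this
  refine tendsto_of_tendsto_of_tendsto_of_le_of_le' tendsto_const_nhds h1
    (Eventually.of_forall fun _ => bot_le) ?_
  filter_upwards [(Metric.tendsto_nhds.1 hmean) (ε / 2) (half_pos hε)] with n hn
  refine (measure_mono fun ω hω => ?_).trans
    (meas_ge_le_variance_div_sq (hY n) (half_pos hε))
  rw [Set.mem_ofPred_eq] at hω ⊢
  have h2 := dist_triangle (Y n ω) (∫ ω, Y n ω ∂P) c
  rw [← Real.dist_eq]
  linarith

theorem tendstoInMeasure_zero_of_integral {Y : ℕ → Ω → ℝ} (hY : ∀ n, Integrable (Y n) P)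
    (h0 : ∀ᶠ n in atTop, ∀ ω, 0 ≤ Y n ω)
    (hlim : Tendsto (fun n => ∫ ω, Y n ω ∂P) atTop (𝓝 0)) :
    TendstoInMeasure P Y atTop fun _ => 0 := by
  rw [tendstoInMeasure_iff_dist]
  intro ε hε
  have h1 : Tendsto (fun n => ENNReal.ofReal (∫ ω, Y n ω ∂P) / ENNReal.ofReal ε) atTop (𝓝 0) := by
    have h2 := ENNReal.tendsto_ofReal hlim
    rw [ENNReal.ofReal_zero] at h2
    have := ENNReal.Tendsto.div_const h2 (b := ENNReal.ofReal ε)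
      (Or.inr (ENNReal.ofReal_pos.2 hε).ne')
    simpa using this
  refine tendsto_of_tendsto_of_tendsto_of_le_of_le' tendsto_const_nhds h1
    (Eventually.of_forall fun _ => bot_le) ?_
  filter_upwards [h0] with n hn
  rw [ofReal_integral_eq_lintegral_ofReal (hY n) (ae_of_all _ hn)]
  refine (measure_mono fun ω hω => ?_).trans
    (meas_ge_le_lintegral_div (hY n).1.aemeasurable.ennreal_ofReal
      (ENNReal.ofReal_pos.2 hε).ne' ENNReal.ofReal_ne_top)
  rw [Set.mem_ofPred_eq] at hω ⊢
  rw [Real.dist_eq, sub_zero, abs_of_nonneg (hn ω)] at hω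
  exact ENNReal.ofReal_le_ofReal hω

end SecondMoments

/-! ### Consistency of the variance estimator under short memory -/

section Consistency

variable {d : ℕ} {Ω : Type*} [MeasurableSpace Ω] {X : (Fin d → ℤ) → Ω → ℝ} {P : Measure Ω}

theorem sum_abs_shift_le {r : (Fin d → ℤ) → ℝ} (hr : Summable fun j => |r j|)
    (s : Finset (Fin d → ℤ)) (a : Fin d → ℤ) : ∑ k ∈ s, |r (k - a)| ≤ ∑' j, |r j| := by
  classical
  have hinj : Set.InjOn (· - a) (s : Set (Fin d → ℤ)) := fun _ _ _ _ h => sub_left_injective h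
  rw [← Finset.sum_image (f := fun j => |r j|) hinj]
  exact hr.sum_le_tsum _ fun _ _ => abs_nonneg _

theorem covSum_cube_le {r : (Fin d → ℤ) → ℝ} (hr : Summable fun j => |r j|) (n : ℕ) :
    covSum r (cube d n) ≤ (n : ℝ) ^ d * ∑' j, |r j| := by
  rw [covSum, Finset.sum_comm]
  refine (Finset.sum_le_card_nsmul _ _ _ fun l _ =>
    (Finset.sum_le_sum fun k _ => le_abs_self (r (k - l))).trans
      (sum_abs_shift_le hr _ l)).trans_eq ?_
  rw [card_cube, nsmul_eq_mul]
  push_cast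
  rfl

/-- Counting the pairs with a given difference turns a double sum over `A_n` into a series with
triangular weights. -/
theorem sum_sum_sub_eq_tsum {f : (Fin d → ℤ) → ℝ} (hf : Summable f) (heven : ∀ j, f (-j) = f j)
    {n : ℕ} (hn : 1 ≤ n) :
    ((n : ℝ) ^ d)⁻¹ * ∑ k ∈ cube d n, ∑ l ∈ cube d n, f (k - l) = ∑' j, triangle n j * f j := by
  classical
  have hn' : (0 : ℝ) < (n : ℝ) ^ d := pow_pos (by exact_mod_cast hn) d
  have h1 : ∀ k ∈ cube d n, ∑ l ∈ cube d n, f (k - l) =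
      ∑' j, if k + j ∈ cube d n then f j else 0 := by
    intro k _
    have e : ∑ l ∈ cube d n, f (k - l) = ∑' l, if l ∈ cube d n then f (k - l) else 0 := by
      rw [tsum_eq_sum (s := cube d n) fun l hl => if_neg hl]
      exact Finset.sum_congr rfl fun l hl => (if_pos hl).symm
    rw [e, ← (Equiv.addLeft k).tsum_eq]
    refine tsum_congr fun j => ?_
    simp only [Equiv.coe_addLeft, sub_add_cancel_left, heven]
  have h2 : ∀ k ∈ cube d n, Summable fun j => if k + j ∈ cube d n then f j else 0 := by
    intro k _
    refine hf.abs.of_norm_bounded fun j => ?_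
    rw [Real.norm_eq_abs]
    split_ifs
    · exact le_rfl
    · rw [abs_zero]; exact abs_nonneg _
  rw [Finset.sum_congr rfl h1, ← Summable.tsum_finsetSum h2, ← tsum_mul_left]
  refine tsum_congr fun j => ?_
  rw [← Finset.sum_filter, Finset.sum_const, nsmul_eq_mul, card_filter_add_mem_cube hn]
  field_simp

theorem tendsto_integral_quadForm [IsProbabilityMeasure P] (hX : IsStationary₂ X P)
    (hr : Summable fun j => |autocov X P j|) {q : ℕ → ℕ} (hq : Tendsto q atTop atTop) :
    Tendsto (fun n => ∫ ω, quadForm n (q n) (fun k => centered X P k ω) ∂P) atTop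
      (𝓝 (longRunVar X P)) := by
  have hlim : Tendsto (fun n : ℕ => ∑' j : Fin d → ℤ,
      triangle n j * (triangle (q n) j * autocov X P j)) atTop (𝓝 (∑' j, autocov X P j)) := by
    refine tendsto_tsum_of_dominated_convergence hr (fun j => ?_)
      (Eventually.of_forall fun n j => ?_)
    · have := (tendsto_triangle j).mul (((tendsto_triangle j).comp hq).mul_const (autocov X P j))
      simpa using this
    · rw [Real.norm_eq_abs, abs_mul, abs_mul, abs_of_nonneg (triangle_nonneg _ _),
        abs_of_nonneg (triangle_nonneg _ _)]
      exact (mul_le_of_le_one_left (by positivity [triangle_nonneg (q n) j])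
        (triangle_le_one _ _)).trans
        (mul_le_of_le_one_left (abs_nonneg _) (triangle_le_one _ _))
  refine hlim.congr' ?_
  filter_upwards [eventually_ge_atTop 1] with n hn
  rw [hX.integral_quadForm, sum_sum_sub_eq_tsum
    (f := fun j => triangle (q n) j * autocov X P j) ?_ ?_ hn]
  · refine hr.of_norm_bounded fun j => ?_
    rw [Real.norm_eq_abs, abs_mul, abs_of_nonneg (triangle_nonneg _ _)]
    exact mul_le_of_le_one_left (abs_nonneg _) (triangle_le_one _ _)
  · intro j
    rw [triangle_neg, hX.autocov_neg]

theorem IsStationary₄.memLp_centered_mul [IsProbabilityMeasure P] (hX : IsStationary₄ X P)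
    (k l : Fin d → ℤ) : MemLp (fun ω => centered X P k ω * centered X P l ω) 2 P := by
  have h : ∀ k, MemLp (centered X P k) 4 P := fun k => (hX.memLp₄ k).sub (memLp_const _)
  have : ENNReal.HolderTriple 4 4 2 := ⟨by
    have e : (4 : ℝ≥0∞) = 2 * 2 := by norm_num
    rw [e, ENNReal.mul_inv (by simp) (by simp), ← mul_add, ENNReal.inv_two_add_inv_two, mul_one]⟩
  exact (h l).mul' (h k)

/-- The covariance of two products is a fourth-order cumulant plus two products of covariances. -/
theorem IsStationary₄.cov_mul_mul [IsProbabilityMeasure P] (hX : IsStationary₄ X P)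
    (k l k' l' : Fin d → ℤ) :
    cov[fun ω => centered X P k ω * centered X P l ω,
      fun ω => centered X P k' ω * centered X P l' ω; P] =
      cumulant₄ X P (l - k) (k' - k) (l' - k) + autocov X P (k' - k) * autocov X P (l' - l) +
        autocov X P (l' - k) * autocov X P (k' - l) := by
  have h2 := hX.toIsStationary₂
  rw [covariance_eq_sub (hX.memLp_centered_mul k l) (hX.memLp_centered_mul k' l'),
    h2.integral_mul, h2.integral_mul]
  have hm : ∫ ω, ((fun ω => centered X P k ω * centered X P l ω) *
      fun ω => centered X P k' ω * centered X P l' ω) ω ∂P =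
      moment₄ X P k (l - k) (k' - k) (l' - k) := by
    simp only [moment₄, add_sub_cancel, h2.mean k, h2.mean l, h2.mean k', h2.mean l']
    refine integral_congr_ae (ae_of_all _ fun ω => ?_)
    simp only [Pi.mul_apply, centered]
    ring
  rw [hm, hX.moment, cumulant₄]
  have e1 : l' - k - (k' - k) = l' - k' := by abel
  have e2 : l' - k - (l - k) = l' - l := by abel
  have e3 : k' - k - (l - k) = k' - l := by abel
  rw [e1, e2, e3, ← h2.autocov_neg (k - l), ← h2.autocov_neg (k' - l'), neg_sub, neg_sub]
  ring

theorem sum_abs_cumulant_le {h : Fin d → ℤ}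
    (hc : (⨆ h : Fin d → ℤ, ∑' p : (Fin d → ℤ) × (Fin d → ℤ),
      ENNReal.ofReal |cumulant₄ X P h p.1 p.2|) < ⊤) (S : Finset ((Fin d → ℤ) × (Fin d → ℤ))) :
    ∑ p ∈ S, |cumulant₄ X P h p.1 p.2| ≤
      (⨆ h : Fin d → ℤ, ∑' p : (Fin d → ℤ) × (Fin d → ℤ),
        ENNReal.ofReal |cumulant₄ X P h p.1 p.2|).toReal := by
  rw [← ENNReal.ofReal_le_iff_le_toReal hc.ne, ENNReal.ofReal_sum_of_nonneg fun _ _ => abs_nonneg _]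
  exact (ENNReal.sum_le_tsum S).trans
    (le_iSup (fun h : Fin d → ℤ => ∑' p : (Fin d → ℤ) × (Fin d → ℤ),
      ENNReal.ofReal |cumulant₄ X P h p.1 p.2|) h)

/-- Fix one product `x_k x_l`. Its covariances with all the other products are absolutely summable,
uniformly in `k` and `l`: the cumulants are summable by hypothesis, and each product of two
covariances separates into two independent sums. -/
theorem IsStationary₄.exists_sum_abs_cov_le [IsProbabilityMeasure P] (hX : IsStationary₄ X P)
    (hr : Summable fun j => |autocov X P j|)
    (hc : (⨆ h : Fin d → ℤ, ∑' p : (Fin d → ℤ) × (Fin d → ℤ),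
      ENNReal.ofReal |cumulant₄ X P h p.1 p.2|) < ⊤) :
    ∃ D : ℝ, 0 ≤ D ∧ ∀ (s : Finset (Fin d → ℤ)) (k l : Fin d → ℤ),
      ∑ p ∈ s ×ˢ s, |cov[fun ω => centered X P k ω * centered X P l ω,
        fun ω => centered X P p.1 ω * centered X P p.2 ω; P]| ≤ D := by
  classical
  set R := ∑' j, |autocov X P j| with hR
  have hR0 : 0 ≤ R := tsum_nonneg fun _ => abs_nonneg _
  refine ⟨(⨆ h : Fin d → ℤ, ∑' p : (Fin d → ℤ) × (Fin d → ℤ),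
      ENNReal.ofReal |cumulant₄ X P h p.1 p.2|).toReal + R * R + R * R, by positivity, ?_⟩
  intro s k l
  have hterm : ∀ p ∈ s ×ˢ s, |cov[fun ω => centered X P k ω * centered X P l ω,
      fun ω => centered X P p.1 ω * centered X P p.2 ω; P]| ≤
      |cumulant₄ X P (l - k) (p.1 - k) (p.2 - k)| +
        |autocov X P (p.1 - k)| * |autocov X P (p.2 - l)| +
        |autocov X P (p.1 - l)| * |autocov X P (p.2 - k)| := by
    intro p _
    rw [hX.cov_mul_mul]
    refine (abs_add_le _ _).trans (add_le_add ((abs_add_le _ _).trans ?_) ?_)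
    · rw [abs_mul]
    · rw [abs_mul, mul_comm]
  refine (Finset.sum_le_sum hterm).trans ?_
  rw [Finset.sum_add_distrib, Finset.sum_add_distrib]
  have hprod : ∀ a b : Fin d → ℤ, ∑ p ∈ s ×ˢ s,
      |autocov X P (p.1 - a)| * |autocov X P (p.2 - b)| ≤ R * R := by
    intro a b
    rw [Finset.sum_product]
    refine (Finset.sum_mul_sum s s (fun x => |autocov X P (x - a)|)
      fun y => |autocov X P (y - b)|).symm.trans_le ?_
    exact mul_le_mul (sum_abs_shift_le hr s a) (sum_abs_shift_le hr s b)
      (Finset.sum_nonneg fun _ _ => abs_nonneg _) hR0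
  refine add_le_add (add_le_add ?_ (hprod k l)) (hprod l k)
  have hinj : Set.InjOn (fun p : (Fin d → ℤ) × (Fin d → ℤ) => (p.1 - k, p.2 - k))
      ((s ×ˢ s : Finset _) : Set ((Fin d → ℤ) × (Fin d → ℤ))) := by
    rintro ⟨a, b⟩ _ ⟨a', b'⟩ _ h
    simp only [Prod.mk.injEq, sub_left_inj] at h
    exact Prod.ext h.1 h.2
  rw [← Finset.sum_image (f := fun p : (Fin d → ℤ) × (Fin d → ℤ) =>
    |cumulant₄ X P (l - k) p.1 p.2|) hinj]
  exact sum_abs_cumulant_le hc _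

theorem quadForm_eq_sum_product (n q : ℕ) (x : (Fin d → ℤ) → ℝ) :
    quadForm n q x = ∑ p ∈ cube d n ×ˢ cube d n,
      ((n : ℝ) ^ d)⁻¹ * triangle q (p.1 - p.2) * (x p.1 * x p.2) := by
  rw [quadForm, Finset.sum_product, Finset.mul_sum]
  refine Finset.sum_congr rfl fun k _ => ?_
  rw [Finset.mul_sum]
  exact Finset.sum_congr rfl fun l _ => (mul_assoc _ _ _).symm

theorem IsStationary₄.memLp_quadForm [IsProbabilityMeasure P] (hX : IsStationary₄ X P)
    (n q : ℕ) : MemLp (fun ω => quadForm n q fun k => centered X P k ω) 2 P := by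
  simp only [quadForm_eq_sum_product]
  exact memLp_finsetSum _ fun p _ => (hX.memLp_centered_mul p.1 p.2).const_mul _

/-- One of the two families of weights in the variance is bounded by `n ^ (-d)`, and the other has
sum `O(q ^ d)`, being the value of the quadratic form at a constant. -/
theorem IsStationary₄.exists_variance_quadForm_le [IsProbabilityMeasure P]
    (hX : IsStationary₄ X P) (hr : Summable fun j => |autocov X P j|)
    (hc : (⨆ h : Fin d → ℤ, ∑' p : (Fin d → ℤ) × (Fin d → ℤ),
      ENNReal.ofReal |cumulant₄ X P h p.1 p.2|) < ⊤) :
    ∃ D : ℝ, ∀ n q : ℕ, 1 ≤ q → q ≤ n →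
      Var[fun ω => quadForm n q fun k => centered X P k ω; P] ≤ D * ((q : ℝ) / n) ^ d := by
  obtain ⟨D, hD0, hD⟩ := hX.exists_sum_abs_cov_le hr hc
  refine ⟨D * 2 ^ d, fun n q hq hqn => ?_⟩
  have hn' : (0 : ℝ) < (n : ℝ) ^ d := pow_pos (by exact_mod_cast hq.trans hqn) d
  simp only [quadForm_eq_sum_product]
  rw [variance_fun_sum' fun p _ => (hX.memLp_centered_mul p.1 p.2).const_mul _]
  set S := cube d n ×ˢ cube d n
  set w : (Fin d → ℤ) × (Fin d → ℤ) → ℝ := fun p => ((n : ℝ) ^ d)⁻¹ * triangle q (p.1 - p.2)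
  have hw0 : ∀ p, 0 ≤ w p := fun p => mul_nonneg (by positivity) (triangle_nonneg _ _)
  have hw1 : ∀ p, w p ≤ ((n : ℝ) ^ d)⁻¹ := fun p =>
    mul_le_of_le_one_right (by positivity) (triangle_le_one _ _)
  have hwsum : ∑ p ∈ S, w p ≤ 2 ^ d * (q : ℝ) ^ d := by
    have := quadForm_const_le (d := d) hq hqn 1
    rw [quadForm_eq_sum_product] at this
    simpa using this
  have hrow : ∀ p ∈ S, ∑ p' ∈ S, cov[fun ω => w p * (centered X P p.1 ω * centered X P p.2 ω),
      fun ω => w p' * (centered X P p'.1 ω * centered X P p'.2 ω); P] ≤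
      w p * (((n : ℝ) ^ d)⁻¹ * D) := by
    intro p _
    have h1 : ∀ p' ∈ S, cov[fun ω => w p * (centered X P p.1 ω * centered X P p.2 ω),
        fun ω => w p' * (centered X P p'.1 ω * centered X P p'.2 ω); P] ≤
        w p * (((n : ℝ) ^ d)⁻¹ * |cov[fun ω => centered X P p.1 ω * centered X P p.2 ω,
          fun ω => centered X P p'.1 ω * centered X P p'.2 ω; P]|) := by
      intro p' _
      rw [covariance_const_mul_left, covariance_const_mul_right]
      refine mul_le_mul_of_nonneg_left ?_ (hw0 p)
      exact (mul_le_mul_of_nonneg_left (le_abs_self _) (hw0 p')).trans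
        (mul_le_mul_of_nonneg_right (hw1 p') (abs_nonneg _))
    refine (Finset.sum_le_sum h1).trans ?_
    rw [← Finset.mul_sum, ← Finset.mul_sum]
    exact mul_le_mul_of_nonneg_left
      (mul_le_mul_of_nonneg_left (hD _ _ _) (by positivity)) (hw0 p)
  refine (Finset.sum_le_sum hrow).trans ?_
  rw [← Finset.sum_mul]
  refine (mul_le_mul_of_nonneg_right hwsum (by positivity)).trans_eq ?_
  rw [div_pow]
  field_simp

/-- Under short memory the variance estimator is consistent. -/
theorem tendstoInMeasure_sHatSq [IsProbabilityMeasure P] (hX : IsStationary₄ X P)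
    (hr : Summable fun j => |autocov X P j|)
    (hc : (⨆ h : Fin d → ℤ, ∑' p : (Fin d → ℤ) × (Fin d → ℤ),
      ENNReal.ofReal |cumulant₄ X P h p.1 p.2|) < ⊤) (hd : 1 ≤ d)
    {q : ℕ → ℕ} (hq : Tendsto q atTop atTop)
    (hqn : Tendsto (fun n : ℕ => (q n : ℝ) / (n : ℝ)) atTop (𝓝 0)) :
    TendstoInMeasure P (fun n => sHatSq X n (q n)) atTop fun _ => longRunVar X P := by
  have hd0 : d ≠ 0 := by omega
  have h2 := hX.toIsStationary₂
  have hqd : Tendsto (fun n : ℕ => ((q n : ℝ) / n) ^ d) atTop (𝓝 0) := by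
    simpa [hd0] using hqn.pow d
  have hgood : ∀ᶠ n in atTop, 1 ≤ q n ∧ q n ≤ n := by
    filter_upwards [hq.eventually_ge_atTop 1, hqn.eventually_le_const zero_lt_one,
      eventually_ge_atTop 1] with n h1 h2 h3
    refine ⟨h1, ?_⟩
    have hn : (0 : ℝ) < n := by exact_mod_cast h3
    exact_mod_cast (div_le_one hn).1 h2
  set v := longRunVar X P
  have hQ : TendstoInMeasure P (fun n ω => quadForm n (q n) fun k => centered X P k ω) atTop
      fun _ => v := by
    refine tendstoInMeasure_of_variance (fun n => hX.memLp_quadForm n (q n))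
      (tendsto_integral_quadForm h2 hr hq) ?_
    obtain ⟨D, hD⟩ := hX.exists_variance_quadForm_le hr hc
    have h3 : Tendsto (fun n : ℕ => D * ((q n : ℝ) / n) ^ d) atTop (𝓝 0) := by
      simpa using hqd.const_mul D
    refine tendsto_of_tendsto_of_tendsto_of_le_of_le' tendsto_const_nhds h3
      (Eventually.of_forall fun _ => variance_nonneg _ _) ?_
    filter_upwards [hgood] with n hn using hD n (q n) hn.1 hn.2
  -- the contribution of the sample mean
  set W : ℕ → Ω → ℝ := fun n ω =>
    (2 ^ d * (q n : ℝ) ^ d * (((n : ℝ) ^ d)⁻¹) ^ 2) * (∑ k ∈ cube d n, centered X P k ω) ^ 2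
    with hW
  have hW0 : ∀ n ω, 0 ≤ W n ω := fun n ω => by positivity
  have hWlim : TendstoInMeasure P W atTop fun _ => 0 := by
    refine tendstoInMeasure_zero_of_integral (fun n => (h2.integrable_sum_sq _).const_mul _)
      (Eventually.of_forall hW0) ?_
    have h3 : Tendsto (fun n : ℕ => 2 ^ d * (∑' j, |autocov X P j|) * ((q n : ℝ) / n) ^ d) atTop
        (𝓝 0) := by
      simpa using hqd.const_mul (2 ^ d * (∑' j, |autocov X P j|))
    refine tendsto_of_tendsto_of_tendsto_of_le_of_le' tendsto_const_nhds h3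
      (Eventually.of_forall fun n => integral_nonneg (hW0 n)) ?_
    filter_upwards [eventually_ge_atTop 1] with n hn
    have hn' : (0 : ℝ) < (n : ℝ) ^ d := pow_pos (by exact_mod_cast hn) d
    rw [hW, integral_const_mul, h2.integral_sum_sq]
    refine (mul_le_mul_of_nonneg_left (covSum_cube_le hr n) (by positivity)).trans_eq ?_
    rw [div_pow]
    field_simp
  have hv0 : 0 ≤ v := by
    refine ge_of_tendsto (tendsto_integral_quadForm h2 hr hq) ?_
    filter_upwards [hgood] with n hn
    exact integral_nonneg fun ω => quadForm_nonneg n hn.1 _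
  refine tendstoInMeasure_of_implication hQ hWlim fun ε hε => ?_
  -- continuity at `(v, 0)` of the error bound of the Cauchy–Schwarz inequality
  have hcont : ContinuousAt (fun p : ℝ × ℝ => |p.1 - v| + (2 * √(p.1 * p.2) + p.2)) (v, 0) := by
    fun_prop
  obtain ⟨δ, hδ, hδε⟩ := Metric.continuousAt_iff.1 hcont ε hε
  refine ⟨δ, hδ, ?_⟩
  filter_upwards [hgood, eventually_ge_atTop 1] with n hn hn1
  intro ω hQω hWω
  have h3 := @hδε (quadForm n (q n) fun k => centered X P k ω, W n ω) (by
    rw [Prod.dist_eq, max_lt_iff]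
    exact ⟨hQω, hWω⟩)
  simp only [sub_self, abs_zero, mul_zero, Real.sqrt_zero, add_zero, Real.dist_eq, sub_zero] at h3
  have h4 : quadForm n (q n) (fun _ : Fin d → ℤ => sampleMean X n ω - ∫ ω', X 0 ω' ∂P) ≤
      W n ω := by
    refine (quadForm_const_le hn.1 hn.2 _).trans_eq ?_
    rw [sampleMean_sub_sq hn1, ← mul_assoc]
  have h5 := abs_quadForm_sub_sub_le n hn.1 (fun k => centered X P k ω)
    (fun _ => sampleMean X n ω - ∫ ω', X 0 ω' ∂P)
  rw [← sHatSq_eq_quadForm_centered X P n hn.1] at h5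
  have hQ0 := quadForm_nonneg n hn.1 fun k => centered X P k ω
  have h6 : √(quadForm n (q n) (fun k => centered X P k ω) *
      quadForm n (q n) (fun _ => sampleMean X n ω - ∫ ω', X 0 ω' ∂P)) ≤
      √(quadForm n (q n) (fun k => centered X P k ω) * W n ω) :=
    Real.sqrt_le_sqrt (mul_le_mul_of_nonneg_left h4 hQ0)
  have h7 := abs_sub_le (sHatSq X n (q n) ω) (quadForm n (q n) fun k => centered X P k ω) v
  have h8 := (abs_lt.1 h3).2
  linarith

end Consistency

/-! ### The variance estimator under long memory -/

section LongMemoryEstimate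

variable {d : ℕ}

/-- Potter's bound for the square of the regularly varying function `x ^ γ * L x`, with any exponent
`β < 2 γ`. -/
theorem IsSlowlyVarying.exists_sq_rpow_mul_le {L : ℝ → ℝ} (hL : IsSlowlyVarying L) {γ β : ℝ}
    (hβ : β < 2 * γ) : ∃ (C : ℝ) (N : ℕ), 0 < C ∧ 1 ≤ N ∧
      (∀ n : ℕ, N ≤ n → 0 < (n : ℝ) ^ γ * L n) ∧
      ∀ m n : ℕ, N ≤ m → m ≤ n →
        ((m : ℝ) ^ γ * L m) ^ 2 ≤ C * ((m : ℝ) / n) ^ β * ((n : ℝ) ^ γ * L n) ^ 2 := by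
  obtain ⟨x₀, hx₀, hpos, hle⟩ := hL.exists_le_rpow_mul (δ := (2 * γ - β) / 2) (by linarith)
  set δ := (2 * γ - β) / 2 with hδ
  have hN : ∀ n : ℕ, max 1 ⌈x₀⌉₊ ≤ n → (0 : ℝ) < n ∧ x₀ ≤ n := fun n hn =>
    ⟨by exact_mod_cast (le_max_left _ _).trans hn,
      (Nat.le_ceil _).trans (by exact_mod_cast (le_max_right _ _).trans hn)⟩
  refine ⟨Real.exp δ ^ 2, max 1 ⌈x₀⌉₊, by positivity, le_max_left _ _, fun n hn => ?_,
    fun m n hm hmn => ?_⟩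
  · exact mul_pos (Real.rpow_pos_of_pos (hN n hn).1 _) (hpos _ (hN n hn).2)
  obtain ⟨hm0, hmx⟩ := hN m hm
  obtain ⟨hn0, hnx⟩ := hN n (hm.trans hmn)
  have h1 := hle m hmx n (by exact_mod_cast hmn)
  have h2 : (m : ℝ) ^ γ * L m ≤
      Real.exp δ * ((m : ℝ) / n) ^ (γ - δ) * ((n : ℝ) ^ γ * L n) := by
    refine (mul_le_mul_of_nonneg_left h1 (Real.rpow_nonneg hm0.le γ)).trans_eq ?_
    rw [Real.rpow_sub (div_pos hm0 hn0), Real.div_rpow hm0.le hn0.le, Real.div_rpow hn0.le hm0.le,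
      Real.div_rpow hm0.le hn0.le]
    have := Real.rpow_pos_of_pos hm0 γ
    have := Real.rpow_pos_of_pos hm0 δ
    have := Real.rpow_pos_of_pos hn0 γ
    have := Real.rpow_pos_of_pos hn0 δ
    field_simp
  have h3 := pow_le_pow_left₀ (mul_pos (Real.rpow_pos_of_pos hm0 γ) (hpos _ hmx)).le h2 2
  refine h3.trans_eq ?_
  rw [mul_pow, mul_pow, ← Real.rpow_mul_natCast (div_pos hm0 hn0).le]
  congr 3
  rw [hδ]
  push_cast
  ring

/-- A bound at scale `n`, regular with exponent `β`, for the values of a nonnegative sequence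
bounded by a regularly varying one. The finitely many indices outside the range of the Potter
bound are compared with `n` through the first index inside it. -/
theorem exists_le_rpow_of_isBigO {L : ℝ → ℝ} (hL : IsSlowlyVarying L) {γ β : ℝ}
    (hβ0 : 0 ≤ β) (hβ : β < 2 * γ) {v : ℕ → ℝ} (hv0 : ∀ m, 0 ≤ v m)
    (hv : v =O[atTop] fun n : ℕ => (n : ℝ) ^ (2 * γ) * L n ^ 2) :
    ∃ (C : ℝ) (N : ℕ), 0 ≤ C ∧ 1 ≤ N ∧ (∀ n : ℕ, N ≤ n → 0 < (n : ℝ) ^ γ * L n) ∧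
      ∀ n M m : ℕ, N ≤ n → 1 ≤ M → M ≤ n → m ≤ M →
        v m ≤ C * ((M : ℝ) / n) ^ β * ((n : ℝ) ^ γ * L n) ^ 2 := by
  obtain ⟨C₁, N₁, hC₁, hN₁, hpos, hreg⟩ := hL.exists_sq_rpow_mul_le hβ
  obtain ⟨C₀, hC₀, hb⟩ := hv.exists_nonneg
  obtain ⟨N₀, hN₀⟩ := eventually_atTop.1 hb.bound
  have hsq : ∀ n : ℕ, (n : ℝ) ^ (2 * γ) * L n ^ 2 = ((n : ℝ) ^ γ * L n) ^ 2 := fun n => by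
    rw [mul_pow, ← Real.rpow_mul_natCast (Nat.cast_nonneg n), mul_comm 2 γ]
    norm_num
  have hlarge : ∀ m, N₀ ≤ m → v m ≤ C₀ * ((m : ℝ) ^ γ * L m) ^ 2 := fun m hm => by
    have := hN₀ m hm
    rwa [Real.norm_eq_abs, Real.norm_eq_abs, abs_of_nonneg (hv0 m), hsq,
      abs_of_nonneg (sq_nonneg _)] at this
  set N := max N₀ N₁
  have hNpos : 0 < (N : ℝ) ^ γ * L N := hpos N (le_max_right _ _)
  have hN1 : 1 ≤ N := hN₁.trans (le_max_right _ _)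
  set V := ∑ m ∈ Finset.range N, v m
  have hV0 : 0 ≤ V := Finset.sum_nonneg fun m _ => hv0 m
  set c := V / ((N : ℝ) ^ γ * L N) ^ 2 * (N : ℝ) ^ β with hc
  have hc0 : 0 ≤ c := by positivity
  refine ⟨(C₀ + c) * C₁, N, by positivity, hN1, fun n hn => hpos n ((le_max_right _ _).trans hn),
    fun n M m hn hM hMn hmM => ?_⟩
  have hn0 : (0 : ℝ) < n := by exact_mod_cast hN1.trans hn
  have hM0 : (1 : ℝ) ≤ M := by exact_mod_cast hM
  have hR : 0 ≤ C₁ * ((M : ℝ) / n) ^ β * ((n : ℝ) ^ γ * L n) ^ 2 := by positivity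
  rcases le_or_gt N m with hm | hm
  · have h1 := hreg m n ((le_max_right _ _).trans hm) (hmM.trans hMn)
    have h2 : C₁ * ((m : ℝ) / n) ^ β * ((n : ℝ) ^ γ * L n) ^ 2 ≤
        C₁ * ((M : ℝ) / n) ^ β * ((n : ℝ) ^ γ * L n) ^ 2 := by
      gcongr
    calc v m ≤ C₀ * ((m : ℝ) ^ γ * L m) ^ 2 := hlarge m ((le_max_left _ _).trans hm)
      _ ≤ C₀ * (C₁ * ((M : ℝ) / n) ^ β * ((n : ℝ) ^ γ * L n) ^ 2) :=
        mul_le_mul_of_nonneg_left (h1.trans h2) hC₀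
      _ ≤ (C₀ + c) * (C₁ * ((M : ℝ) / n) ^ β * ((n : ℝ) ^ γ * L n) ^ 2) :=
        mul_le_mul_of_nonneg_right (by linarith) hR
      _ = _ := by ring
  · have h1 := hreg N n (le_max_right _ _) hn
    have h2 : ((N : ℝ) / n) ^ β ≤ (N : ℝ) ^ β * ((M : ℝ) / n) ^ β := by
      rw [← Real.mul_rpow (Nat.cast_nonneg _) (by positivity)]
      refine Real.rpow_le_rpow (by positivity) ?_ hβ0
      rw [← mul_div_assoc]
      gcongr
      exact le_mul_of_one_le_right (Nat.cast_nonneg _) hM0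
    calc v m ≤ V := Finset.single_le_sum (fun i _ => hv0 i) (Finset.mem_range.2 hm)
      _ = V / ((N : ℝ) ^ γ * L N) ^ 2 * ((N : ℝ) ^ γ * L N) ^ 2 :=
        (div_mul_cancel₀ V (pow_pos hNpos 2).ne').symm
      _ ≤ V / ((N : ℝ) ^ γ * L N) ^ 2 *
          (C₁ * ((N : ℝ) ^ β * ((M : ℝ) / n) ^ β) * ((n : ℝ) ^ γ * L n) ^ 2) := by
        refine mul_le_mul_of_nonneg_left (h1.trans ?_) (by positivity)
        gcongr
      _ = c * (C₁ * ((M : ℝ) / n) ^ β * ((n : ℝ) ^ γ * L n) ^ 2) := by rw [hc]; ring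
      _ ≤ (C₀ + c) * (C₁ * ((M : ℝ) / n) ^ β * ((n : ℝ) ^ γ * L n) ^ 2) :=
        mul_le_mul_of_nonneg_right (by linarith) hR
      _ = _ := by ring

theorem window_eq_Icc (n q : ℕ) (m : Fin d → ℤ) : window n q m =
    Finset.Icc (fun i => max 1 (m i)) fun i => min (n : ℤ) (m i + ((q : ℤ) - 1)) := by
  ext k
  rw [mem_window, mem_cube, Finset.mem_Icc, Pi.le_def, Pi.le_def, Pi.le_def, Pi.le_def]
  simp only [Pi.add_apply, max_le_iff, le_min_iff, forall_and]
  tauto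

/-- The variance of a window sum is at most a constant times the largest variance of the sums over
the cubes of comparable side, although the windows at the boundary of `A_n` can be thin. -/
theorem exists_covSum_window_le (d : ℕ) : ∃ (C : ℝ) (K : ℕ), 0 < C ∧ 1 ≤ K ∧
    ∀ r : (Fin d → ℤ) → ℝ, (∀ j, r (-j) = r j) →
      (∀ (s : Finset (Fin d → ℤ)) (c : (Fin d → ℤ) → ℝ),
        0 ≤ ∑ k ∈ s, ∑ l ∈ s, c k * c l * r (k - l)) →
      ∀ (n q : ℕ) (m : Fin d → ℤ) (T : ℝ), 1 ≤ q →
        (∀ p ≤ K * q, covSum r (cube d p) ≤ T) → covSum r (window n q m) ≤ C * T := by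
  obtain ⟨C, K, hC, hK, h⟩ := exists_sum_box_le_sum_cube d
  refine ⟨C * K, K, mul_pos hC (by exact_mod_cast hK), hK, fun r hr hpd n q m T hq hT => ?_⟩
  have hq0 : (0 : ℝ) < q := by exact_mod_cast hq
  rw [window_eq_Icc, covSum_Icc]
  refine (h r hr hpd q _ hq fun i => ?_).trans ?_
  · have := le_max_right 1 (m i)
    have := min_le_right (n : ℤ) (m i + ((q : ℤ) - 1))
    omega
  · have h1 : ∑ p ∈ Finset.Icc 1 (K * q), covSum r (cube d p) ≤ (K * q : ℕ) * T := by
      refine (Finset.sum_le_card_nsmul _ _ T fun p hp => hT p (Finset.mem_Icc.1 hp).2).trans_eq ?_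
      rw [Nat.card_Icc, Nat.add_sub_cancel, nsmul_eq_mul]
    refine (mul_le_mul_of_nonneg_left h1 (by positivity)).trans_eq ?_
    push_cast
    field_simp

variable {Ω Ω' : Type*} [MeasurableSpace Ω] [MeasurableSpace Ω'] {X : (Fin d → ℤ) → Ω → ℝ}
  {P : Measure Ω} [IsProbabilityMeasure P] {P' : Measure Ω'} [IsProbabilityMeasure P']

/-- Under long memory the variance estimator is negligible at the scale of the partial sums. -/
theorem LongMemory.tendstoInMeasure_sHatSq {γ : ℝ} {L : ℝ → ℝ} {Y : Ω' → SkorokhodSpace d}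
    (h : LongMemory X P γ L Y P') (hd : 1 ≤ d) {q : ℕ → ℕ} (hq : Tendsto q atTop atTop)
    (hqn : Tendsto (fun n : ℕ => (q n : ℝ) / (n : ℝ)) atTop (𝓝 0)) :
    TendstoInMeasure P (fun (n : ℕ) ω => (n : ℝ) ^ d / ((n : ℝ) ^ γ * L n) ^ 2 * sHatSq X n (q n) ω)
      atTop fun _ => 0 := by
  have hd0 : d ≠ 0 := by omega
  have hX := h.stationary
  have hγ := h.exponent
  -- any exponent strictly between `d` and `2 γ`
  obtain ⟨β, hdβ, hβ⟩ := exists_between (show (d : ℝ) < 2 * γ by linarith)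
  have hβ0 : 0 ≤ β := (Nat.cast_nonneg d).trans hdβ.le
  have hvar : (fun n : ℕ => covSum (autocov X P) (cube d n)) =O[atTop]
      fun n : ℕ => (n : ℝ) ^ (2 * γ) * L n ^ 2 := by
    simpa only [hX.variance_sum_eq] using h.variance
  obtain ⟨C₁, N, hC₁, hN1, hpos, hv⟩ := exists_le_rpow_of_isBigO h.slowlyVarying hβ0 hβ
    (fun m => hX.covSum_nonneg (cube d m)) hvar
  obtain ⟨C₂, K, hC₂, hK, hw⟩ := exists_covSum_window_le d
  have hK0 : (0 : ℝ) < K := by exact_mod_cast hK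
  set U : ℕ → Ω → ℝ := fun n ω => (n : ℝ) ^ d / ((n : ℝ) ^ γ * L n) ^ 2 *
    (2 * quadForm n (q n) (fun k => centered X P k ω) +
      2 * (2 ^ d * (q n : ℝ) ^ d * (((n : ℝ) ^ d)⁻¹) ^ 2 *
        (∑ k ∈ cube d n, centered X P k ω) ^ 2)) with hU
  have hgood : ∀ᶠ n in atTop, N ≤ n ∧ 1 ≤ q n ∧ K * q n ≤ n := by
    filter_upwards [hq.eventually_ge_atTop 1,
      hqn.eventually_le_const (show (0 : ℝ) < (K : ℝ)⁻¹ by positivity),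
      eventually_ge_atTop N] with n h1 h2 h3
    refine ⟨h3, h1, ?_⟩
    have hn : (0 : ℝ) < n := by exact_mod_cast hN1.trans h3
    rw [div_le_iff₀ hn, inv_mul_eq_div, le_div_iff₀ hK0, mul_comm] at h2
    exact_mod_cast h2
  have hU0 : ∀ᶠ n in atTop, ∀ ω, 0 ≤ U n ω := by
    filter_upwards [hgood] with n hn
    intro ω
    have := quadForm_nonneg n hn.2.1 fun k => centered X P k ω
    positivity
  have hint : ∀ n, Integrable (U n) P := fun n =>
    (((hX.integrable_quadForm n (q n)).const_mul 2).add
      (((hX.integrable_sum_sq (cube d n)).const_mul _).const_mul 2)).const_mul _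
  have hbound : ∀ᶠ n in atTop, ∫ ω, U n ω ∂P ≤
      2 * (2 ^ d * (C₂ * (C₁ * (K : ℝ) ^ β))) * ((q n : ℝ) / n) ^ (β - d) +
        2 * (2 ^ d * C₁) * ((q n : ℝ) / n) ^ d := by
    filter_upwards [hgood] with n ⟨hNn, hqn1, hKq⟩
    have hn0 : (0 : ℝ) < n := by exact_mod_cast hN1.trans hNn
    have hq0 : (0 : ℝ) < q n := by exact_mod_cast hqn1
    obtain ⟨a, ha'⟩ : ∃ a, a = (n : ℝ) ^ γ * L n := ⟨_, rfl⟩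
    have ha : 0 < a := ha' ▸ hpos n hNn
    have hv := hv n
    rw [← ha'] at hv
    have hqn' : q n ≤ n := (Nat.le_mul_of_pos_left _ hK).trans hKq
    have h1 : ∫ ω, quadForm n (q n) (fun k => centered X P k ω) ∂P ≤
        ((n : ℝ) ^ d)⁻¹ * ((q n : ℝ) ^ d)⁻¹ * (2 ^ d * (n : ℝ) ^ d *
          (C₂ * (C₁ * (((K * q n : ℕ) : ℝ) / n) ^ β * a ^ 2))) := by
      rw [hX.integral_quadForm_eq_sum_windows n hqn1]
      refine mul_le_mul_of_nonneg_left ?_ (by positivity)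
      refine (Finset.sum_le_card_nsmul _ _ _ fun m _ =>
        hw _ hX.autocov_neg hX.autocov_posDef n (q n) m _ hqn1 fun p hp =>
          hv (K * q n) p hNn (Nat.mul_pos hK hqn1) hKq hp).trans ?_
      rw [nsmul_eq_mul]
      exact mul_le_mul_of_nonneg_right (card_windowCorners_le hqn1 hqn') (by positivity)
    have h2 : ∫ ω, (∑ k ∈ cube d n, centered X P k ω) ^ 2 ∂P ≤ C₁ * a ^ 2 := by
      rw [hX.integral_sum_sq]
      refine (hv n n hNn (hN1.trans hNn) le_rfl le_rfl).trans_eq ?_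
      rw [div_self hn0.ne', Real.one_rpow, mul_one]
    simp only [hU]
    rw [← ha', integral_const_mul, integral_add ((hX.integrable_quadForm n (q n)).const_mul 2)
      (((hX.integrable_sum_sq (cube d n)).const_mul _).const_mul 2), integral_const_mul,
      integral_const_mul, integral_const_mul]
    have h3 := add_le_add (mul_le_mul_of_nonneg_left h1 zero_le_two)
      (mul_le_mul_of_nonneg_left (mul_le_mul_of_nonneg_left h2 (show (0 : ℝ) ≤
        2 ^ d * (q n : ℝ) ^ d * (((n : ℝ) ^ d)⁻¹) ^ 2 by positivity)) zero_le_two)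
    refine (mul_le_mul_of_nonneg_left h3 (by positivity)).trans_eq ?_
    rw [Real.rpow_sub (div_pos hq0 hn0), Real.rpow_natCast]
    push_cast
    rw [mul_div_assoc, Real.mul_rpow hK0.le (div_pos hq0 hn0).le, div_pow]
    field_simp
  have hlim : TendstoInMeasure P U atTop fun _ => 0 := by
    refine tendstoInMeasure_zero_of_integral hint hU0 ?_
    refine tendsto_of_tendsto_of_tendsto_of_le_of_le' tendsto_const_nhds ?_
      (hU0.mono fun n hn => integral_nonneg hn) hbound
    have h1 := (hqn.rpow_const (p := β - d) (Or.inr (by linarith))).const_mul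
      (2 * (2 ^ d * (C₂ * (C₁ * (K : ℝ) ^ β))))
    have h2 := (hqn.pow d).const_mul (2 * (2 ^ d * C₁))
    have := h1.add h2
    rwa [Real.zero_rpow (by linarith), zero_pow hd0, mul_zero, mul_zero, add_zero] at this
  refine tendstoInMeasure_of_implication hlim hlim fun ε hε => ⟨ε, hε, ?_⟩
  filter_upwards [hgood] with n ⟨hNn, hqn1, hKq⟩
  intro ω h1 _
  have hqn' : q n ≤ n := (Nat.le_mul_of_pos_left _ hK).trans hKq
  refine lt_of_le_of_lt ?_ ((le_abs_self _).trans_lt h1)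
  have hs := sHatSq_eq_quadForm_centered X P n hqn1 ω
  rw [sub_zero, sub_zero, abs_of_nonneg (mul_nonneg (by positivity)
    (hs.symm ▸ quadForm_nonneg n hqn1 _)), hs]
  refine mul_le_mul_of_nonneg_left ((quadForm_sub_le n hqn1 (fun k => centered X P k ω)
    fun _ => sampleMean X n ω - ∫ ω', X 0 ω' ∂P).trans ?_) (by positivity)
  have := quadForm_const_le (d := d) hqn1 hqn' (sampleMean X n ω - ∫ ω', X 0 ω' ∂P)
  rw [sampleMean_sub_sq (hN1.trans hNn), ← mul_assoc] at this
  linarith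

end LongMemoryEstimate

/-! ### Convergence of the statistic -/

section Convergence

/-- The portmanteau theorem for closed sets. -/
theorem limsup_measure_preimage_le {Ω Ω' : Type*} [MeasurableSpace Ω] [MeasurableSpace Ω']
    {P : Measure Ω} [IsProbabilityMeasure P] {P' : Measure Ω'} [IsProbabilityMeasure P']
    {T : ℕ → Ω → ℝ} {Z : Ω' → ℝ} (h : TendstoInDistribution T atTop Z (fun _ => P) P')
    {F : Set ℝ} (hF : IsClosed F) :
    limsup (fun n => P (T n ⁻¹' F)) atTop ≤ P' (Z ⁻¹' F) := by
  have := ProbabilityMeasure.limsup_measure_closed_le_of_tendsto h.tendsto hF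
  simp only [ProbabilityMeasure.coe_mk] at this
  rw [Measure.map_apply_of_aemeasurable h.aemeasurable_limit hF.measurableSet] at this
  refine le_of_eq_of_le (limsup_congr (Eventually.of_forall fun n => ?_)) this
  exact (Measure.map_apply_of_aemeasurable (h.forall_aemeasurable n) hF.measurableSet).symm

theorem tendstoInMeasure_const_fun {Ω : Type*} [MeasurableSpace Ω] (P : Measure Ω) {e : ℕ → ℝ}
    {c : ℝ} (he : Tendsto e atTop (𝓝 c)) :
    TendstoInMeasure P (fun n _ => e n) atTop fun _ => c := by
  rw [tendstoInMeasure_iff_dist]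
  intro ε hε
  refine tendsto_const_nhds.congr' ?_
  filter_upwards [Metric.tendsto_nhds.1 he ε hε] with n hn
  simp [not_le.2 hn]

/-- A sequence converging in distribution is tight, so deterministic factors tending to zero make it
negligible. -/
theorem tendstoInMeasure_mul_of_tendstoInDistribution {Ω Ω' : Type*} [MeasurableSpace Ω]
    [MeasurableSpace Ω'] {P : Measure Ω} [IsProbabilityMeasure P] {P' : Measure Ω'}
    [IsProbabilityMeasure P'] {T : ℕ → Ω → ℝ} {Z : Ω' → ℝ}
    (h : TendstoInDistribution T atTop Z (fun _ => P) P') {e : ℕ → ℝ}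
    (he : Tendsto e atTop (𝓝 0)) :
    TendstoInMeasure P (fun n ω => e n * T n ω) atTop fun _ => 0 := by
  have h1 := h.continuous_comp_prodMk_of_tendstoInMeasure_const
    (g := fun p : ℝ × ℝ => p.2 * p.1) (by fun_prop) (tendstoInMeasure_const_fun P he)
    fun _ => aemeasurable_const
  rw [tendstoInMeasure_iff_dist]
  intro ε hε
  have h2 := limsup_measure_preimage_le h1 (F := {x | ε ≤ dist x 0})
    (isClosed_le continuous_const (continuous_id.dist continuous_const))
  have h3 : (fun ω => (fun p : ℝ × ℝ => p.2 * p.1) (Z ω, 0)) ⁻¹' {x | ε ≤ dist x 0} = ∅ := by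
    ext ω
    simp [hε]
  rw [h3, measure_empty] at h2
  exact tendsto_of_le_liminf_of_limsup_le bot_le h2

variable {d : ℕ} {Ω Ω' : Type*} [MeasurableSpace Ω] [MeasurableSpace Ω'] {X : (Fin d → ℤ) → Ω → ℝ}
  {P : Measure Ω} {P' : Measure Ω'}

theorem aemeasurable_sampleMean (hX : ∀ k, AEMeasurable (X k) P) (n : ℕ) :
    AEMeasurable (sampleMean X n) P :=
  (Finset.aemeasurable_fun_sum _ fun k _ => hX k).const_mul _

theorem aemeasurable_sHatSq (hX : ∀ k, AEMeasurable (X k) P) (n q : ℕ) :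
    AEMeasurable (sHatSq X n q) P := by
  have h := aemeasurable_sampleMean hX n
  exact Finset.aemeasurable_fun_sum _ fun j _ => ((Finset.aemeasurable_fun_sum _ fun k _ =>
    ((hX k).sub h).mul ((hX (k + j)).sub h)).const_mul _).const_mul _

theorem aemeasurable_sStarVar (hX : ∀ k, AEMeasurable (X k) P) (n : ℕ) :
    AEMeasurable (sStarVar X n) P := by
  have h : ∀ j, AEMeasurable (sStar X n j) P := fun j =>
    Finset.aemeasurable_fun_sum _ fun k _ => (hX k).sub (aemeasurable_sampleMean hX n)
  exact (Finset.aemeasurable_fun_sum _ fun j _ => ((h j).sub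
    ((Finset.aemeasurable_fun_sum _ fun j _ => h j).const_mul _)).pow_const 2).const_mul _

variable [IsProbabilityMeasure P] [IsProbabilityMeasure P']

/-- The numerator of the statistic is, up to the discretization error, a continuous functional of
the partial-sum process. -/
theorem tendstoInDistribution_sStarVar {a : ℕ → ℝ} {Z : Ω' → SkorokhodSpace d}
    (hX : ∀ k, AEMeasurable (X k) P)
    (h : TendstoInDistribution (fun n : ℕ => partialSumProcess X P n (a n)) atTop Z
      (fun _ => P) P') :
    TendstoInDistribution (fun n ω => (a n)⁻¹ ^ 2 * sStarVar X n ω) atTop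
      (fun ω => vsFunctional (Z ω)) (fun _ => P) P' := by
  have h1 := h.continuous_comp (continuous_vsFunctional (d := d))
  have h2 := h.continuous_comp ((SkorokhodSpace.continuous_supNorm (d := d)).pow 2)
  have h3 := tendstoInMeasure_mul_of_tendstoInDistribution h2 (tendsto_discretizationError d)
  refine tendstoInDistribution_of_tendstoInMeasure_sub _ _ h1 ?_
    fun n => (aemeasurable_sStarVar hX n).const_mul _
  refine tendstoInMeasure_of_implication (z := 0) h3 h3 fun ε hε => ⟨ε, hε, ?_⟩
  filter_upwards [eventually_ge_atTop 2] with n hn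
  intro ω hω _
  rw [sub_zero] at hω ⊢
  exact (abs_sStarVar_sub_le X P hn (a n) ω).trans_lt ((le_abs_self _).trans_lt hω)

theorem ShortMemory.tendstoInDistribution_vsStat {B : Ω' → SkorokhodSpace d}
    (h : ShortMemory X P B P') (hd : 1 ≤ d) {q : ℕ → ℕ} (hq : Tendsto q atTop atTop)
    (hqn : Tendsto (fun n : ℕ => (q n : ℝ) / (n : ℝ)) atTop (𝓝 0)) :
    TendstoInDistribution (fun n : ℕ => vsStat X n (q n)) atTop
      (fun ω => vsFunctional (B ω)) (fun _ => P) P' := by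
  have hX : ∀ k, AEMeasurable (X k) P := fun k => (h.stationary.memLp k).1.aemeasurable
  have hv := h.pos
  have hV := tendstoInDistribution_sStarVar hX h.invariance
  have hs := tendstoInMeasure_sHatSq h.stationary h.summable h.cumulants hd hq hqn
  have hratio : TendstoInMeasure P (fun n ω => longRunVar X P / sHatSq X n (q n) ω) atTop
      fun _ => 1 := by
    refine tendstoInMeasure_of_implication hs hs fun ε hε => ?_
    have hcont : ContinuousAt (fun x : ℝ => longRunVar X P / x) (longRunVar X P) :=
      continuousAt_const.div continuousAt_id hv.ne'
    obtain ⟨δ, hδ, H⟩ := Metric.continuousAt_iff.1 hcont ε hε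
    refine ⟨δ, hδ, Eventually.of_forall fun n ω h1 _ => ?_⟩
    have := @H (sHatSq X n (q n) ω) h1
    rwa [div_self hv.ne', Real.dist_eq] at this
  have hprod := hV.continuous_comp_prodMk_of_tendstoInMeasure_const
    (g := fun p : ℝ × ℝ => p.1 * p.2) (by fun_prop) hratio
    fun n => (aemeasurable_sHatSq hX n (q n)).const_div _
  refine hprod.congr (fun n => ae_of_all _ fun ω => ?_) (ae_of_all _ fun ω => mul_one _)
  have ha : (√(longRunVar X P) * (n : ℝ) ^ ((d : ℝ) / 2)) ^ 2 = longRunVar X P * (n : ℝ) ^ d := by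
    rw [mul_pow, Real.sq_sqrt hv.le, ← Real.rpow_mul_natCast (Nat.cast_nonneg n)]
    push_cast
    rw [div_mul_cancel₀ _ two_ne_zero, Real.rpow_natCast]
  simp only [vsStat]
  rw [inv_pow, ha, mul_inv]
  field_simp

/-- Under long memory the statistic diverges: the numerator has an almost surely positive limit at
the scale at which the denominator is negligible. -/
theorem LongMemory.tendsto_measure_vsStat_le {γ : ℝ} {L : ℝ → ℝ} {Y : Ω' → SkorokhodSpace d}
    (h : LongMemory X P γ L Y P') (hd : 1 ≤ d) {q : ℕ → ℕ} (hq : Tendsto q atTop atTop)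
    (hqn : Tendsto (fun n : ℕ => (q n : ℝ) / (n : ℝ)) atTop (𝓝 0)) (K : ℝ) :
    Tendsto (fun n : ℕ => P {ω | vsStat X n (q n) ω ≤ K}) atTop (𝓝 0) := by
  have hX : ∀ k, AEMeasurable (X k) P := fun k => (h.stationary.memLp k).1.aemeasurable
  have hV := tendstoInDistribution_sStarVar hX h.invariance
  have hs := h.tendstoInMeasure_sHatSq hd hq hqn
  rw [tendstoInMeasure_iff_dist] at hs
  -- the limit of the numerator puts no mass near zero
  have hzero : Tendsto (fun k : ℕ => P' ((fun ω => vsFunctional (Y ω)) ⁻¹'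
      Set.Iic (1 / ((k : ℝ) + 1)))) atTop (𝓝 0) := by
    have hlim := tendsto_measure_iInter_atTop (μ := P')
      (s := fun k : ℕ => (fun ω => vsFunctional (Y ω)) ⁻¹' Set.Iic (1 / ((k : ℝ) + 1)))
      (fun k => hV.aemeasurable_limit.nullMeasurableSet_preimage measurableSet_Iic)
      (fun i j hij => Set.preimage_mono (Set.Iic_subset_Iic.2 (Nat.one_div_le_one_div hij)))
      ⟨0, measure_ne_top _ _⟩
    have hnull : P' (⋂ k : ℕ, (fun ω => vsFunctional (Y ω)) ⁻¹' Set.Iic (1 / ((k : ℝ) + 1))) =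
        0 := by
      refine measure_eq_zero_iff_ae_notMem.2 ?_
      filter_upwards [h.nondegenerate] with ω hω
      obtain ⟨k, hk⟩ := exists_nat_one_div_lt (vsFunctional_pos hω)
      exact fun hmem => absurd (Set.mem_iInter.1 hmem k) (not_le.2 hk)
    rwa [hnull] at hlim
  rw [ENNReal.tendsto_nhds_zero]
  intro ε hε
  have hε2 : 0 < ε / 2 := ENNReal.half_pos hε.ne'
  obtain ⟨k, hk⟩ := (hzero.eventually_lt_const hε2).exists
  set η : ℝ := 1 / ((k : ℝ) + 1) with hη'
  have hη : 0 < η := by positivity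
  set K' := max K 1
  have hK' : 0 < K' := zero_lt_one.trans_le (le_max_right _ _)
  have hnum := eventually_lt_of_limsup_lt
    ((limsup_measure_preimage_le hV (F := Set.Iic η) isClosed_Iic).trans_lt hk)
  have hden := (hs (η / K') (by positivity)).eventually_lt_const hε2
  filter_upwards [hnum, hden, hq.eventually_ge_atTop 1, eventually_ge_atTop 1] with n h1 h2 h3 hn
  refine (measure_mono (t := (fun ω => ((n : ℝ) ^ γ * L n)⁻¹ ^ 2 * sStarVar X n ω) ⁻¹' Set.Iic η ∪
    {ω | η / K' ≤ dist ((n : ℝ) ^ d / ((n : ℝ) ^ γ * L n) ^ 2 * sHatSq X n (q n) ω) 0})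
    fun ω hω => ?_).trans ((measure_union_le _ _).trans
      ((add_le_add h1.le h2.le).trans_eq (ENNReal.add_halves ε)))
  rw [Set.mem_union, or_iff_not_imp_right]
  intro hsmall
  rw [Set.mem_ofPred_eq, not_le] at hsmall
  rw [Set.mem_preimage, Set.mem_Iic]
  have hn' : (0 : ℝ) < (n : ℝ) ^ d := pow_pos (by exact_mod_cast hn) d
  have hs0 : 0 ≤ sHatSq X n (q n) ω := by
    rw [sHatSq_eq_quadForm X n h3]
    exact quadForm_nonneg n h3 _
  -- if `ŝ_n² = 0` the data are constant, and the quotient `0 / 0 = 0` in the statistic must be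
  -- accounted for: the numerator then vanishes as well
  rcases hs0.eq_or_lt with hs0 | hs0
  · rw [sStarVar_eq_zero_of_sHatSq_eq_zero hn h3 hs0.symm, mul_zero]
    exact hη.le
  · have hM : ((n : ℝ) ^ d)⁻¹ * (sStarVar X n ω / sHatSq X n (q n) ω) ≤ K' :=
      le_trans hω (le_max_left _ _)
    rw [inv_mul_le_iff₀ hn', div_le_iff₀ hs0] at hM
    have hlt := (le_abs_self _).trans_lt hsmall
    rw [sub_zero, lt_div_iff₀ hK'] at hlt
    refine (mul_le_mul_of_nonneg_left hM (by positivity)).trans (le_trans (le_of_eq ?_) hlt.le)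
    rw [inv_pow, div_eq_mul_inv]
    ring

end Convergence

end VSTest

theorem proposition1 {d : ℕ} (hd : 1 ≤ d)
    {Ω : Type*} [MeasurableSpace Ω] (P : Measure Ω) [IsProbabilityMeasure P]
    {Ω' : Type*} [MeasurableSpace Ω'] (P' : Measure Ω') [IsProbabilityMeasure P']
    (X : (Fin d → ℤ) → Ω → ℝ) (q : ℕ → ℕ) (hq : Tendsto q atTop atTop)
    (hqn : Tendsto (fun n : ℕ => (q n : ℝ) / (n : ℝ)) atTop (𝓝 0)) :
    (∀ B : Ω' → VSTest.SkorokhodSpace d, VSTest.ShortMemory X P B P' →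
      TendstoInDistribution (fun n : ℕ => VSTest.vsStat X n (q n)) atTop
        (fun ω => VSTest.vsFunctional (B ω)) (fun _ => P) P') ∧
    (∀ (γ : ℝ) (L : ℝ → ℝ) (Y : Ω' → VSTest.SkorokhodSpace d),
      VSTest.LongMemory X P γ L Y P' →
      ∀ K : ℝ, Tendsto (fun n : ℕ => P {ω | VSTest.vsStat X n (q n) ω ≤ K}) atTop (𝓝 0)) :=
  ⟨fun _ h => h.tendstoInDistribution_vsStat hd hq hqn,
    fun _ _ _ h => h.tendsto_measure_vsStat_le hd hq hqn⟩
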